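/- **Conventions.** A quantum query algorithm with $q$ queries starts in a computational basis state of a query register together with a finite workspace, applies unitaries $U_0,\dots,U_q$ (independent of the input function) interleaved with $q$ applications of the oracle to the query register, measures in the computational basis, and outputs a function of the outcome. For $f:\mathbb F_2^n\to\mathbb F_2$ the oracle is $|x\rangle|b\rangle\mapsto|x\rangle|b+f(x)\rangle$; for $f:\mathbb F_p^n\to\mathbb C$ with values of modulus one it is $|x\rangle\mapsto f(x)|x\rangle$. Let $\delta(f,g)=2^{-n}|\{x:f(x)\ne g(x)\}|$ for $f,g:\mathbb F_2^n\to\mathbb F_2$, and let $\delta_{\mathrm{RM}_2}(f)$ be the minimum of $\delta(f,g)$ over all polynomials $g$ of degree at most $2$. For $p$ prime put $\omega_p=e^{2\pi i/p}$ and, for $f:\mathbb F_p^n\to\mathbb C$, let $\widehat f(y)=\mathbb E_x f(x)\omega_p^{-\langle x,y\rangle}$, $\Delta_hf(x)=f(x+h)\overline{f(x)}$ and $\|f\|_{U^3}=(\mathbb E_{x,h_1,h_2,h_3}\Delta_{h_3}\Delta_{h_2}\Delta_{h_1}f(x))^{1/8}$. A polynomial phase function is a function $f(x)=\omega_p^{P(x)}$,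 where $P$ is a polynomial over $\mathbb F_p$ in $n$ variables of degree at most $p-1$ in each variable. **Theorem.** (1) There is an absolute constant $C>0$ such that for every $\varepsilon>0$ the following holds with $\eta=\exp(-1/\varepsilon^{C})$. There is a constant $K_\varepsilon>0$ depending only on $\varepsilon$ and, for each $n$, a quantum query algorithm, making at most $K_\varepsilon\, n\log n$ queries when $n\ge 2$, that for every $f:\mathbb F_2^n\to\mathbb F_2$ with $\delta_{\mathrm{RM}_2}(f)\le\frac12-\varepsilon$ returns, with probability at least $2/3$, a polynomial $g$ over $\mathbb F_2$ in $n$ variables of degree at most $2$ with $\delta(f,g)\le\frac12-\eta$. (2) For every prime $p$ there is an integer $K\ge1$ such that for every $\gamma>0$ and every $n$ there is a quantum query algorithm, making at most $K\gamma^{-K}\,n\log n$ queries when $n\ge2$, that for every polynomial phase function $f:\mathbb F_p^n\to\mathbb C$ with $\|f\|_{U^3}\ge\gamma$ returns, with probability at least $\gamma^{K}/K$, a matrix $M\in\mathbb F_p^{n\times n}$ with $$\mathbb E_{h\in\mathbb F_p^n}\big|\widehat{\Delta_hf}(Mh)\big|^2\ \ge\ \exp(-K\gamma^{-K}).$$ 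-/

import Mathlib

open scoped BigOperators Matrix Kronecker

noncomputable section

namespace QuadraticDecoding

/-! ### Quantum query algorithms -/

/-- A quantum query algorithm with query register indexed by `Q` and outputs in `R`.
Its state space is `ℂ^Q ⊗ ℂ^W` for a finite workspace `W`. It starts in the computational basis
state `init`, applies `U 0, O, U 1, O, …, O, U queries` with `O` the oracle, measures in the
computational basis and maps the outcome to an element of `R`. Only `U 0, …, U queries` matter.
Internal randomness, intermediate measurements and adaptivity are covered by deferring all
measurements to the end. -/
structure QueryAlgorithm (Q R : Type) [Fintype Q] [DecidableEq Q] where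
  W : Type
  [fintypeW : Fintype W]
  [decEqW : DecidableEq W]
  queries : ℕ
  init : Q × W
  U : ℕ → Matrix.unitaryGroup (Q × W) ℂ
  output : Q × W → R

attribute [instance] QueryAlgorithm.fintypeW QueryAlgorithm.decEqW

namespace QueryAlgorithm

variable {Q R : Type} [Fintype Q] [DecidableEq Q]

/-- The state vector after the `k`-th oracle call and the unitary `U k` that follows it. The
oracle acts on the query register and as the identity on the workspace. -/
def state (A : QueryAlgorithm Q R) (O : Matrix Q Q ℂ) : ℕ → (Q × A.W → ℂ)
  | 0 => (A.U 0 : Matrix (Q × A.W) (Q × A.W) ℂ) *ᵥ Pi.single A.init 1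
  | k + 1 => (A.U (k + 1) : Matrix (Q × A.W) (Q × A.W) ℂ) *ᵥ
      ((O ⊗ₖ (1 : Matrix A.W A.W ℂ)) *ᵥ A.state O k)

/-- The probability that the output of `A`, run with the oracle `O`, lies in `S`. -/
def prob (A : QueryAlgorithm Q R) (O : Matrix Q Q ℂ) (S : Set R) : ℝ :=
  ∑ s : Q × A.W, Set.indicator {s | A.output s ∈ S} (fun s => ‖A.state O A.queries s‖ ^ 2) s

end QueryAlgorithm

/-- The bit-flip oracle `|x⟩|b⟩ ↦ |x⟩|b + f x⟩` of `f : 𝔽₂ⁿ → 𝔽₂`. -/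
def bitOracle {n : ℕ} (f : (Fin n → ZMod 2) → ZMod 2) :
    Matrix ((Fin n → ZMod 2) × ZMod 2) ((Fin n → ZMod 2) × ZMod 2) ℂ :=
  Matrix.of fun s t => if s = (t.1, t.2 + f t.1) then 1 else 0

/-- The phase oracle `|x⟩ ↦ f x |x⟩`. -/
def phaseOracle {p n : ℕ} (f : (Fin n → ZMod p) → ℂ) :
    Matrix (Fin n → ZMod p) (Fin n → ZMod p) ℂ :=
  Matrix.diagonal f

/-! ### Quadratic Reed-Muller codewords -/

/-- The normalized Hamming distance between two functions on `𝔽₂ⁿ`. -/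
def relDist {n : ℕ} (f g : (Fin n → ZMod 2) → ZMod 2) : ℝ :=
  (hammingDist f g : ℝ) / 2 ^ n

/-- The Reed-Muller codewords of degree at most `2`: evaluations on all of `𝔽₂ⁿ` of polynomials
of total degree at most `2`. -/
def RM2 (n : ℕ) : Set ((Fin n → ZMod 2) → ZMod 2) :=
  {c | ∃ P : MvPolynomial (Fin n) (ZMod 2), P.totalDegree ≤ 2 ∧ ∀ x, c x = MvPolynomial.eval x P}

/-- The minimal normalized distance from `f` to a Reed-Muller codeword of degree at most `2`
(the infimum is over a finite nonempty set). -/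
def distRM2 {n : ℕ} (f : (Fin n → ZMod 2) → ZMod 2) : ℝ :=
  sInf (relDist f '' RM2 n)

/-! ### Higher-order Fourier analysis over `𝔽ₚⁿ` -/

section Fourier

variable {p n : ℕ} [Fact p.Prime]

/-- A polynomial phase function `x ↦ ω_p ^ P(x)`, with `ω_p = exp (2πi/p)` and `P` of degree at
most `p - 1` in every variable. -/
def IsPolynomialPhase (f : (Fin n → ZMod p) → ℂ) : Prop :=
  ∃ P : MvPolynomial (Fin n) (ZMod p), (∀ i, P.degreeOf i ≤ p - 1) ∧
    ∀ x, f x = ZMod.stdAddChar (MvPolynomial.eval x P)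

/-- The multiplicative derivative `Δ_h f (x) = f (x + h) * conj (f x)`. -/
def mulDeriv (h : Fin n → ZMod p) (f : (Fin n → ZMod p) → ℂ) : (Fin n → ZMod p) → ℂ :=
  fun x => f (x + h) * starRingEnd ℂ (f x)

/-- The Fourier coefficient `𝔼_x f x * ω_p ^ (-⟨x, y⟩)`. -/
def fourierCoeff (f : (Fin n → ZMod p) → ℂ) (y : Fin n → ZMod p) : ℂ :=
  Finset.expect Finset.univ fun x => f x * ZMod.stdAddChar (-(x ⬝ᵥ y))

/-- The average `𝔼_{h₁, …, h_d, x} Δ_{h_d} ⋯ Δ_{h₁} f (x)`. -/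
def gowersAverage : ℕ → ((Fin n → ZMod p) → ℂ) → ℂ
  | 0, f => Finset.expect Finset.univ f
  | d + 1, f => Finset.expect Finset.univ fun h => gowersAverage d (mulDeriv h f)

/-- The Gowers `U^d`-norm, for `d ≥ 1` (the average is then a nonnegative real number). -/
def gowersNorm (d : ℕ) (f : (Fin n → ZMod p) → ℂ) : ℝ :=
  (gowersAverage d f).re ^ ((1 : ℝ) / 2 ^ d)

end Fourier

end QuadraticDecoding

end

/-!
The weights `p⁻ⁿ |(Δ_h f)^(y)|²` form a probability distribution on the pairs `(h, y)`, and a sample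
of it costs a bounded number of queries: put `∏ f(xᵢ)^{±1}` into the phase of a uniform
superposition and apply the quantum Fourier transform.

If `f` is close to a quadratic, this distribution gives large mass to the graph of the associated
polar form. If only the `U³` norm is large, one uses that the weights `|(Δ_h f)^(y)|²` are their own
symplectic Fourier transform up to scaling: a set carrying much of the mass then has many additive
pairs, and the theorems of Balog–Szemerédi–Gowers and Freiman yield a subspace of size `O(pⁿ)` that
still has large mass.

The samples lying in a subspace are spanned by at most `dim` of them, so by a union bound over such
spanning families `O(n)` samples suffice for the following to hold with high probability: every
subspace that contains many of the samples has large mass. Any heavy subspace found among the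
samples is therefore as good as the one whose existence was shown. In characteristic two, a
quadratic whose polar graph catches many samples has an affine twist correlating with `f`, which is
found by comparing with further samples of `f`. In general, one takes a random linear map whose
graph lies in the subspace above the projection of the latter; the second moment of its total
weight shows that it succeeds with probability at least `1/2`.
-/

noncomputable section

namespace QuadraticDecoding

/-! ### Finite probability distributions -/

section Mass

variable {α β : Type*} [Fintype α] [Fintype β] {D : α → ℝ}

/-- The total weight of a set; the probability of an event when `D ∈ stdSimplex ℝ α`. -/
def mass (D : α → ℝ) (S : Set α) : ℝ := ∑ a, S.indicator D a

/-- The product of two weights; the distribution of a pair of independent samples. -/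
def prodDist (D₁ : α → ℝ) (D₂ : β → ℝ) : α × β → ℝ := fun t => D₁ t.1 * D₂ t.2

lemma mass_nonneg (hD : ∀ a, 0 ≤ D a) (S : Set α) : 0 ≤ mass D S :=
  Finset.sum_nonneg fun _ _ => Set.indicator_nonneg (fun a _ => hD a) _

lemma mass_mono (hD : ∀ a, 0 ≤ D a) {S T : Set α} (h : S ⊆ T) : mass D S ≤ mass D T :=
  Finset.sum_le_sum fun a _ => Set.indicator_le_indicator_of_subset h hD a

lemma mass_univ (D : α → ℝ) : mass D Set.univ = ∑ a, D a := by
  simp only [mass, Set.indicator_univ]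

lemma mass_le_one {D : α → ℝ} (hD : D ∈ stdSimplex ℝ α) (S : Set α) : mass D S ≤ 1 := by
  rw [← hD.2, ← mass_univ]
  exact mass_mono hD.1 S.subset_univ

lemma mass_eq_sum_mul_indicator_one (D : α → ℝ) (S : Set α) :
    mass D S = ∑ a, D a * S.indicator 1 a := by
  classical
  exact Finset.sum_congr rfl fun a _ => by simp [Set.indicator_apply]

lemma mass_compl (hD : D ∈ stdSimplex ℝ α) (S : Set α) : mass D Sᶜ = 1 - mass D S := by
  rw [eq_sub_iff_add_eq, mass, mass, ← Finset.sum_add_distrib, ← hD.2]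
  exact Finset.sum_congr rfl fun a _ => congrFun (Set.indicator_compl_add_self S D) a

lemma mass_iUnion_le {ι : Type*} [Fintype ι] (hD : ∀ a, 0 ≤ D a) (S : ι → Set α) :
    mass D (⋃ j, S j) ≤ ∑ j, mass D (S j) := by
  simp only [mass]
  rw [Finset.sum_comm]
  refine Finset.sum_le_sum fun a _ => ?_
  have hnonneg : ∀ j, 0 ≤ (S j).indicator D a := fun j => Set.indicator_nonneg (fun a _ => hD a) a
  by_cases ha : a ∈ ⋃ j, S j
  · obtain ⟨j, hj⟩ := Set.mem_iUnion.1 ha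
    calc (⋃ j, S j).indicator D a = (S j).indicator D a := by
          rw [Set.indicator_of_mem ha, Set.indicator_of_mem hj]
      _ ≤ _ := Finset.single_le_sum (fun j _ => hnonneg j) (Finset.mem_univ j)
  · rw [Set.indicator_of_notMem ha]
    exact Finset.sum_nonneg fun j _ => hnonneg j

lemma mass_union_le (hD : ∀ a, 0 ≤ D a) (S T : Set α) :
    mass D (S ∪ T) ≤ mass D S + mass D T := by
  rw [Set.union_eq_iUnion]
  exact (mass_iUnion_le hD _).trans_eq (by simp)

lemma mass_le_sum_mul (hD : ∀ a, 0 ≤ D a) {S : Set α} {g : α → ℝ} (hg : ∀ a, 0 ≤ g a)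
    (hS : ∀ a ∈ S, 1 ≤ g a) : mass D S ≤ ∑ a, D a * g a := by
  refine Finset.sum_le_sum fun a _ => ?_
  by_cases ha : a ∈ S
  · rw [Set.indicator_of_mem ha]
    exact le_mul_of_one_le_right (hD a) (hS a ha)
  · rw [Set.indicator_of_notMem ha]
    exact mul_nonneg (hD a) (hg a)

lemma mass_comp_equiv (D : β → ℝ) (e : α ≃ β) (S : Set β) :
    mass (fun a => D (e a)) (e ⁻¹' S) = mass D S :=
  e.sum_comp (S.indicator D)

lemma mass_prodDist (D₁ : α → ℝ) (D₂ : β → ℝ) (S : Set (α × β)) :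
    mass (prodDist D₁ D₂) S = ∑ a, D₁ a * mass D₂ {b | (a, b) ∈ S} := by
  classical
  simp only [mass, Fintype.sum_prod_type, Finset.mul_sum, Set.indicator_apply, prodDist, mul_ite,
    mul_zero, Set.mem_ofPred_eq]

lemma mass_prodDist_le {D₁ : α → ℝ} {D₂ : β → ℝ} {S : Set (α × β)} {c : ℝ}
    (h₁ : D₁ ∈ stdSimplex ℝ α) (h : ∀ a, mass D₂ {b | (a, b) ∈ S} ≤ c) :
    mass (prodDist D₁ D₂) S ≤ c :=
  calc mass (prodDist D₁ D₂) S = ∑ a, D₁ a * mass D₂ {b | (a, b) ∈ S} := mass_prodDist D₁ D₂ S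
    _ ≤ ∑ a, D₁ a * c := Finset.sum_le_sum fun a _ => mul_le_mul_of_nonneg_left (h a) (h₁.1 a)
    _ = c := by rw [← Finset.sum_mul, h₁.2, one_mul]

lemma mul_le_mass_prodDist {D₁ : α → ℝ} {D₂ : β → ℝ} {S : Set (α × β)} {G : Set α} {a b : ℝ}
    (h₁ : ∀ x, 0 ≤ D₁ x) (h₂ : ∀ y, 0 ≤ D₂ y) (hb₀ : 0 ≤ b) (ha : a ≤ mass D₁ G)
    (hb : ∀ x ∈ G, b ≤ mass D₂ {y | (x, y) ∈ S}) : a * b ≤ mass (prodDist D₁ D₂) S := by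
  rw [mass_prodDist]
  calc a * b ≤ mass D₁ G * b := mul_le_mul_of_nonneg_right ha hb₀
    _ = ∑ x, G.indicator D₁ x * b := Finset.sum_mul ..
    _ ≤ ∑ x, D₁ x * mass D₂ {y | (x, y) ∈ S} := by
      refine Finset.sum_le_sum fun x _ => ?_
      by_cases hx : x ∈ G
      · rw [Set.indicator_of_mem hx]
        exact mul_le_mul_of_nonneg_left (hb x hx) (h₁ x)
      · rw [Set.indicator_of_notMem hx, zero_mul]
        exact mul_nonneg (h₁ x) (mass_nonneg h₂ _)

end Mass

lemma card_mem_eq_sum_indicator_one {α ι : Type*} [Fintype ι] (s : ι → α) (V : Set α) :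
    (Nat.card {i | s i ∈ V} : ℝ) = ∑ i, V.indicator 1 (s i) := by
  classical
  rw [Nat.card_eq_fintype_card, Fintype.card_subtype]
  simp [Set.indicator_apply]

section IID

variable {α β ι : Type*} [Fintype α] [Fintype β] [Fintype ι] {D : α → ℝ}

/-- The distribution of a family of independent samples from `D`. -/
def iid (D : α → ℝ) : (ι → α) → ℝ := fun s => ∏ i, D (s i)

lemma iid_mem_stdSimplex [DecidableEq ι] (hD : D ∈ stdSimplex ℝ α) :
    iid D ∈ stdSimplex ℝ (ι → α) := by
  refine ⟨fun s => Finset.prod_nonneg fun i _ => hD.1 (s i), ?_⟩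
  simp only [iid]
  rw [← Fintype.prod_sum (fun (_ : ι) a => D a)]
  simp only [hD.2, Finset.prod_const_one]

lemma mass_iid_pi [DecidableEq ι] (D : α → ℝ) (A : ι → Set α) :
    mass (iid D) (Set.univ.pi A) = ∏ i, mass D (A i) := by
  classical
  simp only [mass]
  rw [Fintype.prod_sum]
  refine Finset.sum_congr rfl fun s _ => ?_
  by_cases hs : s ∈ Set.univ.pi A
  · rw [Set.indicator_of_mem hs]
    exact Finset.prod_congr rfl fun i _ => (Set.indicator_of_mem (hs i trivial) D).symm
  · rw [Set.indicator_of_notMem hs]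
    obtain ⟨i, hi⟩ : ∃ i, s i ∉ A i := by simpa using hs
    exact (Finset.prod_eq_zero (Finset.mem_univ i) (Set.indicator_of_notMem hi D)).symm

lemma mass_iid_forall_mem [DecidableEq ι] (hD : ∑ a, D a = 1) (J : Finset ι) (A : Set α) :
    mass (iid D) {s | ∀ i ∈ J, s i ∈ A} = mass D A ^ J.card := by
  have h : {s : ι → α | ∀ i ∈ J, s i ∈ A} = Set.univ.pi fun i => if i ∈ J then A else Set.univ := by
    ext s
    refine forall_congr' fun i => ?_
    by_cases hi : i ∈ J <;> simp [hi]
  rw [h, mass_iid_pi]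
  simp only [apply_ite (mass D), mass_univ, hD, Finset.prod_ite_mem, Finset.univ_inter,
    Finset.prod_const]

lemma mass_iid_eval_mem [DecidableEq ι] (hD : ∑ a, D a = 1) (i : ι) (A : Set α) :
    mass (iid D) {s : ι → α | s i ∈ A} = mass D A := by
  simpa using mass_iid_forall_mem hD {i} A

lemma mass_iid_prodDist (D₁ : α → ℝ) (D₂ : β → ℝ) [DecidableEq ι] (S : Set ((ι → α) × (ι → β))) :
    mass (iid (prodDist D₁ D₂)) {s : ι → α × β | (fun i => (s i).1, fun i => (s i).2) ∈ S} =
      mass (prodDist (iid D₁) (iid D₂)) S := by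
  rw [← mass_comp_equiv _ (Equiv.arrowProdEquivProdArrow ι (fun _ => α) (fun _ => β)) S]
  congr 1
  ext s
  exact Finset.prod_mul_distrib

lemma mass_iid_le_pow [DecidableEq ι] (hD : ∀ a, 0 ≤ D a) {S : Set (ι → α)} {g : α → ℝ}
    (hg : ∀ a, 0 ≤ g a) (hS : ∀ s ∈ S, 1 ≤ ∏ i, g (s i)) :
    mass (iid D) S ≤ (∑ a, D a * g a) ^ Fintype.card ι := by
  calc mass (iid D) S ≤ ∑ s, iid D s * ∏ i, g (s i) :=
        mass_le_sum_mul (fun s => Finset.prod_nonneg fun i _ => hD (s i))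
          (fun s => Finset.prod_nonneg fun i _ => hg (s i)) hS
    _ = ∑ s : ι → α, ∏ i, (D (s i) * g (s i)) := by simp only [iid, Finset.prod_mul_distrib]
    _ = (∑ a, D a * g a) ^ Fintype.card ι := by
      rw [← Fintype.prod_sum (fun (_ : ι) a => D a * g a), Finset.prod_const, Finset.card_univ]

lemma abs_sum_mul_le (hD : D ∈ stdSimplex ℝ α) {Y : α → ℝ} {c : ℝ} (hY : ∀ a, |Y a| ≤ c) :
    |∑ a, D a * Y a| ≤ c :=
  calc |∑ a, D a * Y a| ≤ ∑ a, |D a * Y a| := Finset.abs_sum_le_sum_abs _ _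
    _ ≤ ∑ a, D a * c := Finset.sum_le_sum fun a _ => by
      rw [abs_mul, abs_of_nonneg (hD.1 a)]
      exact mul_le_mul_of_nonneg_left (hY a) (hD.1 a)
    _ = c := by rw [← Finset.sum_mul, hD.2, one_mul]

lemma sum_mul_exp_le_exp_sq (hD : D ∈ stdSimplex ℝ α) {Z : α → ℝ} {c : ℝ} (hZ : ∀ a, |Z a| ≤ c)
    (hc : c ≤ 1) (hmean : ∑ a, D a * Z a = 0) : ∑ a, D a * Real.exp (Z a) ≤ Real.exp (c ^ 2) := by
  have hexp : ∀ a, Real.exp (Z a) ≤ 1 + c ^ 2 + Z a := fun a => by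
    have h := (abs_le.1 (Real.abs_exp_sub_one_sub_id_le ((hZ a).trans hc))).2
    have hsq : Z a ^ 2 ≤ c ^ 2 := sq_le_sq' (abs_le.1 (hZ a)).1 (abs_le.1 (hZ a)).2
    linarith
  calc ∑ a, D a * Real.exp (Z a) ≤ ∑ a, D a * (1 + c ^ 2 + Z a) :=
        Finset.sum_le_sum fun a _ => mul_le_mul_of_nonneg_left (hexp a) (hD.1 a)
    _ = c ^ 2 + 1 := by
      simp only [mul_add _ _ (Z _), Finset.sum_add_distrib, ← Finset.sum_mul, hD.2, hmean]
      ring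
    _ ≤ Real.exp (c ^ 2) := Real.add_one_le_exp _

/- The exponential moment method, with parameter `τ / 8`. -/
theorem mass_iid_sum_le [DecidableEq ι] (hD : D ∈ stdSimplex ℝ α) {Y : α → ℝ}
    (hY : ∀ a, |Y a| ≤ 1) {τ : ℝ} (hτ₀ : 0 ≤ τ) (hτ : τ ≤ 4) :
    mass (iid D) {s : ι → α | ∑ i, Y (s i) ≤ Fintype.card ι * (∑ a, D a * Y a - τ)} ≤
      Real.exp (-(Fintype.card ι * τ ^ 2 / 16)) := by
  set μ := ∑ a, D a * Y a
  have htail : mass (iid D) {s : ι → α | ∑ i, Y (s i) ≤ Fintype.card ι * (μ - τ)} ≤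
      (∑ a, D a * Real.exp (τ / 8 * (μ - τ - Y a))) ^ Fintype.card ι := by
    refine mass_iid_le_pow hD.1 (fun a => (Real.exp_pos _).le) fun s hs => ?_
    rw [← Real.exp_sum, Real.one_le_exp_iff, ← Finset.mul_sum, Finset.sum_sub_distrib]
    refine mul_nonneg (by positivity) (sub_nonneg.2 ?_)
    simpa [mul_sub] using hs
  have hmoment : ∑ a, D a * Real.exp (τ / 8 * (μ - Y a)) ≤ Real.exp ((τ / 4) ^ 2) := by
    refine sum_mul_exp_le_exp_sq hD (fun a => ?_) (by linarith) ?_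
    · rw [abs_mul, abs_of_nonneg (by positivity)]
      have : |μ - Y a| ≤ 2 := (abs_sub _ _).trans (by linarith [abs_sum_mul_le hD hY, hY a])
      nlinarith
    · simp only [mul_left_comm (D _), ← Finset.mul_sum, mul_sub, Finset.sum_sub_distrib,
        ← Finset.sum_mul, hD.2]
      simp [μ]
  have hbase : ∑ a, D a * Real.exp (τ / 8 * (μ - τ - Y a)) ≤ Real.exp (-(τ ^ 2 / 16)) :=
    calc ∑ a, D a * Real.exp (τ / 8 * (μ - τ - Y a))
        = Real.exp (-(τ ^ 2 / 8)) * ∑ a, D a * Real.exp (τ / 8 * (μ - Y a)) := by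
          rw [Finset.mul_sum]
          refine Finset.sum_congr rfl fun a _ => ?_
          rw [mul_left_comm, ← Real.exp_add]
          ring_nf
      _ ≤ Real.exp (-(τ ^ 2 / 8)) * Real.exp ((τ / 4) ^ 2) := by gcongr
      _ = Real.exp (-(τ ^ 2 / 16)) := by
          rw [← Real.exp_add]
          ring_nf
  calc _ ≤ _ := htail
    _ ≤ Real.exp (-(τ ^ 2 / 16)) ^ Fintype.card ι := by
        gcongr
        exact Finset.sum_nonneg fun a _ => mul_nonneg (hD.1 a) (Real.exp_pos _).le
    _ = Real.exp (-(Fintype.card ι * τ ^ 2 / 16)) := by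
        rw [← Real.exp_nat_mul]
        ring_nf

lemma mass_iid_card_mem_le [DecidableEq ι] (hD : D ∈ stdSimplex ℝ α) {V : Set α} {θ : ℝ}
    (hθ₀ : 0 ≤ θ) (hV : θ ≤ mass D V) :
    mass (iid D) {s : ι → α | (Nat.card {i | s i ∈ V} : ℝ) ≤ θ * Fintype.card ι / 2} ≤
      Real.exp (-(Fintype.card ι * θ ^ 2 / 64)) := by
  classical
  refine (mass_mono (iid_mem_stdSimplex hD).1 fun s hs => ?_).trans
    ((mass_iid_sum_le (ι := ι) hD (Y := V.indicator 1) (fun a => ?_) (τ := θ / 2) (by positivity)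
      (by linarith [mass_le_one hD V])).trans_eq (by ring_nf))
  · rw [Set.mem_ofPred_eq, ← mass_eq_sum_mul_indicator_one, ← card_mem_eq_sum_indicator_one]
    have : (Fintype.card ι : ℝ) * (θ / 2) ≤ Fintype.card ι * (mass D V - θ / 2) := by
      gcongr
      linarith
    linarith [Set.mem_ofPred_eq ▸ hs]
  · by_cases ha : a ∈ V <;> simp [ha]

lemma le_mass_iid_forall_abs_sub_lt [DecidableEq ι] {T : Type*} [Fintype T]
    (hD : D ∈ stdSimplex ℝ α) {Y : T → α → ℝ} (hY : ∀ t a, |Y t a| ≤ 1) {τ : ℝ} (hτ₀ : 0 ≤ τ)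
    (hτ : τ ≤ 4) :
    1 - 2 * Fintype.card T * Real.exp (-(Fintype.card ι * τ ^ 2 / 16)) ≤ mass (iid D)
      {s : ι → α | ∀ t, |∑ i, Y t (s i) - Fintype.card ι * ∑ a, D a * Y t a| <
        Fintype.card ι * τ} := by
  have hiid := iid_mem_stdSimplex (ι := ι) hD
  set tail : (α → ℝ) → Set (ι → α) := fun y =>
    {s | ∑ i, y (s i) ≤ Fintype.card ι * (∑ a, D a * y a - τ)} with htail
  have hbad : mass (iid D) (⋃ t, tail (Y t) ∪ tail (-Y t)) ≤
      2 * Fintype.card T * Real.exp (-(Fintype.card ι * τ ^ 2 / 16)) :=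
    calc _ ≤ ∑ t, mass (iid D) (tail (Y t) ∪ tail (-Y t)) := mass_iUnion_le hiid.1 _
      _ ≤ ∑ _t : T, (Real.exp (-(Fintype.card ι * τ ^ 2 / 16)) +
            Real.exp (-(Fintype.card ι * τ ^ 2 / 16))) :=
          Finset.sum_le_sum fun t _ => (mass_union_le hiid.1 _ _).trans <| add_le_add
            (mass_iid_sum_le hD (hY t) hτ₀ hτ)
            (mass_iid_sum_le hD (fun a => (abs_neg (Y t a)).trans_le (hY t a)) hτ₀ hτ)
      _ = _ := by
          rw [Finset.sum_const, Finset.card_univ, nsmul_eq_mul]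
          ring
  rw [← compl_compl {s : ι → α | _}, mass_compl hiid]
  refine sub_le_sub_left ((mass_mono hiid.1 fun s hs => ?_).trans hbad) 1
  obtain ⟨t, ht⟩ := not_forall.1 hs
  refine Set.mem_iUnion.2 ⟨t, ?_⟩
  simp only [htail, Set.mem_union, Set.mem_ofPred_eq, Pi.neg_apply, mul_neg,
    Finset.sum_neg_distrib]
  rcases le_abs.1 (not_lt.1 ht) with h | h
  · right
    linarith
  · left
    linarith

end IID

section Subspaces

variable {K E ι : Type*} [DivisionRing K] [AddCommGroup E] [Module K E]

lemma exists_finset_span [Module.Finite K E] [Finite ι] (s : ι → E) (V : Submodule K E) :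
    ∃ T : Finset ι, (∀ i ∈ T, s i ∈ V) ∧ T.card ≤ Module.finrank K E ∧
      ∀ i, s i ∈ V → s i ∈ Submodule.span K (Set.range fun i : T => s i) := by
  classical
  cases nonempty_fintype ι
  obtain ⟨b, hbV, -, hspan, hindep⟩ := exists_linearIndepOn_extension (K := K) (v := s)
    (s := ∅) (t := {i | s i ∈ V}) (linearIndepOn_empty _ _) (Set.empty_subset _)
  refine ⟨b.toFinset, fun i hi => hbV (Set.mem_toFinset.1 hi), ?_, fun i hi => ?_⟩
  · simpa only [Set.toFinset_card] using LinearIndependent.fintype_card_le_finrank hindep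
  · have hrange : Set.range (fun i : b.toFinset => s i) = s '' b := by
      ext x
      simp
    exact hrange ▸ hspan ⟨i, hi, rfl⟩

variable [Fintype E] [Fintype ι] [DecidableEq ι] {D : E → ℝ} {θ : ℝ}

/- Condition on the samples indexed by `T`: the remaining ones hit their span independently. -/
lemma mass_iid_mem_span_le (hD : D ∈ stdSimplex ℝ E) (hθ : 0 ≤ θ) {T J : Finset ι}
    (hJT : Disjoint J T) :
    mass (iid D) {s : ι → E | (∀ i ∈ J, s i ∈ Submodule.span K (Set.range fun i : T => s i)) ∧
      mass D (Submodule.span K (Set.range fun i : T => s i) : Set E) < θ} ≤ θ ^ J.card := by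
  let e := Equiv.piEquivPiSubtypeProd (fun i => i ∈ T) (fun _ : ι => E)
  let H : (T → E) → Submodule K E := fun a => Submodule.span K (Set.range a)
  let J' : Finset {i // i ∉ T} := J.subtype fun i => i ∉ T
  have hsplit : iid D = fun s : ι → E => prodDist (iid D) (iid D) (e s) := by
    ext s
    simp only [prodDist, iid]
    convert! (Fintype.prod_subtype_mul_prod_subtype (fun i => i ∈ T) fun i => D (s i)).symm
  have hevent : {s : ι → E | (∀ i ∈ J, s i ∈ Submodule.span K (Set.range fun i : T => s i)) ∧
      mass D (Submodule.span K (Set.range fun i : T => s i) : Set E) < θ} =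
      e ⁻¹' {t | (∀ i ∈ J', t.2 i ∈ H t.1) ∧ mass D (H t.1 : Set E) < θ} := by
    ext s
    refine and_congr_left fun _ => ⟨fun h i hi => h i (Finset.mem_subtype.1 hi), fun h i hi => ?_⟩
    exact h ⟨i, Finset.disjoint_left.1 hJT hi⟩ (Finset.mem_subtype.2 hi)
  have hcard : J'.card = J.card := by
    rw [Finset.card_subtype, Finset.filter_true_of_mem fun i hi => Finset.disjoint_left.1 hJT hi]
  rw [hevent, hsplit, mass_comp_equiv]
  refine mass_prodDist_le (iid_mem_stdSimplex hD) fun a => ?_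
  by_cases ha : mass D (H a : Set E) < θ
  · calc _ = mass (iid D) {b | ∀ i ∈ J', b i ∈ (H a : Set E)} := by simp [ha]
      _ = mass D (H a : Set E) ^ J.card := by rw [mass_iid_forall_mem hD.2, hcard]
      _ ≤ θ ^ J.card := pow_le_pow_left₀ (mass_nonneg hD.1 _) ha.le _
  · simp only [Set.mem_ofPred_eq, ha, and_false, Set.ofPred_false]
    simp [mass, pow_nonneg hθ]

/- A union bound over a spanning set `T` of the samples in `V` and the set `J` of the others. -/
lemma mass_iid_exists_subspace_le (hD : D ∈ stdSimplex ℝ E) (hθ₀ : 0 ≤ θ) (hθ₁ : θ ≤ 1) (k : ℕ) :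
    mass (iid D) {s : ι → E | ∃ V : Submodule K E,
      k + Module.finrank K E ≤ Nat.card {i | s i ∈ V} ∧ mass D (V : Set E) < θ} ≤
      4 ^ Fintype.card ι * θ ^ k := by
  classical
  let Index := {t : Finset ι × Finset ι // Disjoint t.2 t.1 ∧ k ≤ t.2.card}
  let B : Index → Set (ι → E) := fun t =>
    {s | (∀ i ∈ t.1.2, s i ∈ Submodule.span K (Set.range fun i : t.1.1 => s i)) ∧
      mass D (Submodule.span K (Set.range fun i : t.1.1 => s i) : Set E) < θ}
  have hcover : {s : ι → E | ∃ V : Submodule K E,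
      k + Module.finrank K E ≤ Nat.card {i | s i ∈ V} ∧ mass D (V : Set E) < θ} ⊆ ⋃ t, B t := by
    rintro s ⟨V, hV, hVθ⟩
    obtain ⟨T, hTV, hT, hspan⟩ := exists_finset_span s V
    let J : Finset ι := {i | s i ∈ V}
    have hk : k ≤ (J \ T).card := by
      have hJ : Nat.card {i | s i ∈ V} = J.card := by
        rw [Nat.card_eq_fintype_card, Fintype.card_subtype]
        rfl
      have := Finset.le_card_sdiff T J
      omega
    have hle : Submodule.span K (Set.range fun i : T => s i) ≤ V :=
      Submodule.span_le.2 (Set.range_subset_iff.2 fun i => hTV i i.2)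
    refine Set.mem_iUnion.2 ⟨⟨(T, J \ T), Finset.sdiff_disjoint, hk⟩, fun i hi => ?_, ?_⟩
    · exact hspan i (Finset.mem_filter.1 (Finset.mem_sdiff.1 hi).1).2
    · exact (mass_mono hD.1 hle).trans_lt hVθ
  have hevent : ∀ t, mass (iid D) (B t) ≤ θ ^ k := fun t =>
    (mass_iid_mem_span_le hD hθ₀ t.2.1).trans (pow_le_pow_of_le_one hθ₀ hθ₁ t.2.2)
  have hIndex : (Fintype.card Index : ℝ) ≤ 4 ^ Fintype.card ι := by
    have h : Fintype.card Index ≤ 4 ^ Fintype.card ι :=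
      (Fintype.card_subtype_le _).trans_eq (by
        rw [Fintype.card_prod, Fintype.card_finset, ← mul_pow]; norm_num)
    exact_mod_cast h
  have hiid : ∀ s : ι → E, 0 ≤ iid D s := (iid_mem_stdSimplex hD).1
  calc _ ≤ mass (iid D) (⋃ t, B t) := mass_mono hiid hcover
    _ ≤ ∑ t, mass (iid D) (B t) := mass_iUnion_le hiid B
    _ ≤ ∑ _t : Index, θ ^ k := Finset.sum_le_sum fun t _ => hevent t
    _ = Fintype.card Index * θ ^ k := by rw [Finset.sum_const, Finset.card_univ, nsmul_eq_mul]
    _ ≤ _ := by gcongr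

lemma mass_iid_exists_subspace_le_exp (hD : D ∈ stdSimplex ℝ E) (hθ₀ : 0 < θ) (hθ₁ : θ ≤ 1)
    (h8 : 8 ≤ θ * Fintype.card ι) (hrank : 4 * (Module.finrank K E : ℝ) ≤ θ * Fintype.card ι) :
    mass (iid D) {s : ι → E | ∃ V : Submodule K E,
      θ * Fintype.card ι / 2 < (Nat.card {i | s i ∈ V} : ℝ) ∧
        mass D (V : Set E) < Real.exp (-(24 / θ))} ≤
      Real.exp (-(Fintype.card ι * θ ^ 2 / 64)) := by
  set m : ℕ := Fintype.card ι
  set k : ℕ := ⌊θ * m / 4⌋₊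
  have hk_le : (k : ℝ) ≤ θ * m / 4 := Nat.floor_le (by positivity)
  have hk_ge : θ * m / 8 ≤ k := by linarith [Nat.lt_floor_add_one (θ * m / 4)]
  have hexponent : m * 2 + k * (-(24 / θ)) ≤ -(m * θ ^ 2 / 64) := by
    have hk : 3 * (m : ℝ) ≤ k * (24 / θ) :=
      calc 3 * (m : ℝ) = θ * m / 8 * (24 / θ) := by field_simp; ring
        _ ≤ k * (24 / θ) := by gcongr
    have hm : (m : ℝ) * θ ^ 2 ≤ m * 1 := by gcongr; exact pow_le_one₀ hθ₀.le hθ₁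
    linarith
  have hfour : (4 : ℝ) ≤ Real.exp 2 := by
    have := Real.quadratic_le_exp_of_nonneg (x := 2) (by norm_num)
    linarith
  calc _ ≤ 4 ^ m * Real.exp (-(24 / θ)) ^ k := by
        refine (mass_mono (iid_mem_stdSimplex hD).1 ?_).trans
          (mass_iid_exists_subspace_le (K := K) hD (Real.exp_pos _).le
            (Real.exp_le_one_iff.2 (neg_nonpos.2 (by positivity))) k)
        rintro s ⟨V, hV, hVθ⟩
        refine ⟨V, ?_, hVθ⟩
        have : ((k + Module.finrank K E : ℕ) : ℝ) ≤ (Nat.card {i | s i ∈ V} : ℝ) := by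
          push_cast
          linarith
        exact_mod_cast this
    _ ≤ Real.exp 2 ^ m * Real.exp (-(24 / θ)) ^ k := by gcongr
    _ = Real.exp (m * 2 + k * (-(24 / θ))) := by
        rw [← Real.exp_nat_mul, ← Real.exp_nat_mul, ← Real.exp_add]
    _ ≤ _ := Real.exp_le_exp.2 hexponent

theorem le_mass_iid_subspace (hD : D ∈ stdSimplex ℝ E) (hθ₀ : 0 < θ)
    (h8 : 8 ≤ θ * Fintype.card ι) (hrank : 4 * (Module.finrank K E : ℝ) ≤ θ * Fintype.card ι)
    {V₀ : Submodule K E} (hV₀ : θ ≤ mass D (V₀ : Set E)) :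
    1 - 2 * Real.exp (-(Fintype.card ι * θ ^ 2 / 64)) ≤ mass (iid D)
      {s : ι → E | θ * Fintype.card ι / 2 < (Nat.card {i | s i ∈ V₀} : ℝ) ∧
        ∀ V : Submodule K E, θ * Fintype.card ι / 2 < (Nat.card {i | s i ∈ V} : ℝ) →
          Real.exp (-(24 / θ)) ≤ mass D (V : Set E)} := by
  set few : Set (ι → E) := {s | (Nat.card {i | s i ∈ V₀} : ℝ) ≤ θ * Fintype.card ι / 2}
  set light : Set (ι → E) := {s | ∃ V : Submodule K E,
    θ * Fintype.card ι / 2 < (Nat.card {i | s i ∈ V} : ℝ) ∧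
      mass D (V : Set E) < Real.exp (-(24 / θ))}
  have hiid := iid_mem_stdSimplex (ι := ι) hD
  have hfew : mass (iid D) few ≤ _ := mass_iid_card_mem_le hD hθ₀.le hV₀
  have hlight : mass (iid D) light ≤ _ :=
    mass_iid_exists_subspace_le_exp hD hθ₀ (hV₀.trans (mass_le_one hD _)) h8 hrank
  calc _ ≤ 1 - mass (iid D) (few ∪ light) := by linarith [mass_union_le hiid.1 few light]
    _ = mass (iid D) (few ∪ light)ᶜ := (mass_compl hiid _).symm
    _ ≤ _ := mass_mono hiid.1 fun s hs => by
      simpa [few, light, not_or] using hs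

end Subspaces

/-! ### Non-adaptive query algorithms -/

section Unitary

variable {Q : Type*} [Fintype Q]

lemma nonempty_of_sum_norm_sq_eq_one {a : Q → ℂ} (ha : ∑ q, ‖a q‖ ^ 2 = 1) : Nonempty Q := by
  by_contra h
  rw [not_nonempty_iff] at h
  simp at ha

variable [DecidableEq Q]

lemma exists_unitary_mulVec_single (i : Q) {a : Q → ℂ} (ha : ∑ q, ‖a q‖ ^ 2 = 1) :
    ∃ U : Matrix.unitaryGroup Q ℂ, (U : Matrix Q Q ℂ) *ᵥ Pi.single i 1 = a := by
  have hnorm : ‖WithLp.toLp 2 a‖ = 1 := by simp [EuclideanSpace.norm_eq, ha]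
  have hv : Orthonormal ℂ (Set.domRestrict ({i} : Set Q)
      (fun _ : Q => (WithLp.toLp 2 a : EuclideanSpace ℂ Q))) := by
    rw [orthonormal_iff_ite]
    rintro ⟨x, rfl⟩ ⟨y, rfl⟩
    simp [hnorm]
  obtain ⟨b, hb⟩ := hv.exists_orthonormalBasis_extension_of_card_eq (by simp)
  refine ⟨⟨_, (EuclideanSpace.basisFun Q ℂ).toMatrix_orthonormalBasis_mem_unitary b⟩, ?_⟩
  ext q
  simp [Module.Basis.toMatrix_apply, hb i rfl]

lemma exists_unitary_mulVec {a b : Q → ℂ} (ha : ∑ q, ‖a q‖ ^ 2 = 1)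
    (hb : ∑ q, ‖b q‖ ^ 2 = 1) :
    ∃ U : Matrix.unitaryGroup Q ℂ, (U : Matrix Q Q ℂ) *ᵥ a = b := by
  obtain ⟨i⟩ := nonempty_of_sum_norm_sq_eq_one ha
  obtain ⟨U, hU⟩ := exists_unitary_mulVec_single i ha
  obtain ⟨V, hV⟩ := exists_unitary_mulVec_single i hb
  refine ⟨V * U⁻¹, ?_⟩
  rw [← hU, Matrix.mulVec_mulVec, ← Matrix.UnitaryGroup.mul_val]
  simp [hV]

variable {W : Type*} [Fintype W] [DecidableEq W]

/-- The unitary `∑_w U w ⊗ |w⟩⟨w|`, acting on the first register under the control of the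
second one. -/
def controlled (U : W → Matrix.unitaryGroup Q ℂ) : Matrix.unitaryGroup (Q × W) ℂ :=
  ⟨Matrix.blockDiagonal fun w => (U w : Matrix Q Q ℂ), by
    rw [Matrix.mem_unitaryGroup_iff, Matrix.star_eq_conjTranspose,
      Matrix.blockDiagonal_conjTranspose, ← Matrix.blockDiagonal_mul,
      show (fun w => (U w : Matrix Q Q ℂ) * (U w : Matrix Q Q ℂ)ᴴ) = 1 from
        funext fun w => Matrix.mem_unitaryGroup_iff.1 (U w).2, Matrix.blockDiagonal_one]⟩

lemma controlled_mulVec (U : W → Matrix.unitaryGroup Q ℂ) (ψ : Q × W → ℂ) (s : Q × W) :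
    ((controlled U : Matrix (Q × W) (Q × W) ℂ) *ᵥ ψ) s =
      ((U s.2 : Matrix Q Q ℂ) *ᵥ fun q => ψ (q, s.2)) s.1 := by
  simp only [controlled, Matrix.mulVec, dotProduct, Matrix.blockDiagonal_apply,
    Fintype.sum_prod_type]
  exact Finset.sum_congr rfl fun q _ => by simp

/-- The product unitary `U ⊗ V`. -/
def unitaryKronecker (U : Matrix.unitaryGroup Q ℂ) (V : Matrix.unitaryGroup W ℂ) :
    Matrix.unitaryGroup (Q × W) ℂ :=
  ⟨(U : Matrix Q Q ℂ) ⊗ₖ (V : Matrix W W ℂ), Matrix.kronecker_mem_unitary U.2 V.2⟩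

end Unitary

section Kronecker

variable {Q W : Type*} [Fintype Q] [Fintype W]

lemma kronecker_mulVec_mul (M : Matrix Q Q ℂ) (N : Matrix W W ℂ) (a : Q → ℂ) (b : W → ℂ) :
    ((M ⊗ₖ N) *ᵥ fun t : Q × W => a t.1 * b t.2) = fun s => (M *ᵥ a) s.1 * (N *ᵥ b) s.2 := by
  ext s
  simp only [Matrix.mulVec, dotProduct, Matrix.kroneckerMap_apply, Fintype.sum_prod_type,
    Finset.sum_mul_sum]
  refine Finset.sum_congr rfl fun q _ => Finset.sum_congr rfl fun w _ => ?_
  ring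

lemma kronecker_one_mulVec_apply [DecidableEq W] (M : Matrix Q Q ℂ) (ψ : Q × W → ℂ)
    (s : Q × W) :
    ((M ⊗ₖ (1 : Matrix W W ℂ)) *ᵥ ψ) s = (M *ᵥ fun q => ψ (q, s.2)) s.1 := by
  simp only [Matrix.mulVec, dotProduct, Matrix.kroneckerMap_apply, Fintype.sum_prod_type,
    Matrix.one_apply]
  exact Finset.sum_congr rfl fun q _ => by simp

end Kronecker

section Entangle

variable {Q W X : Type*}

/-- The state `∑_w ψ w • (v (x w) ⊗ |w⟩)`, in which the workspace `w` determines the state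
`v (x w)` of the query register. -/
def entangle (v : X → Q → ℂ) (x : W → X) (ψ : W → ℂ) : Q × W → ℂ :=
  fun s => v (x s.2) s.1 * ψ s.2

variable {v : X → Q → ℂ}

lemma entangle_slice (x : W → X) (ψ : W → ℂ) (w : W) :
    (fun q => entangle v x ψ (q, w)) = ψ w • v (x w) := by
  ext q
  exact mul_comm _ _

variable [Fintype Q] [Fintype W]

lemma mass_norm_sq_entangle (hv : ∀ x, ∑ q, ‖v x q‖ ^ 2 = 1) (x : W → X) (ψ : W → ℂ)
    (S : Set W) :
    mass (fun s => ‖entangle v x ψ s‖ ^ 2) (Prod.snd ⁻¹' S) = mass (fun w => ‖ψ w‖ ^ 2) S := by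
  rw [mass, mass, Fintype.sum_prod_type_right]
  refine Finset.sum_congr rfl fun w _ => ?_
  by_cases hw : w ∈ S
  · simp only [Set.indicator, Set.mem_preimage, hw, if_true, entangle, norm_mul, mul_pow,
      ← Finset.sum_mul, hv, one_mul]
  · simp [hw]

lemma sum_norm_sq_entangle (hv : ∀ x, ∑ q, ‖v x q‖ ^ 2 = 1) (x : W → X) {ψ : W → ℂ}
    (hψ : ∑ w, ‖ψ w‖ ^ 2 = 1) : ∑ s, ‖entangle v x ψ s‖ ^ 2 = 1 := by
  rw [← hψ, ← mass_univ, ← mass_univ (fun w => ‖ψ w‖ ^ 2), ← mass_norm_sq_entangle hv x ψ,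
    Set.preimage_univ]

variable [DecidableEq W]

lemma kronecker_one_mulVec_entangle {O : Matrix Q Q ℂ} {φ : X → ℂ}
    (hO : ∀ x, O *ᵥ v x = φ x • v x) (x : W → X) (ψ : W → ℂ) :
    (O ⊗ₖ (1 : Matrix W W ℂ)) *ᵥ entangle v x ψ = entangle v x fun w => φ (x w) * ψ w := by
  ext s
  rw [kronecker_one_mulVec_apply, entangle_slice, Matrix.mulVec_smul, hO]
  simp only [Pi.smul_apply, smul_eq_mul, entangle]
  ring

variable [DecidableEq Q]

lemma controlled_mulVec_entangle {x y : W → X} {U : W → Matrix.unitaryGroup Q ℂ}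
    (hU : ∀ w, (U w : Matrix Q Q ℂ) *ᵥ v (x w) = v (y w)) (ψ : W → ℂ) :
    (controlled U : Matrix (Q × W) (Q × W) ℂ) *ᵥ entangle v x ψ = entangle v y ψ := by
  ext s
  rw [controlled_mulVec, entangle_slice, Matrix.mulVec_smul, hU]
  exact mul_comm _ _

lemma unitaryKronecker_one_mulVec_entangle (V : Matrix.unitaryGroup W ℂ) (x₀ : X) (ψ : W → ℂ) :
    (unitaryKronecker (1 : Matrix.unitaryGroup Q ℂ) V).1 *ᵥ entangle v (fun _ => x₀) ψ =
      entangle v (fun _ => x₀) ((V : Matrix W W ℂ) *ᵥ ψ) := by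
  refine (kronecker_mulVec_mul _ _ (v x₀) ψ).trans ?_
  simp only [OneMemClass.coe_one, Matrix.one_mulVec]
  rfl

lemma exists_unitary_seq (hv : ∀ x, ∑ q, ‖v x q‖ ^ 2 = 1) (x : ℕ → W → X) (i : Q × W)
    {u : W → ℂ} (hu : ∑ w, ‖u w‖ ^ 2 = 1) :
    ∃ B : ℕ → Matrix.unitaryGroup (Q × W) ℂ,
      (B 0 : Matrix (Q × W) (Q × W) ℂ) *ᵥ Pi.single i 1 = entangle v (x 0) u ∧
      ∀ k ψ, (B (k + 1) : Matrix (Q × W) (Q × W) ℂ) *ᵥ entangle v (x k) ψ =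
        entangle v (x (k + 1)) ψ := by
  obtain ⟨B₀, hB₀⟩ := exists_unitary_mulVec_single i (sum_norm_sq_entangle hv (x 0) hu)
  choose move hmove using fun y z => exists_unitary_mulVec (hv y) (hv z)
  let B : ℕ → Matrix.unitaryGroup (Q × W) ℂ
    | 0 => B₀
    | k + 1 => controlled fun w => move (x k w) (x (k + 1) w)
  exact ⟨B, hB₀, fun k => controlled_mulVec_entangle fun w => hmove _ _⟩

end Entangle

namespace QueryAlgorithm

variable {Q R : Type} [Fintype Q] [DecidableEq Q]

lemma prob_eq_mass (A : QueryAlgorithm Q R) (O : Matrix Q Q ℂ) (S : Set R) :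
    A.prob O S = mass (fun s => ‖A.state O A.queries s‖ ^ 2) (A.output ⁻¹' S) := rfl

lemma prob_mono (A : QueryAlgorithm Q R) (O : Matrix Q Q ℂ) {S T : Set R} (h : S ⊆ T) :
    A.prob O S ≤ A.prob O T := by
  rw [prob_eq_mass, prob_eq_mass]
  exact mass_mono (fun _ => sq_nonneg _) (Set.preimage_mono h)

/-- The algorithm that runs `A` and applies the unitary `F` just before the measurement. -/
def andThen (A : QueryAlgorithm Q R) (F : Matrix.unitaryGroup (Q × A.W) ℂ) :
    QueryAlgorithm Q R :=
  { A with U := Function.update A.U A.queries (F * A.U A.queries) }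

lemma state_andThen_of_lt (A : QueryAlgorithm Q R) (F : Matrix.unitaryGroup (Q × A.W) ℂ)
    (O : Matrix Q Q ℂ) {k : ℕ} (hk : k < A.queries) :
    (A.andThen F).state O k = A.state O k := by
  have hU : ∀ j < A.queries, (A.andThen F).U j = A.U j := fun j hj =>
    Function.update_of_ne hj.ne _ _
  induction k with
  | zero => rw [state, state, hU 0 hk]; rfl
  | succ k ih => rw [state, state, hU _ hk, ih (by omega)]; rfl

lemma state_andThen (A : QueryAlgorithm Q R) (F : Matrix.unitaryGroup (Q × A.W) ℂ)
    (O : Matrix Q Q ℂ) :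
    (A.andThen F).state O A.queries =
      (F : Matrix (Q × A.W) (Q × A.W) ℂ) *ᵥ A.state O A.queries := by
  have hU : (A.andThen F).U A.queries = F * A.U A.queries := Function.update_self _ _ _
  have hlt : ∀ k < A.queries, (A.andThen F).state O k = A.state O k := fun k =>
    A.state_andThen_of_lt F O
  generalize A.queries = N at hU hlt ⊢
  cases N with
  | zero =>
    exact (congrArg (fun M : Matrix.unitaryGroup (Q × A.W) ℂ => M.1 *ᵥ Pi.single A.init 1)
      hU).trans (Matrix.mulVec_mulVec _ _ _).symm
  | succ k =>
    exact (congrArg₂ (fun (M : Matrix.unitaryGroup (Q × A.W) ℂ) ψ =>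
      M.1 *ᵥ ((O ⊗ₖ (1 : Matrix A.W A.W ℂ)) *ᵥ ψ)) hU (hlt k k.lt_succ_self)).trans
      (Matrix.mulVec_mulVec _ _ _).symm

end QueryAlgorithm

section Nonadaptive

variable {Q R X W κ : Type} [Fintype Q] [DecidableEq Q] [Fintype W] [DecidableEq W] [Fintype κ]
  {v : X → Q → ℂ}

lemma exists_forall_state_eq (hv : ∀ x, ∑ q, ‖v x q‖ ^ 2 = 1) (x : ℕ → W → X) {u : W → ℂ}
    (hu : ∑ w, ‖u w‖ ^ 2 = 1) (T : ℕ) (out : W → R) :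
    ∃ (i : Q × W) (B : ℕ → Matrix.unitaryGroup (Q × W) ℂ),
      ∀ (O : Matrix Q Q ℂ) (φ : X → ℂ), (∀ x, O *ᵥ v x = φ x • v x) → ∀ k,
        QueryAlgorithm.state (⟨W, T, i, B, fun s => out s.2⟩ : QueryAlgorithm Q R) O k =
          entangle v (x k) fun w => (∏ j ∈ Finset.range k, φ (x j w)) * u w := by
  obtain ⟨w₀⟩ := nonempty_of_sum_norm_sq_eq_one hu
  obtain ⟨q₀⟩ := nonempty_of_sum_norm_sq_eq_one (hv (x 0 w₀))
  obtain ⟨B, hB₀, hB⟩ := exists_unitary_seq hv x (q₀, w₀) hu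
  refine ⟨(q₀, w₀), B, fun O φ hO k => ?_⟩
  induction k with
  | zero =>
    simp only [Finset.range_zero, Finset.prod_empty, one_mul]
    exact hB₀
  | succ k ih =>
    rw [QueryAlgorithm.state, ih, kronecker_one_mulVec_entangle hO, hB]
    simp only [Finset.prod_range_succ_comm, mul_assoc]

theorem exists_nonadaptive (hv : ∀ x, ∑ q, ‖v x q‖ ^ 2 = 1) (x₀ : X)
    (q : κ → W → X) {u : W → ℂ} (hu : ∑ w, ‖u w‖ ^ 2 = 1) (V : Matrix.unitaryGroup W ℂ)
    (out : W → R) :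
    ∃ A : QueryAlgorithm Q R, A.queries = Fintype.card κ ∧
      ∀ (O : Matrix Q Q ℂ) (φ : X → ℂ), (∀ x, O *ᵥ v x = φ x • v x) → ∀ S : Set R,
        A.prob O S =
          mass (fun w => ‖((V : Matrix W W ℂ) *ᵥ fun w => (∏ k, φ (q k w)) * u w) w‖ ^ 2)
            (out ⁻¹' S) := by
  let e : κ ≃ Fin (Fintype.card κ) := Fintype.equivFin κ
  let x : ℕ → W → X := fun k w => if h : k < Fintype.card κ then q (e.symm ⟨k, h⟩) w else x₀
  obtain ⟨i, B, hB⟩ := exists_forall_state_eq hv x hu (Fintype.card κ) out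
  refine ⟨.andThen ⟨W, Fintype.card κ, i, B, fun s => out s.2⟩ (unitaryKronecker 1 V), rfl,
    fun O φ hO S => ?_⟩
  have hx : x (Fintype.card κ) = fun _ => x₀ := by simp [x]
  have hprod : ∀ w, ∏ j ∈ Finset.range (Fintype.card κ), φ (x j w) = ∏ k, φ (q k w) := by
    intro w
    rw [Finset.prod_range, ← e.prod_comp]
    simp [x]
  have hstate := QueryAlgorithm.state_andThen
    (⟨W, Fintype.card κ, i, B, fun s => out s.2⟩ : QueryAlgorithm Q R) (unitaryKronecker 1 V) O
  rw [hB O φ hO] at hstate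
  simp only [hprod, hx] at hstate
  rw [unitaryKronecker_one_mulVec_entangle] at hstate
  rw [← mass_norm_sq_entangle hv (fun _ => x₀), ← hstate]
  rfl

/-- The `m`-fold tensor power of a unitary. -/
def tensorPower (V : Matrix.unitaryGroup W ℂ) (m : ℕ) : Matrix.unitaryGroup (Fin m → W) ℂ :=
  ⟨Matrix.of fun s t => ∏ i, (V : Matrix W W ℂ) (s i) (t i), by
    rw [Matrix.mem_unitaryGroup_iff]
    ext s t
    have hV : ∀ a b, ∑ c, (V : Matrix W W ℂ) a c * star ((V : Matrix W W ℂ) b c) =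
        if a = b then 1 else 0 := by
      intro a b
      have := congrFun (congrFun (Matrix.mem_unitaryGroup_iff.1 V.2) a) b
      simpa [Matrix.mul_apply, Matrix.one_apply] using this
    simp only [Matrix.mul_apply, Matrix.star_apply, Matrix.of_apply, star_prod,
      ← Finset.prod_mul_distrib]
    rw [← Fintype.prod_sum (fun i c => (V : Matrix W W ℂ) (s i) c *
      star ((V : Matrix W W ℂ) (t i) c))]
    simp only [hV, Matrix.one_apply, Finset.prod_ite_zero, Finset.mem_univ, true_imp_iff,
      funext_iff, Finset.prod_const_one]⟩

lemma tensorPower_mulVec (V : Matrix.unitaryGroup W ℂ) (m : ℕ) (ψ : Fin m → W → ℂ)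
    (s : Fin m → W) :
    ((tensorPower V m : Matrix (Fin m → W) (Fin m → W) ℂ) *ᵥ fun t => ∏ i, ψ i (t i)) s =
      ∏ i, ((V : Matrix W W ℂ) *ᵥ ψ i) (s i) := by
  simp only [tensorPower, Matrix.mulVec, dotProduct, Matrix.of_apply, ← Finset.prod_mul_distrib]
  rw [Fintype.prod_sum]

theorem exists_nonadaptive_iid (hv : ∀ x, ∑ q, ‖v x q‖ ^ 2 = 1) (x₀ : X)
    (q : κ → W → X) {u : W → ℂ} (hu : ∑ w, ‖u w‖ ^ 2 = 1) (V : Matrix.unitaryGroup W ℂ)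
    (m : ℕ) (out : (Fin m → W) → R) :
    ∃ A : QueryAlgorithm Q R, A.queries = m * Fintype.card κ ∧
      ∀ (O : Matrix Q Q ℂ) (φ : X → ℂ), (∀ x, O *ᵥ v x = φ x • v x) → ∀ S : Set R,
        A.prob O S =
          mass (iid fun w => ‖((V : Matrix W W ℂ) *ᵥ fun w => (∏ k, φ (q k w)) * u w) w‖ ^ 2)
            (out ⁻¹' S) := by
  have hu' : ∑ w : Fin m → W, ‖∏ i, u (w i)‖ ^ 2 = 1 := by
    simp only [norm_prod, ← Finset.prod_pow]
    rw [← Fintype.prod_sum (fun (_ : Fin m) w => ‖u w‖ ^ 2)]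
    simp [hu]
  obtain ⟨A, hA, h⟩ := exists_nonadaptive (κ := Fin m × κ) hv x₀ (fun k w => q k.2 (w k.1)) hu'
    (tensorPower V m) out
  refine ⟨A, by simpa using hA, fun O φ hO S => (h O φ hO S).trans ?_⟩
  congr 1
  ext w
  simp only [iid, Fintype.prod_prod_type, ← Finset.prod_mul_distrib]
  rw [tensorPower_mulVec V m (fun _ w => (∏ k, φ (q k w)) * u w) w, norm_prod, Finset.prod_pow]

end Nonadaptive

/-! ### Fourier analysis of multiplicative derivatives -/

section PositiveDefinite

variable {G ι : Type*} [AddCommGroup G] [Fintype ι] {P : ι → ℝ} {χ : ι → AddChar G ℂ}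
  {F : G → ℝ}

lemma abs_sum_le_sum_mul_norm (hP : ∀ u, 0 ≤ P u)
    (hF : ∀ v, (F v : ℂ) = ∑ u, (P u : ℂ) * χ u v) (A : Finset G) :
    |∑ v ∈ A, F v| ≤ ∑ u, P u * ‖∑ v ∈ A, χ u v‖ := by
  have hsum : ((∑ v ∈ A, F v : ℝ) : ℂ) = ∑ u, (P u : ℂ) * ∑ v ∈ A, χ u v := by
    push_cast
    simp only [hF, Finset.mul_sum]
    exact Finset.sum_comm
  rw [← Real.norm_eq_abs, ← Complex.norm_real, hsum]
  refine (norm_sum_le _ _).trans_eq (Finset.sum_congr rfl fun u _ => ?_)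
  rw [norm_mul, Complex.norm_real, Real.norm_of_nonneg (hP u)]

variable [Finite G]

lemma sum_sum_sub_eq_sum_mul_norm_sq (hF : ∀ v, (F v : ℂ) = ∑ u, (P u : ℂ) * χ u v)
    (A : Finset G) :
    ∑ v ∈ A, ∑ v' ∈ A, F (v - v') = ∑ u, P u * ‖∑ v ∈ A, χ u v‖ ^ 2 := by
  have hnorm : ∀ u, (‖∑ v ∈ A, χ u v‖ : ℂ) ^ 2 = ∑ v ∈ A, ∑ v' ∈ A, χ u (v - v') := by
    intro u
    simp only [← Complex.mul_conj', map_sum, Finset.sum_mul_sum, sub_eq_add_neg,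
      AddChar.map_add_eq_mul, AddChar.map_neg_eq_conj]
  rw [← Complex.ofReal_inj]
  push_cast
  simp only [hF, hnorm, Finset.mul_sum]
  rw [Finset.sum_comm (s := Finset.univ)]
  exact Finset.sum_congr rfl fun v _ => Finset.sum_comm

lemma sq_sum_le_sum_sum_sub (hP : P ∈ stdSimplex ℝ ι)
    (hF : ∀ v, (F v : ℂ) = ∑ u, (P u : ℂ) * χ u v) (A : Finset G) :
    (∑ v ∈ A, F v) ^ 2 ≤ ∑ v ∈ A, ∑ v' ∈ A, F (v - v') := by
  calc (∑ v ∈ A, F v) ^ 2 ≤ (∑ u, P u * ‖∑ v ∈ A, χ u v‖) ^ 2 := by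
        rw [← sq_abs]
        exact pow_le_pow_left₀ (abs_nonneg _) (abs_sum_le_sum_mul_norm hP.1 hF A) 2
    _ ≤ (∑ u, P u) * ∑ u, P u * ‖∑ v ∈ A, χ u v‖ ^ 2 :=
        Finset.sum_sq_le_sum_mul_sum_of_sq_le_mul _ (fun u _ => hP.1 u)
          (fun u _ => mul_nonneg (hP.1 u) (sq_nonneg _)) fun u _ => by
            rw [mul_pow, sq (P u), mul_assoc]
    _ = ∑ v ∈ A, ∑ v' ∈ A, F (v - v') := by
        rw [hP.2, one_mul, sum_sum_sub_eq_sum_mul_norm_sq hF]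

end PositiveDefinite

section Fourier

variable {p n : ℕ} [Fact p.Prime]

lemma card_pow_pos (p n : ℕ) [Fact p.Prime] : (0 : ℝ) < (p : ℝ) ^ n :=
  pow_pos (by exact_mod_cast (Fact.out : p.Prime).pos) _

lemma card_pow_ne_zero (p n : ℕ) [Fact p.Prime] : (p : ℂ) ^ n ≠ 0 :=
  pow_ne_zero _ (by exact_mod_cast (Fact.out : p.Prime).ne_zero)

lemma expect_eq_inv_mul_sum {𝕜 : Type*} [Field 𝕜] [CharZero 𝕜] (g : (Fin n → ZMod p) → 𝕜) :
    Finset.expect Finset.univ g = ((p : 𝕜) ^ n)⁻¹ * ∑ x, g x := by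
  rw [Fintype.expect_eq_sum_div_card]
  simp [ZMod.card, div_eq_inv_mul]

lemma conj_stdAddChar (a : ZMod p) :
    starRingEnd ℂ (ZMod.stdAddChar a) = ZMod.stdAddChar (-a) :=
  (AddChar.map_neg_eq_conj _ _).symm

lemma sum_stdAddChar_mul (b : ZMod p) :
    ∑ c : ZMod p, (ZMod.stdAddChar (c * b) : ℂ) = if b = 0 then (p : ℂ) else 0 := by
  simpa [ZMod.card] using
    AddChar.sum_mulShift (R' := ℂ) b (ZMod.isPrimitive_stdAddChar p)

lemma sum_stdAddChar_dotProduct (y : Fin n → ZMod p) :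
    ∑ x : Fin n → ZMod p, ZMod.stdAddChar (x ⬝ᵥ y) = if y = 0 then (p : ℂ) ^ n else 0 := by
  have hprod : ∀ x : Fin n → ZMod p, (ZMod.stdAddChar (x ⬝ᵥ y) : ℂ) =
      ∏ i, ZMod.stdAddChar (x i * y i) := fun x =>
    map_sum (ZMod.stdAddChar (N := p)).toAddMonoidHom _ _
  simp only [hprod]
  rw [← Fintype.prod_sum (fun i (c : ZMod p) => (ZMod.stdAddChar (c * y i) : ℂ))]
  simp [sum_stdAddChar_mul, Finset.prod_ite_zero, funext_iff]

lemma sum_stdAddChar_mul_sum (a : (Fin n → ZMod p) → ℂ) (y : Fin n → ZMod p) :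
    ∑ k : Fin n → ZMod p, ZMod.stdAddChar (-(k ⬝ᵥ y)) * ∑ z, a z * ZMod.stdAddChar (z ⬝ᵥ k) =
      (p : ℂ) ^ n * a y := by
  have hterm : ∀ z k : Fin n → ZMod p, ZMod.stdAddChar (-(k ⬝ᵥ y)) *
      (a z * ZMod.stdAddChar (z ⬝ᵥ k)) = a z * ZMod.stdAddChar (k ⬝ᵥ (z - y)) := by
    intro z k
    rw [dotProduct_sub, sub_eq_neg_add, AddChar.map_add_eq_mul, dotProduct_comm z k]
    ring
  simp only [Finset.mul_sum]
  rw [Finset.sum_comm]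
  simp only [hterm, ← Finset.mul_sum, sum_stdAddChar_dotProduct, sub_eq_zero, mul_ite, mul_zero,
    Finset.sum_ite_eq', Finset.mem_univ, if_true]
  exact mul_comm _ _

lemma sum_norm_sq_sum_mul_stdAddChar (a : (Fin n → ZMod p) → ℂ) :
    ∑ k : Fin n → ZMod p, ‖∑ z, a z * ZMod.stdAddChar (z ⬝ᵥ k)‖ ^ 2 =
      (p : ℝ) ^ n * ∑ z, ‖a z‖ ^ 2 := by
  have hnorm : ∀ k : Fin n → ZMod p, (‖∑ z, a z * ZMod.stdAddChar (z ⬝ᵥ k)‖ : ℂ) ^ 2 =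
      ∑ y, starRingEnd ℂ (a y) *
        (ZMod.stdAddChar (-(k ⬝ᵥ y)) * ∑ z, a z * ZMod.stdAddChar (z ⬝ᵥ k)) := by
    intro k
    simp only [← Complex.conj_mul', map_sum, map_mul, conj_stdAddChar, ← mul_assoc,
      ← Finset.sum_mul, dotProduct_comm k]
  rw [← Complex.ofReal_inj]
  push_cast
  simp only [hnorm]
  rw [Finset.sum_comm, Finset.mul_sum]
  refine Finset.sum_congr rfl fun y _ => ?_
  rw [← Finset.mul_sum, sum_stdAddChar_mul_sum, ← Complex.conj_mul']
  ring

lemma expect_mulDeriv (g : (Fin n → ZMod p) → ℂ) (k : Fin n → ZMod p) :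
    Finset.expect Finset.univ (mulDeriv k g) =
      ∑ z, (‖fourierCoeff g z‖ : ℂ) ^ 2 * ZMod.stdAddChar (z ⬝ᵥ k) := by
  have hterm : ∀ z, (‖fourierCoeff g z‖ : ℂ) ^ 2 * ZMod.stdAddChar (z ⬝ᵥ k) =
      ((p : ℂ) ^ n)⁻¹ * ((p : ℂ) ^ n)⁻¹ * ∑ x', ∑ x, g x * starRingEnd ℂ (g x') *
        ZMod.stdAddChar (z ⬝ᵥ (x' + k - x)) := by
    intro z
    rw [← Complex.mul_conj', fourierCoeff, expect_eq_inv_mul_sum, map_mul, map_sum]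
    simp only [map_mul, map_inv₀, map_pow, Complex.conj_natCast, conj_stdAddChar, neg_neg]
    rw [mul_mul_mul_comm, Finset.sum_mul_sum, Finset.sum_comm, mul_assoc, Finset.sum_mul]
    congr 1
    refine Finset.sum_congr rfl fun x' _ => ?_
    rw [Finset.sum_mul]
    refine Finset.sum_congr rfl fun x _ => ?_
    rw [dotProduct_sub, dotProduct_add, sub_eq_add_neg, AddChar.map_add_eq_mul,
      AddChar.map_add_eq_mul, dotProduct_comm z x, dotProduct_comm z x']
    ring
  have hinner : ∀ x', ∑ z, ∑ x, g x * starRingEnd ℂ (g x') *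
      ZMod.stdAddChar (z ⬝ᵥ (x' + k - x)) = (p : ℂ) ^ n * mulDeriv k g x' := by
    intro x'
    rw [Finset.sum_comm]
    simp only [← Finset.mul_sum, sum_stdAddChar_dotProduct, sub_eq_zero, mul_ite, mul_zero,
      Finset.sum_ite_eq, Finset.mem_univ, if_true, mulDeriv]
    ring
  simp only [hterm, ← Finset.mul_sum]
  rw [Finset.sum_comm, expect_eq_inv_mul_sum]
  simp only [hinner, ← Finset.mul_sum]
  rw [mul_assoc, inv_mul_cancel_left₀ (card_pow_ne_zero p n)]

lemma norm_sq_fourierCoeff_eq (g : (Fin n → ZMod p) → ℂ) (y : Fin n → ZMod p) :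
    (‖fourierCoeff g y‖ : ℂ) ^ 2 = ((p : ℂ) ^ n)⁻¹ * ∑ k : Fin n → ZMod p,
      ZMod.stdAddChar (-(k ⬝ᵥ y)) * Finset.expect Finset.univ (mulDeriv k g) := by
  simp only [expect_mulDeriv]
  rw [sum_stdAddChar_mul_sum, inv_mul_cancel_left₀ (card_pow_ne_zero p n)]

lemma sum_norm_sq_expect_mulDeriv (g : (Fin n → ZMod p) → ℂ) :
    ∑ k, ‖Finset.expect Finset.univ (mulDeriv k g)‖ ^ 2 =
      (p : ℝ) ^ n * ∑ z, ‖fourierCoeff g z‖ ^ 4 := by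
  simp only [expect_mulDeriv, sum_norm_sq_sum_mul_stdAddChar, norm_pow, Complex.norm_real,
    norm_norm, ← pow_mul]

lemma norm_mulDeriv {f : (Fin n → ZMod p) → ℂ} (hf : ∀ x, ‖f x‖ = 1) (h x : Fin n → ZMod p) :
    ‖mulDeriv h f x‖ = 1 := by
  simp [mulDeriv, hf]

lemma mulDeriv_zero {f : (Fin n → ZMod p) → ℂ} (hf : ∀ x, ‖f x‖ = 1) :
    mulDeriv 0 f = fun _ => 1 := by
  ext x
  simp [mulDeriv, Complex.mul_conj', hf]

lemma mulDeriv_comm (h k : Fin n → ZMod p) (f : (Fin n → ZMod p) → ℂ) :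
    mulDeriv h (mulDeriv k f) = mulDeriv k (mulDeriv h f) := by
  ext x
  simp only [mulDeriv, map_mul, Complex.conj_conj, add_right_comm x h k]
  ring

lemma sum_norm_sq_fourierCoeff {g : (Fin n → ZMod p) → ℂ} (hg : ∀ x, ‖g x‖ = 1) :
    ∑ z, ‖fourierCoeff g z‖ ^ 2 = 1 := by
  have h := expect_mulDeriv g 0
  simp only [mulDeriv_zero hg, dotProduct_zero, AddChar.map_zero_eq_one, mul_one,
    Finset.expect_const Finset.univ_nonempty] at h
  exact_mod_cast h.symm

/-- The weights `|(Δ_h f)^(y)|²`, as a function of `(h, y)`. -/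
def derivWeight (f : (Fin n → ZMod p) → ℂ) (v : (Fin n → ZMod p) × (Fin n → ZMod p)) : ℝ :=
  ‖fourierCoeff (mulDeriv v.1 f) v.2‖ ^ 2

/-- The distribution `(h, y) ↦ p⁻ⁿ |(Δ_h f)^(y)|²`, sampled by the quantum algorithms. -/
def derivDist (f : (Fin n → ZMod p) → ℂ) (v : (Fin n → ZMod p) × (Fin n → ZMod p)) : ℝ :=
  ((p : ℝ) ^ n)⁻¹ * derivWeight f v

/-- The character `v ↦ ω_p ^ (⟨u₂, v₁⟩ - ⟨u₁, v₂⟩)`. -/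
def symplecticChar (u : (Fin n → ZMod p) × (Fin n → ZMod p)) :
    AddChar ((Fin n → ZMod p) × (Fin n → ZMod p)) ℂ :=
  ZMod.stdAddChar.compAddMonoidHom
    (AddMonoidHom.mk' (fun v => u.2 ⬝ᵥ v.1 - u.1 ⬝ᵥ v.2) fun v w => by
      simp only [Prod.fst_add, Prod.snd_add, dotProduct_add]
      ring)

lemma mass_derivDist (f : (Fin n → ZMod p) → ℂ) (S : Set ((Fin n → ZMod p) × (Fin n → ZMod p))) :
    mass (derivDist f) S = ((p : ℝ) ^ n)⁻¹ * ∑ v, S.indicator (derivWeight f) v := by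
  rw [mass, Finset.mul_sum]
  refine Finset.sum_congr rfl fun v _ => ?_
  rw [← Set.indicator_const_mul]
  rfl

lemma derivWeight_nonneg (f : (Fin n → ZMod p) → ℂ) (v) : 0 ≤ derivWeight f v :=
  sq_nonneg _

lemma derivWeight_eq_sum (f : (Fin n → ZMod p) → ℂ) (v : (Fin n → ZMod p) × (Fin n → ZMod p)) :
    (derivWeight f v : ℂ) = ∑ u, (derivDist f u : ℂ) * symplecticChar u v := by
  rw [derivWeight, Complex.ofReal_pow, norm_sq_fourierCoeff_eq, Fintype.sum_prod_type,
    Finset.mul_sum]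
  refine Finset.sum_congr rfl fun k _ => ?_
  rw [mulDeriv_comm, expect_mulDeriv, Finset.mul_sum, Finset.mul_sum]
  refine Finset.sum_congr rfl fun z _ => ?_
  simp only [derivDist, derivWeight, symplecticChar, AddChar.compAddMonoidHom_apply,
    AddMonoidHom.mk'_apply, sub_eq_add_neg, AddChar.map_add_eq_mul]
  push_cast
  ring

lemma gowersAverage_one (g : (Fin n → ZMod p) → ℂ) :
    gowersAverage 1 g = (‖Finset.expect Finset.univ g‖ : ℂ) ^ 2 := by
  have hshift : ∀ x, ∑ h, mulDeriv h g x = ∑ y, g y * starRingEnd ℂ (g x) := fun x =>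
    Equiv.sum_comp (Equiv.addLeft x) fun y => g y * starRingEnd ℂ (g x)
  rw [← Complex.mul_conj']
  simp only [gowersAverage, expect_eq_inv_mul_sum, map_mul, map_inv₀, map_pow,
    Complex.conj_natCast, map_sum]
  rw [← Finset.mul_sum, Finset.sum_comm, mul_mul_mul_comm, mul_comm (∑ x, g x),
    Finset.sum_mul_sum, ← mul_assoc]
  simp only [hshift, mul_comm (g _)]

lemma gowersAverage_two (g : (Fin n → ZMod p) → ℂ) :
    gowersAverage 2 g = ((∑ z, ‖fourierCoeff g z‖ ^ 4 : ℝ) : ℂ) := by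
  have h := congrArg (fun r : ℝ => (r : ℂ)) (sum_norm_sq_expect_mulDeriv g)
  push_cast at h ⊢
  rw [gowersAverage]
  simp only [gowersAverage_one]
  rw [expect_eq_inv_mul_sum, h, inv_mul_cancel_left₀ (card_pow_ne_zero p n)]

lemma gowersAverage_three (f : (Fin n → ZMod p) → ℂ) :
    gowersAverage 3 f = ((∑ v, derivDist f v * derivWeight f v : ℝ) : ℂ) := by
  rw [gowersAverage]
  simp only [gowersAverage_two, derivDist, derivWeight]
  rw [expect_eq_inv_mul_sum, Fintype.sum_prod_type, Finset.mul_sum]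
  push_cast
  simp only [Finset.mul_sum]
  refine Finset.sum_congr rfl fun h _ => Finset.sum_congr rfl fun y _ => ?_
  ring

lemma sum_derivWeight {f : (Fin n → ZMod p) → ℂ} (hf : ∀ x, ‖f x‖ = 1)
    (h : Fin n → ZMod p) : ∑ y, derivWeight f (h, y) = 1 := by
  simp only [derivWeight]
  exact sum_norm_sq_fourierCoeff (norm_mulDeriv hf h)

lemma derivWeight_le_one {f : (Fin n → ZMod p) → ℂ} (hf : ∀ x, ‖f x‖ = 1)
    (v) : derivWeight f v ≤ 1 := by
  rw [← sum_derivWeight hf v.1]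
  exact Finset.single_le_sum (f := fun y => derivWeight f (v.1, y))
    (fun y _ => derivWeight_nonneg f _) (Finset.mem_univ v.2)

lemma derivDist_mem_stdSimplex {f : (Fin n → ZMod p) → ℂ} (hf : ∀ x, ‖f x‖ = 1) :
    derivDist f ∈ stdSimplex ℝ _ := by
  refine ⟨fun v => mul_nonneg (inv_nonneg.2 (card_pow_pos p n).le) (derivWeight_nonneg f v), ?_⟩
  simp only [derivDist, ← Finset.mul_sum]
  rw [Fintype.sum_prod_type]
  simp [sum_derivWeight hf, ZMod.card, (card_pow_pos p n).ne']

lemma derivWeight_zero {f : (Fin n → ZMod p) → ℂ} (hf : ∀ x, ‖f x‖ = 1) : derivWeight f 0 = 1 := by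
  simp [derivWeight, mulDeriv_zero hf, fourierCoeff]

lemma sq_sum_derivWeight_le {f : (Fin n → ZMod p) → ℂ} (hf : ∀ x, ‖f x‖ = 1)
    (A : Finset ((Fin n → ZMod p) × (Fin n → ZMod p))) :
    (∑ v ∈ A, derivWeight f v) ^ 2 ≤ ∑ v ∈ A, ∑ v' ∈ A, derivWeight f (v - v') :=
  sq_sum_le_sum_sum_sub (derivDist_mem_stdSimplex hf) (derivWeight_eq_sum f) A

end Fourier

/-! ### Fourier sampling -/

section FourierSampling

variable {p k : ℕ} [Fact p.Prime]

lemma mass_iid_comp_equiv {ι α β γ : Type*} [Fintype ι] [DecidableEq ι] [Fintype α] [Fintype β]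
    [Fintype γ] (D₁ : α → ℝ) (D₂ : β → ℝ) (e : γ ≃ α × β) (S : Set ((ι → α) × (ι → β))) :
    mass (iid fun c => prodDist D₁ D₂ (e c))
        {s : ι → γ | (fun i => (e (s i)).1, fun i => (e (s i)).2) ∈ S} =
      mass (prodDist (iid D₁) (iid D₂)) S := by
  rw [← mass_iid_prodDist]
  exact mass_comp_equiv (iid (prodDist D₁ D₂)) (Equiv.piCongrRight fun _ : ι => e)
    {s | (fun i => (s i).1, fun i => (s i).2) ∈ S}

/-- The quantum Fourier transform on `𝔽ₚᵏ`. -/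
def qft (p k : ℕ) [Fact p.Prime] : Matrix.unitaryGroup (Fin k → ZMod p) ℂ :=
  ⟨Matrix.of fun y x => ((√((p : ℝ) ^ k) : ℝ) : ℂ)⁻¹ * ZMod.stdAddChar (-(x ⬝ᵥ y)), by
    have hentry : ∀ x y z : Fin k → ZMod p,
        (((√((p : ℝ) ^ k) : ℝ) : ℂ)⁻¹ * ZMod.stdAddChar (-(x ⬝ᵥ y))) *
          star (((√((p : ℝ) ^ k) : ℝ) : ℂ)⁻¹ * (ZMod.stdAddChar (-(x ⬝ᵥ z)) : ℂ)) =
        ((p : ℂ) ^ k)⁻¹ * ZMod.stdAddChar (x ⬝ᵥ (z - y)) := by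
      intro x y z
      have hsqrt : ((√((p : ℝ) ^ k) : ℝ) : ℂ) * ((√((p : ℝ) ^ k) : ℝ) : ℂ) = (p : ℂ) ^ k := by
        rw [← Complex.ofReal_mul, Real.mul_self_sqrt (card_pow_pos p k).le]
        push_cast
        rfl
      rw [star_mul', RCLike.star_def, ← AddChar.map_neg_eq_conj, neg_neg, map_inv₀,
        Complex.conj_ofReal, ← hsqrt, mul_inv, dotProduct_sub, sub_eq_neg_add,
        AddChar.map_add_eq_mul]
      ring
    rw [Matrix.mem_unitaryGroup_iff]
    ext y z
    simp only [Matrix.mul_apply, Matrix.star_apply, Matrix.of_apply, hentry, ← Finset.mul_sum,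
      sum_stdAddChar_dotProduct, sub_eq_zero, Matrix.one_apply, eq_comm (a := z), mul_ite,
      inv_mul_cancel₀ (card_pow_ne_zero p k), mul_zero]⟩

lemma qft_mulVec (ψ : (Fin k → ZMod p) → ℂ) (y : Fin k → ZMod p) :
    ((qft p k : Matrix (Fin k → ZMod p) (Fin k → ZMod p) ℂ) *ᵥ ψ) y =
      ((√((p : ℝ) ^ k) : ℝ) : ℂ) * fourierCoeff ψ y := by
  have hpos := card_pow_pos p k
  have hsqrt : ((√((p : ℝ) ^ k) : ℝ) : ℂ) ≠ 0 := by
    exact_mod_cast (Real.sqrt_pos.2 hpos).ne'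
  have hsq : ((√((p : ℝ) ^ k) : ℝ) : ℂ) ^ 2 = (p : ℂ) ^ k := by
    rw [← Complex.ofReal_pow, Real.sq_sqrt hpos.le]
    push_cast
    rfl
  have hinv : ((√((p : ℝ) ^ k) : ℝ) : ℂ)⁻¹ =
      ((√((p : ℝ) ^ k) : ℝ) : ℂ) * ((p : ℂ) ^ k)⁻¹ := by
    rw [← hsq]
    field_simp
  simp only [fourierCoeff, expect_eq_inv_mul_sum, ← mul_assoc, ← hinv, qft, Matrix.mulVec,
    dotProduct, Matrix.of_apply]
  rw [Finset.mul_sum]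
  exact Finset.sum_congr rfl fun x _ => by ring

variable {Q R X Z κ : Type} [Fintype Q] [DecidableEq Q] [Fintype Z] [Fintype κ]

/-- The outcome distribution of Fourier sampling with the phases `Φ`: `z` is uniform and, given
`z`, the outcome `y` has probability `|𝔼ₓ Φ (x, z) ω_p ^ (-⟨x, y⟩)|²`. -/
def fourierDist (Φ : (Fin k → ZMod p) × Z → ℂ) (w : (Fin k → ZMod p) × Z) : ℝ :=
  (Fintype.card Z : ℝ)⁻¹ * ‖fourierCoeff (fun x => Φ (x, w.2)) w.1‖ ^ 2

lemma norm_sq_qft_kronecker_mulVec [DecidableEq Z] (Φ : (Fin k → ZMod p) × Z → ℂ)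
    (w : (Fin k → ZMod p) × Z) :
    ‖(((qft p k : Matrix _ _ ℂ) ⊗ₖ (1 : Matrix Z Z ℂ)) *ᵥ fun w =>
      Φ w * (((√((p : ℝ) ^ k))⁻¹ * (√(Fintype.card Z : ℝ))⁻¹ : ℝ) : ℂ)) w‖ ^ 2 =
        fourierDist Φ w := by
  have hp := card_pow_pos p k
  have hsqrt : √((p : ℝ) ^ k) ≠ 0 := (Real.sqrt_pos.2 hp).ne'
  have hcoeff (c : ℂ) : fourierCoeff (fun x => Φ (x, w.2) * c) w.1 =
      c * fourierCoeff (fun x => Φ (x, w.2)) w.1 := by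
    simp only [fourierCoeff, Finset.mul_expect]
    exact Finset.expect_congr rfl fun x _ => by ring
  rw [kronecker_one_mulVec_apply, qft_mulVec, hcoeff, fourierDist, norm_mul, norm_mul,
    Complex.norm_real, Complex.norm_real, Real.norm_of_nonneg (by positivity),
    Real.norm_of_nonneg (by positivity), ← mul_assoc, mul_inv_cancel_left₀ hsqrt, mul_pow, inv_pow,
    Real.sq_sqrt (Nat.cast_nonneg _)]

theorem exists_fourierSampling [Nonempty Z] {v : X → Q → ℂ} (hv : ∀ x, ∑ q, ‖v x q‖ ^ 2 = 1)
    (x₀ : X) (q : κ → (Fin k → ZMod p) × Z → X) (m : ℕ)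
    (out : (Fin m → (Fin k → ZMod p) × Z) → R) :
    ∃ A : QueryAlgorithm Q R, A.queries = m * Fintype.card κ ∧
      ∀ (O : Matrix Q Q ℂ) (φ : X → ℂ), (∀ x, O *ᵥ v x = φ x • v x) → ∀ S : Set R,
        A.prob O S = mass (iid (fourierDist fun r => ∏ j, φ (q j r))) (out ⁻¹' S) := by
  classical
  have hp := card_pow_pos p k
  have hZ : (0 : ℝ) < Fintype.card Z := by exact_mod_cast Fintype.card_pos
  set c : ℝ := (√((p : ℝ) ^ k))⁻¹ * (√(Fintype.card Z : ℝ))⁻¹ with hc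
  have hc_sq : c ^ 2 = ((p : ℝ) ^ k)⁻¹ * (Fintype.card Z : ℝ)⁻¹ := by
    rw [hc, mul_pow, inv_pow, inv_pow, Real.sq_sqrt hp.le, Real.sq_sqrt hZ.le]
  have hu : ∑ _w : (Fin k → ZMod p) × Z, ‖(c : ℂ)‖ ^ 2 = 1 := by
    simp only [Complex.norm_real, Real.norm_eq_abs, sq_abs, hc_sq, Finset.sum_const,
      Finset.card_univ, Fintype.card_prod, Fintype.card_fun, ZMod.card, Fintype.card_fin,
      nsmul_eq_mul, Nat.cast_mul, Nat.cast_pow]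
    field_simp
  obtain ⟨A, hA, hprob⟩ := exists_nonadaptive_iid hv x₀ q hu
    (unitaryKronecker (qft p k) (1 : Matrix.unitaryGroup Z ℂ)) m out
  refine ⟨A, hA, fun O φ hO S => (hprob O φ hO S).trans ?_⟩
  congr 2
  ext w
  exact norm_sq_qft_kronecker_mulVec (fun r => ∏ j, φ (q j r)) w

end FourierSampling

section BitSampling

variable {n : ℕ}

/-- The vectors `|x⟩ ⊗ (|0⟩ + (-1)ᶜ|1⟩)/√2`, indexed by the pairs `(x, c)`. They are eigenvectors
of every bit-flip oracle. -/
def kickback (x : (Fin n → ZMod 2) × ZMod 2) (s : (Fin n → ZMod 2) × ZMod 2) : ℂ :=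
  if s.1 = x.1 then ((√2 : ℝ) : ℂ)⁻¹ * ZMod.stdAddChar (x.2 * s.2) else 0

lemma sum_norm_sq_kickback (x : (Fin n → ZMod 2) × ZMod 2) : ∑ s, ‖kickback x s‖ ^ 2 = 1 := by
  rw [Fintype.sum_prod_type, Finset.sum_eq_single x.1]
  · simp [kickback]
  · intro b _ hb
    simp [kickback, hb]
  · simp

lemma bitOracle_mulVec_kickback (f : (Fin n → ZMod 2) → ZMod 2)
    (x : (Fin n → ZMod 2) × ZMod 2) :
    bitOracle f *ᵥ kickback x = (ZMod.stdAddChar (x.2 * f x.1) : ℂ) • kickback x := by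
  have hinvol : ∀ s : (Fin n → ZMod 2) × ZMod 2, s = (s.1, s.2 + f s.1 + f s.1) := fun s => by
    rw [add_assoc, CharTwo.add_self_eq_zero, add_zero]
  ext s
  simp only [Matrix.mulVec, dotProduct, bitOracle, Matrix.of_apply, Pi.smul_apply, smul_eq_mul]
  rw [Finset.sum_eq_single (s.1, s.2 + f s.1)]
  · simp only [← hinvol, if_true, one_mul, kickback]
    split_ifs with hx
    · rw [hx, mul_add, AddChar.map_add_eq_mul]
      ring
    · simp
  · intro t _ ht
    rw [if_neg, zero_mul]
    rintro rfl
    exact ht (hinvol t)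
  · simp

/-- The distribution of `(z, f z)` for uniform `z`. -/
def graphDist (f : (Fin n → ZMod 2) → ZMod 2) (c : (Fin n → ZMod 2) × ZMod 2) : ℝ :=
  if c.2 = f c.1 then ((2 : ℝ) ^ n)⁻¹ else 0

lemma sum_graphDist_mul (f : (Fin n → ZMod 2) → ZMod 2) (Y : (Fin n → ZMod 2) × ZMod 2 → ℝ) :
    ∑ c, graphDist f c * Y c = ((2 : ℝ) ^ n)⁻¹ * ∑ z, Y (z, f z) := by
  rw [Fintype.sum_prod_type, Finset.mul_sum]
  refine Finset.sum_congr rfl fun z _ => ?_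
  simp [graphDist, ite_mul]

lemma graphDist_mem_stdSimplex (f : (Fin n → ZMod 2) → ZMod 2) :
    graphDist f ∈ stdSimplex ℝ ((Fin n → ZMod 2) × ZMod 2) := by
  refine ⟨fun c => ?_, by simpa [ZMod.card] using sum_graphDist_mul f fun _ => 1⟩
  unfold graphDist
  split_ifs <;> positivity

lemma fourierCoeff_tail_mul_stdAddChar (g : (Fin n → ZMod 2) → ℂ) (d : ZMod 2)
    (y : Fin (n + 1) → ZMod 2) :
    fourierCoeff (fun a : Fin (n + 1) → ZMod 2 => g (Fin.tail a) * ZMod.stdAddChar (a 0 * d)) y =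
      if y 0 = d then fourierCoeff g (Fin.tail y) else 0 := by
  have hsum : ∀ Ψ : (Fin (n + 1) → ZMod 2) → ℂ,
      ∑ a, Ψ a = ∑ c : ZMod 2, ∑ x : Fin n → ZMod 2, Ψ (Fin.cons c x) := by
    intro Ψ
    rw [← (Fin.consEquiv fun _ : Fin (n + 1) => ZMod 2).sum_comp, Fintype.sum_prod_type]
    rfl
  have hterm : ∀ (c : ZMod 2) (x : Fin n → ZMod 2),
      g x * ZMod.stdAddChar (c * d) *
        ZMod.stdAddChar (-((Fin.cons c x : Fin (n + 1) → ZMod 2) ⬝ᵥ y)) =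
      (ZMod.stdAddChar (c * (d - y 0)) : ℂ) *
        (g x * ZMod.stdAddChar (-(x ⬝ᵥ Fin.tail y))) := by
    intro c x
    have hdot : (Fin.cons c x : Fin (n + 1) → ZMod 2) ⬝ᵥ y = c * y 0 + x ⬝ᵥ Fin.tail y := by
      simp [dotProduct, Fin.sum_univ_succ, Fin.tail]
    rw [hdot, neg_add, AddChar.map_add_eq_mul, mul_sub, sub_eq_add_neg, AddChar.map_add_eq_mul]
    ring
  simp only [fourierCoeff, expect_eq_inv_mul_sum, hsum, Fin.tail_cons, Fin.cons_zero, hterm,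
    ← Finset.mul_sum, ← Finset.sum_mul, sum_stdAddChar_mul, sub_eq_zero, eq_comm (a := d)]
  split_ifs
  · push_cast
    rw [pow_succ]
    field_simp
  · simp

/-- The regrouping of a measurement outcome into a sample of `derivDist` and one of `graphDist`. -/
def regroupBit (n : ℕ) : (Fin (n + 1) → ZMod 2) × ((Fin n → ZMod 2) × (Fin n → ZMod 2)) ≃
    ((Fin n → ZMod 2) × (Fin n → ZMod 2)) × ((Fin n → ZMod 2) × ZMod 2) where
  toFun r := ((r.2.1, Fin.tail r.1), (r.2.2, r.1 0))
  invFun t := (Fin.cons t.2.2 t.1.2, (t.1.1, t.2.1))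
  left_inv r := by simp
  right_inv t := by simp

/-- The three positions of `f` queried for one sample, the first component of the register being
`(a 0, x)`: two queries produce the derivative of `(-1)ᶠ` at `x` and the third one produces the
phase `(-1) ^ (a 0 * f z)`, from which the Fourier transform reads off `f z`. -/
def bitQuery (j : Fin 3) (r : (Fin (n + 1) → ZMod 2) × ((Fin n → ZMod 2) × (Fin n → ZMod 2))) :
    (Fin n → ZMod 2) × ZMod 2 :=
  ![(Fin.tail r.1, 1), (Fin.tail r.1 + r.2.1, 1), (r.2.2, r.1 0)] j

lemma fourierDist_bitQuery (f : (Fin n → ZMod 2) → ZMod 2) :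
    fourierDist (fun r => ∏ j, (ZMod.stdAddChar ((bitQuery j r).2 * f (bitQuery j r).1) : ℂ)) =
      fun r => prodDist (derivDist fun x => (ZMod.stdAddChar (f x) : ℂ)) (graphDist f)
        (regroupBit n r) := by
  ext r
  have hphase : (fun a : Fin (n + 1) → ZMod 2 => ∏ j,
      (ZMod.stdAddChar ((bitQuery j (a, r.2)).2 * f (bitQuery j (a, r.2)).1) : ℂ)) =
      fun a => mulDeriv r.2.1 (fun x => (ZMod.stdAddChar (f x) : ℂ)) (Fin.tail a) *
        ZMod.stdAddChar (a 0 * f r.2.2) := by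
    ext a
    simp [bitQuery, Fin.prod_univ_three, mulDeriv, conj_stdAddChar, mul_comm]
  have hgraph : graphDist f (regroupBit n r).2 =
      if r.1 0 = f r.2.2 then ((2 : ℝ) ^ n)⁻¹ else 0 := rfl
  rw [fourierDist, hphase, fourierCoeff_tail_mul_stdAddChar, prodDist, hgraph]
  simp only [regroupBit, Equiv.coe_fn_mk, derivDist, derivWeight, Fintype.card_prod,
    Fintype.card_fun, ZMod.card, Fintype.card_fin]
  push_cast
  by_cases hr : r.1 0 = f r.2.2
  · rw [if_pos hr, if_pos hr, mul_inv]
    ring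
  · rw [if_neg hr, if_neg hr, norm_zero]
    ring

theorem exists_bitSampling {R : Type} (m : ℕ)
    (out : (Fin m → (Fin n → ZMod 2) × (Fin n → ZMod 2)) →
      (Fin m → (Fin n → ZMod 2) × ZMod 2) → R) :
    ∃ A : QueryAlgorithm ((Fin n → ZMod 2) × ZMod 2) R, A.queries = m * 3 ∧
      ∀ (f : (Fin n → ZMod 2) → ZMod 2) (S : Set R), A.prob (bitOracle f) S =
        mass (prodDist (iid (derivDist fun x => (ZMod.stdAddChar (f x) : ℂ))) (iid (graphDist f)))
          {t | out t.1 t.2 ∈ S} := by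
  obtain ⟨A, hA, hprob⟩ := exists_fourierSampling sum_norm_sq_kickback 0 (bitQuery (n := n)) m
    fun w => out (fun i => (regroupBit n (w i)).1) fun i => (regroupBit n (w i)).2
  refine ⟨A, by simpa using hA, fun f S => ?_⟩
  rw [hprob _ _ (bitOracle_mulVec_kickback f) S, fourierDist_bitQuery]
  exact mass_iid_comp_equiv _ _ (regroupBit n) {t | out t.1 t.2 ∈ S}

end BitSampling

section PhaseSampling

variable {p n : ℕ} [Fact p.Prime]

/-- The uniform distribution. -/
def uniformDist (α : Type*) [Fintype α] (_ : α) : ℝ :=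
  (Fintype.card α : ℝ)⁻¹

lemma uniformDist_mem_stdSimplex (α : Type*) [Fintype α] [Nonempty α] :
    uniformDist α ∈ stdSimplex ℝ α := by
  refine ⟨fun _ => by unfold uniformDist; positivity, ?_⟩
  simp [uniformDist]

lemma sum_norm_sq_single {α : Type*} [Fintype α] [DecidableEq α] (x : α) :
    ∑ y, ‖(Pi.single x 1 : α → ℂ) y‖ ^ 2 = 1 := by
  rw [Finset.sum_eq_single x] <;> simp +contextual

lemma phaseOracle_mulVec_single (f : (Fin n → ZMod p) → ℂ) (x : Fin n → ZMod p) :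
    phaseOracle f *ᵥ Pi.single x 1 = f x • (Pi.single x 1 : (Fin n → ZMod p) → ℂ) := by
  rw [phaseOracle, Matrix.diagonal_mulVec_single, ← Pi.single_smul, smul_eq_mul]

lemma norm_eq_one_of_pow_prime_eq_one {z : ℂ} (hz : z ^ p = 1) : ‖z‖ = 1 :=
  Complex.norm_eq_one_of_pow_eq_one hz (Fact.out : p.Prime).ne_zero

lemma conj_eq_pow_sub_one {z : ℂ} (hz : z ^ p = 1) : starRingEnd ℂ z = z ^ (p - 1) := by
  have hnorm := norm_eq_one_of_pow_prime_eq_one hz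
  have hz₀ : z ≠ 0 := norm_ne_zero_iff.1 (hnorm ▸ one_ne_zero)
  refine mul_left_cancel₀ hz₀ ?_
  rw [← pow_succ', Nat.sub_add_cancel (Fact.out : p.Prime).one_lt.le, hz, Complex.mul_conj', hnorm]
  norm_num

/-- The regrouping of a measurement outcome into a sample of `derivDist` and one of `Z`. -/
def regroupPhase (p n : ℕ) (Z : Type*) :
    (Fin n → ZMod p) × ((Fin n → ZMod p) × Z) ≃ ((Fin n → ZMod p) × (Fin n → ZMod p)) × Z where
  toFun r := ((r.2.1, r.1), r.2.2)
  invFun t := (t.1.2, (t.1.1, t.2))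
  left_inv _ := rfl
  right_inv _ := rfl

/-- The `p` positions of `f` queried for one sample: the phase `f (x + h) * f x ^ (p - 1)` is the
derivative of `f` when `f` takes values in the `p`-th roots of unity. -/
def phaseQuery {Z : Type} (j : Option (Fin (p - 1)))
    (r : (Fin n → ZMod p) × ((Fin n → ZMod p) × Z)) : Fin n → ZMod p :=
  j.elim (r.1 + r.2.1) fun _ => r.1

variable {Z : Type} [Fintype Z]

lemma fourierDist_phaseQuery {f : (Fin n → ZMod p) → ℂ} (hf : ∀ x, f x ^ p = 1) :
    fourierDist (fun r : (Fin n → ZMod p) × ((Fin n → ZMod p) × Z) => ∏ j, f (phaseQuery j r)) =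
      fun r => prodDist (derivDist f) (uniformDist Z) (regroupPhase p n Z r) := by
  ext r
  have hphase : (fun x => ∏ j, f (phaseQuery j (x, r.2))) = mulDeriv r.2.1 f := by
    ext x
    rw [Fintype.prod_option, mulDeriv, conj_eq_pow_sub_one (hf x)]
    simp [phaseQuery]
  rw [fourierDist, hphase]
  simp only [regroupPhase, Equiv.coe_fn_mk, prodDist, derivDist, derivWeight, uniformDist,
    Fintype.card_prod, Fintype.card_fun, ZMod.card, Fintype.card_fin]
  push_cast
  rw [mul_inv]
  ring

variable [Nonempty Z]

theorem exists_phaseSampling {R : Type} (m : ℕ)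
    (out : (Fin m → (Fin n → ZMod p) × (Fin n → ZMod p)) → (Fin m → Z) → R) :
    ∃ A : QueryAlgorithm (Fin n → ZMod p) R, A.queries = m * p ∧
      ∀ f : (Fin n → ZMod p) → ℂ, (∀ x, f x ^ p = 1) → ∀ S : Set R, A.prob (phaseOracle f) S =
        mass (prodDist (iid (derivDist f)) (iid (uniformDist Z))) {t | out t.1 t.2 ∈ S} := by
  obtain ⟨A, hA, hprob⟩ := exists_fourierSampling
    (v := fun x : Fin n → ZMod p => (Pi.single x 1 : (Fin n → ZMod p) → ℂ)) sum_norm_sq_single 0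
    phaseQuery m
    fun w => out (fun i => (regroupPhase p n Z (w i)).1) fun i => (regroupPhase p n Z (w i)).2
  refine ⟨A, by simpa [Nat.sub_add_cancel (Fact.out : p.Prime).one_lt.le] using hA,
    fun f hf S => ?_⟩
  rw [hprob _ _ (phaseOracle_mulVec_single f) S, fourierDist_phaseQuery hf]
  exact mass_iid_comp_equiv _ _ (regroupPhase p n Z) {t | out t.1 t.2 ∈ S}

end PhaseSampling

/-! ### Polar forms of quadratic polynomials -/

section PolarMatrix

variable {σ R : Type*} [Fintype σ] [CommRing R]

/-- `M` is a matrix of the polar form `P (x + h) - P x - P h + P 0` of `P`. -/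
def IsPolarMatrix (P : MvPolynomial σ R) (M : Matrix σ σ R) : Prop :=
  ∀ x h, MvPolynomial.eval (x + h) P =
    MvPolynomial.eval x P + MvPolynomial.eval h P - MvPolynomial.eval 0 P + x ⬝ᵥ (M *ᵥ h)

lemma exists_isPolarMatrix_monomial {s : σ →₀ ℕ} (hs : s.degree ≤ 2) (c : R) :
    ∃ M, IsPolarMatrix (MvPolynomial.monomial s c) M := by
  classical
  have eval_monomial : ∀ x, MvPolynomial.eval x (MvPolynomial.monomial s c) =
      c * ((Finsupp.toMultiset s).map x).prod := fun x => by
    rw [MvPolynomial.eval_monomial, Finsupp.toMultiset_map, Finsupp.prod_toMultiset,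
      Finsupp.prod_mapDomain_index (by simp) (by simp [pow_add])]
  simp only [IsPolarMatrix, eval_monomial]
  have hcard : (Finsupp.toMultiset s).card ≤ 2 := by rwa [Finsupp.card_toMultiset]
  generalize Finsupp.toMultiset s = t at hcard
  obtain h₀ | h₁ | h₂ : t.card = 0 ∨ t.card = 1 ∨ t.card = 2 := by omega
  · obtain rfl := Multiset.card_eq_zero.1 h₀
    exact ⟨0, fun x h => by simp⟩
  · obtain ⟨i, rfl⟩ := Multiset.card_eq_one.1 h₁
    exact ⟨0, fun x h => by simp [mul_add]⟩
  · obtain ⟨i, j, rfl⟩ := Multiset.card_eq_two.1 h₂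
    refine ⟨Matrix.single i j c + Matrix.single j i c, fun x h => ?_⟩
    simp only [Multiset.insert_eq_cons, Multiset.map_cons, Multiset.map_singleton,
      Multiset.prod_cons, Multiset.prod_singleton, Pi.add_apply, Pi.zero_apply,
      Matrix.add_mulVec, dotProduct_add, Matrix.single_mulVec]
    simp only [dotProduct, Function.update_apply, Pi.zero_apply, mul_ite, mul_zero,
      Finset.sum_ite_eq', Finset.mem_univ, if_true]
    ring

lemma exists_isPolarMatrix {P : MvPolynomial σ R} (hP : P.totalDegree ≤ 2) :
    ∃ M, IsPolarMatrix P M := by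
  choose! M hM using fun s (hs : s ∈ P.support) => exists_isPolarMatrix_monomial
    ((MvPolynomial.le_totalDegree hs).trans hP) (P.coeff s)
  refine ⟨∑ s ∈ P.support, M s, fun x h => ?_⟩
  have eval_eq_sum : ∀ y, MvPolynomial.eval y P =
      ∑ s ∈ P.support, MvPolynomial.eval y (MvPolynomial.monomial s (P.coeff s)) := fun y => by
    conv_lhs => rw [P.as_sum, map_sum]
  simp only [eval_eq_sum, Matrix.sum_mulVec, dotProduct_sum]
  rw [← Finset.sum_add_distrib, ← Finset.sum_sub_distrib, ← Finset.sum_add_distrib]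
  exact Finset.sum_congr rfl fun s hs => hM s hs x h

/-- A chosen matrix of the polar form of `P`, meaningful when `P` has degree at most `2`. -/
def polarMatrix (P : MvPolynomial σ R) : Matrix σ σ R :=
  Classical.epsilon (IsPolarMatrix P)

lemma isPolarMatrix_polarMatrix {P : MvPolynomial σ R} (hP : P.totalDegree ≤ 2) :
    IsPolarMatrix P (polarMatrix P) :=
  Classical.epsilon_spec (exists_isPolarMatrix hP)

end PolarMatrix

section PolarGraph

variable {p n : ℕ} [Fact p.Prime]

lemma IsPolarMatrix.derivWeight_eq {q : MvPolynomial (Fin n) (ZMod p)}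
    {M : Matrix (Fin n) (Fin n) (ZMod p)} (hM : IsPolarMatrix q M) (f : (Fin n → ZMod p) → ℂ)
    (h : Fin n → ZMod p) :
    derivWeight f (h, M *ᵥ h) = ‖Finset.expect Finset.univ
      (mulDeriv h fun x => f x * ZMod.stdAddChar (-MvPolynomial.eval x q))‖ ^ 2 := by
  have expect_eq : Finset.expect Finset.univ
      (mulDeriv h fun x => f x * ZMod.stdAddChar (-MvPolynomial.eval x q)) =
      ZMod.stdAddChar (-(MvPolynomial.eval h q - MvPolynomial.eval 0 q)) *
        fourierCoeff (mulDeriv h f) (M *ᵥ h) := by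
    rw [fourierCoeff, Finset.mul_expect]
    refine Finset.expect_congr rfl fun x _ => ?_
    have hchar : (ZMod.stdAddChar (-MvPolynomial.eval (x + h) q) : ℂ) *
        ZMod.stdAddChar (MvPolynomial.eval x q) =
        ZMod.stdAddChar (-(MvPolynomial.eval h q - MvPolynomial.eval 0 q)) *
          ZMod.stdAddChar (-(x ⬝ᵥ (M *ᵥ h))) := by
      rw [← AddChar.map_add_eq_mul, ← AddChar.map_add_eq_mul, hM]
      congr 1
      ring
    simp only [mulDeriv, map_mul, conj_stdAddChar, neg_neg]
    linear_combination f (x + h) * starRingEnd ℂ (f x) * hchar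
  rw [expect_eq, norm_mul, AddChar.norm_apply, one_mul, derivWeight]

lemma mass_derivDist_graph (f : (Fin n → ZMod p) → ℂ) (M : Matrix (Fin n) (Fin n) (ZMod p)) :
    mass (derivDist f) (M.mulVecLin.graph : Set _) =
      ((p : ℝ) ^ n)⁻¹ * ∑ h, derivWeight f (h, M *ᵥ h) := by
  rw [mass_derivDist, Fintype.sum_prod_type]
  congr 1
  refine Finset.sum_congr rfl fun h _ => ?_
  rw [Finset.sum_eq_single_of_mem (M *ᵥ h) (Finset.mem_univ _) fun y _ hy =>
    Set.indicator_of_notMem (by simpa using hy) _, Set.indicator_of_mem (by simp)]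

lemma IsPolarMatrix.mass_graph {q : MvPolynomial (Fin n) (ZMod p)}
    {M : Matrix (Fin n) (Fin n) (ZMod p)} (hM : IsPolarMatrix q M)
    (f : (Fin n → ZMod p) → ℂ) :
    mass (derivDist f) (M.mulVecLin.graph : Set _) =
      ∑ z, ‖fourierCoeff (fun x => f x * ZMod.stdAddChar (-MvPolynomial.eval x q)) z‖ ^ 4 := by
  rw [mass_derivDist_graph]
  simp only [hM.derivWeight_eq]
  rw [sum_norm_sq_expect_mulDeriv, inv_mul_cancel_left₀ (card_pow_pos p n).ne']

end PolarGraph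

/-! ### Decoding quadratic Reed-Muller codes -/

section Correlation

variable {n : ℕ}

/-- The sign `(-1)ᵃ`. -/
def signChar (a : ZMod 2) : ℝ := if a = 0 then 1 else -1

lemma signChar_zero : signChar 0 = 1 :=
  if_pos rfl

lemma signChar_one : signChar 1 = -1 :=
  if_neg one_ne_zero

lemma zmod_two_eq_zero_or_one (a : ZMod 2) : a = 0 ∨ a = 1 := by
  revert a
  decide

lemma signChar_add_one (a : ZMod 2) : signChar (a + 1) = -signChar a := by
  rcases zmod_two_eq_zero_or_one a with rfl | rfl
  · rw [zero_add, signChar_zero, signChar_one]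
  · rw [CharTwo.add_self_eq_zero, signChar_zero, signChar_one, neg_neg]

lemma abs_signChar (a : ZMod 2) : |signChar a| = 1 := by
  unfold signChar
  split_ifs <;> simp

lemma signChar_add (a b : ZMod 2) :
    signChar (a + b) = 1 - 2 * (if a ≠ b then (1 : ℝ) else 0) := by
  have hab : a + b = 0 ↔ a = b := by rw [← CharTwo.sub_eq_add, sub_eq_zero]
  unfold signChar
  by_cases h : a = b
  · rw [if_pos (hab.2 h), if_neg (not_not.2 h)]
    norm_num
  · rw [if_neg (mt hab.1 h), if_pos h]
    norm_num

lemma stdAddChar_eq_signChar (a : ZMod 2) : (ZMod.stdAddChar a : ℂ) = signChar a := by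
  have stdAddChar_one : (ZMod.stdAddChar (1 : ZMod 2) : ℂ) = -1 := by
    have h := ZMod.stdAddChar_coe (N := 2) 1
    rw [show 2 * Real.pi * Complex.I * ((1 : ℤ) : ℂ) / ((2 : ℕ) : ℂ) = Real.pi * Complex.I by
      push_cast; ring, Complex.exp_pi_mul_I] at h
    exact_mod_cast h
  rcases zmod_two_eq_zero_or_one a with rfl | rfl
  · rw [AddChar.map_zero_eq_one, signChar_zero, Complex.ofReal_one]
  · rw [stdAddChar_one, signChar_one, Complex.ofReal_neg, Complex.ofReal_one]

/-- The correlation `𝔼ₓ (-1)^(f x + P x)` of a Boolean function with a polynomial. -/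
def corr (f : (Fin n → ZMod 2) → ZMod 2) (P : MvPolynomial (Fin n) (ZMod 2)) : ℝ :=
  ((2 : ℝ) ^ n)⁻¹ * ∑ x, signChar (f x + MvPolynomial.eval x P)

lemma relDist_eq (f : (Fin n → ZMod 2) → ZMod 2) (P : MvPolynomial (Fin n) (ZMod 2)) :
    relDist f (fun x => MvPolynomial.eval x P) = (1 - corr f P) / 2 := by
  rw [corr, relDist, hammingDist]
  simp only [signChar_add, Finset.sum_sub_distrib, ← Finset.mul_sum, Finset.sum_boole,
    Finset.sum_const, Finset.card_univ, Fintype.card_fun, ZMod.card, Fintype.card_fin,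
    nsmul_eq_mul, mul_one, Nat.cast_pow, Nat.cast_ofNat]
  field_simp
  ring

lemma exists_le_corr_of_distRM2_le {f : (Fin n → ZMod 2) → ZMod 2} {δ : ℝ} (h : distRM2 f ≤ δ) :
    ∃ q : MvPolynomial (Fin n) (ZMod 2), q.totalDegree ≤ 2 ∧ 1 - 2 * δ ≤ corr f q := by
  have hne : (relDist f '' RM2 n).Nonempty := ⟨_, 0, ⟨0, by simp, fun x => rfl⟩, rfl⟩
  obtain ⟨c, ⟨q, hq, hc⟩, hd⟩ := hne.csInf_mem ((Set.toFinite (RM2 n)).image _)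
  refine ⟨q, hq, ?_⟩
  have hδ : relDist f c ≤ δ := hd.le.trans h
  rw [funext hc, relDist_eq] at hδ
  linarith

lemma distRM2_nonneg (f : (Fin n → ZMod 2) → ZMod 2) : 0 ≤ distRM2 f :=
  Real.sInf_nonneg <| by
    rintro _ ⟨c, -, rfl⟩
    exact div_nonneg (Nat.cast_nonneg _) (by positivity)

/-- The polynomial `q(x) + ⟨x, t.1⟩ + t.2`. -/
def addAffine (q : MvPolynomial (Fin n) (ZMod 2)) (t : (Fin n → ZMod 2) × ZMod 2) :
    MvPolynomial (Fin n) (ZMod 2) :=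
  q + ((∑ i, MvPolynomial.C (t.1 i) * MvPolynomial.X i) + MvPolynomial.C t.2)

lemma eval_addAffine (q : MvPolynomial (Fin n) (ZMod 2)) (t : (Fin n → ZMod 2) × ZMod 2)
    (x : Fin n → ZMod 2) :
    MvPolynomial.eval x (addAffine q t) = MvPolynomial.eval x q + (x ⬝ᵥ t.1 + t.2) := by
  simp [addAffine, dotProduct, mul_comm]

lemma totalDegree_addAffine_le {q : MvPolynomial (Fin n) (ZMod 2)} (hq : q.totalDegree ≤ 2)
    (t : (Fin n → ZMod 2) × ZMod 2) : (addAffine q t).totalDegree ≤ 2 := by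
  refine (MvPolynomial.totalDegree_add _ _).trans (max_le hq ?_)
  refine (MvPolynomial.totalDegree_add _ _).trans (max_le ?_ (by simp))
  refine MvPolynomial.totalDegree_finsetSum_le fun i _ => ?_
  refine (MvPolynomial.totalDegree_mul _ _).trans ?_
  simp

lemma fourierCoeff_mul_stdAddChar_neg_eval (f : (Fin n → ZMod 2) → ZMod 2)
    (q : MvPolynomial (Fin n) (ZMod 2)) (z : Fin n → ZMod 2) :
    fourierCoeff (fun x => ZMod.stdAddChar (f x) * ZMod.stdAddChar (-MvPolynomial.eval x q)) z =
      corr f (addAffine q (z, 0)) := by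
  rw [fourierCoeff, expect_eq_inv_mul_sum, corr]
  push_cast
  congr 1
  refine Finset.sum_congr rfl fun x _ => ?_
  rw [← AddChar.map_add_eq_mul, ← AddChar.map_add_eq_mul, stdAddChar_eq_signChar, eval_addAffine,
    CharTwo.neg_eq, CharTwo.neg_eq, add_zero, add_assoc]

lemma corr_addAffine_one (f : (Fin n → ZMod 2) → ZMod 2) (q : MvPolynomial (Fin n) (ZMod 2))
    (z : Fin n → ZMod 2) : corr f (addAffine q (z, 1)) = -corr f (addAffine q (z, 0)) := by
  simp only [corr, eval_addAffine, add_zero, ← add_assoc, signChar_add_one,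
    Finset.sum_neg_distrib, mul_neg]

lemma sum_sq_corr_addAffine (f : (Fin n → ZMod 2) → ZMod 2)
    (q : MvPolynomial (Fin n) (ZMod 2)) : ∑ z, corr f (addAffine q (z, 0)) ^ 2 = 1 := by
  have h := sum_norm_sq_fourierCoeff (g := fun x =>
    ZMod.stdAddChar (f x) * ZMod.stdAddChar (-MvPolynomial.eval x q)) fun x => by
      rw [norm_mul, AddChar.norm_apply, AddChar.norm_apply, one_mul]
  simpa only [fourierCoeff_mul_stdAddChar_neg_eval, Complex.norm_real, Real.norm_eq_abs, sq_abs]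
    using h

lemma IsPolarMatrix.mass_graph_eq_sum_corr {q : MvPolynomial (Fin n) (ZMod 2)}
    {M : Matrix (Fin n) (Fin n) (ZMod 2)} (hM : IsPolarMatrix q M)
    (f : (Fin n → ZMod 2) → ZMod 2) :
    mass (derivDist fun x => (ZMod.stdAddChar (f x) : ℂ)) (M.mulVecLin.graph : Set _) =
      ∑ z, (corr f (addAffine q (z, 0)) ^ 2) ^ 2 := by
  rw [hM.mass_graph]
  refine Finset.sum_congr rfl fun z _ => ?_
  rw [fourierCoeff_mul_stdAddChar_neg_eval, Complex.norm_real, Real.norm_eq_abs, ← pow_mul,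
    Even.pow_abs (by decide)]

lemma IsPolarMatrix.corr_pow_four_le_mass {q : MvPolynomial (Fin n) (ZMod 2)}
    {M : Matrix (Fin n) (Fin n) (ZMod 2)} (hM : IsPolarMatrix q M)
    (f : (Fin n → ZMod 2) → ZMod 2) :
    corr f q ^ 4 ≤
      mass (derivDist fun x => (ZMod.stdAddChar (f x) : ℂ)) (M.mulVecLin.graph : Set _) := by
  have corr_zero : corr f (addAffine q (0, 0)) = corr f q := by
    simp only [corr, eval_addAffine, dotProduct_zero, add_zero]
  rw [hM.mass_graph_eq_sum_corr, ← corr_zero]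
  calc corr f (addAffine q (0, 0)) ^ 4 = (corr f (addAffine q (0, 0)) ^ 2) ^ 2 := by ring
    _ ≤ _ := Finset.single_le_sum (f := fun z => (corr f (addAffine q (z, 0)) ^ 2) ^ 2)
        (fun z _ => sq_nonneg _) (Finset.mem_univ 0)

lemma exists_le_of_le_sum_sq {ι : Type*} [Fintype ι] {a : ι → ℝ} (ha : a ∈ stdSimplex ℝ ι)
    {ρ : ℝ} (h : ρ ≤ ∑ i, a i ^ 2) : ∃ i, ρ ≤ a i := by
  by_contra! hlt
  obtain ⟨i₀, -, hi₀⟩ := Finset.exists_ne_zero_of_sum_ne_zero (ha.2 ▸ one_ne_zero)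
  refine (h.trans_lt ?_).false
  calc ∑ i, a i ^ 2 < ∑ i, ρ * a i :=
        Finset.sum_lt_sum (fun i _ => by rw [sq]; gcongr; exacts [ha.1 i, (hlt i).le])
          ⟨i₀, Finset.mem_univ _, by
            rw [sq]; exact mul_lt_mul_of_pos_right (hlt i₀) ((ha.1 i₀).lt_of_ne' hi₀)⟩
    _ = ρ := by rw [← Finset.mul_sum, ha.2, mul_one]

lemma IsPolarMatrix.exists_le_corr {q : MvPolynomial (Fin n) (ZMod 2)}
    {M : Matrix (Fin n) (Fin n) (ZMod 2)} (hM : IsPolarMatrix q M)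
    {f : (Fin n → ZMod 2) → ZMod 2} {ρ : ℝ} (hρ : ρ ^ 2 ≤
      mass (derivDist fun x => (ZMod.stdAddChar (f x) : ℂ)) (M.mulVecLin.graph : Set _)) :
    ∃ t, ρ ≤ corr f (addAffine q t) := by
  rw [hM.mass_graph_eq_sum_corr] at hρ
  obtain ⟨z, hz⟩ := exists_le_of_le_sum_sq
    ⟨fun _ => sq_nonneg _, sum_sq_corr_addAffine f q⟩ hρ
  rcases le_abs.1 ((le_abs_self ρ).trans (sq_le_sq.1 hz)) with h | h
  · exact ⟨(z, 0), h⟩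
  · exact ⟨(z, 1), by rwa [corr_addAffine_one]⟩

end Correlation

section QuadraticDecoder

variable {n m : ℕ} {θ ρ : ℝ}

/-- A quadratic polynomial, if there is one, such that the graph of its polar matrix contains
more than a fraction `θ / 2` of the samples `s`. -/
def heavyQuadratic (θ : ℝ) (s : Fin m → (Fin n → ZMod 2) × (Fin n → ZMod 2)) :
    MvPolynomial (Fin n) (ZMod 2) :=
  Classical.epsilon fun q => q.totalDegree ≤ 2 ∧
    θ * m / 2 < (Nat.card {i | s i ∈ (polarMatrix q).mulVecLin.graph} : ℝ)

/-- An affine part, if there is one, for which adding it to `q` gives an empirical correlation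
above `ρ / 2` on the samples `c` of the graph of a function. -/
def correlatedAffine (ρ : ℝ) (q : MvPolynomial (Fin n) (ZMod 2))
    (c : Fin m → (Fin n → ZMod 2) × ZMod 2) : (Fin n → ZMod 2) × ZMod 2 :=
  Classical.epsilon fun t =>
    m * (ρ / 2) < ∑ i, signChar ((c i).2 + MvPolynomial.eval (c i).1 (addAffine q t))

lemma le_mass_heavyQuadratic (hθ₀ : 0 < θ) (hm : 8 * ((n : ℝ) + 1) ≤ θ * m)
    {f : (Fin n → ZMod 2) → ZMod 2} {q : MvPolynomial (Fin n) (ZMod 2)} (hq : q.totalDegree ≤ 2)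
    (hcorr : θ ≤ corr f q ^ 4) :
    1 - 2 * Real.exp (-(m * θ ^ 2 / 64)) ≤
      mass (iid (derivDist fun x => (ZMod.stdAddChar (f x) : ℂ)))
        {s : Fin m → (Fin n → ZMod 2) × (Fin n → ZMod 2) |
          (heavyQuadratic θ s).totalDegree ≤ 2 ∧
            ∃ t, Real.exp (-(12 / θ)) ≤ corr f (addAffine (heavyQuadratic θ s) t)} := by
  have hn : (0 : ℝ) ≤ n := n.cast_nonneg
  have hD := derivDist_mem_stdSimplex (f := fun x => (ZMod.stdAddChar (f x) : ℂ))
    fun x => AddChar.norm_apply _ _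
  have hrank : 4 * (Module.finrank (ZMod 2) ((Fin n → ZMod 2) × (Fin n → ZMod 2)) : ℝ) ≤
      θ * Fintype.card (Fin m) := by
    rw [Module.finrank_prod, Module.finrank_fin_fun, Fintype.card_fin]
    push_cast
    linarith
  have hsub := le_mass_iid_subspace hD hθ₀ (by rw [Fintype.card_fin]; linarith) hrank
    (hcorr.trans ((isPolarMatrix_polarMatrix hq).corr_pow_four_le_mass f))
  rw [Fintype.card_fin] at hsub
  refine hsub.trans (mass_mono (fun s => (iid_mem_stdSimplex hD).1 s) ?_)
  rintro s ⟨hcard, hmass⟩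
  obtain ⟨hdeg, hheavy⟩ : (heavyQuadratic θ s).totalDegree ≤ 2 ∧ θ * m / 2 <
      (Nat.card {i | s i ∈ (polarMatrix (heavyQuadratic θ s)).mulVecLin.graph} : ℝ) :=
    Classical.epsilon_spec (p := fun q : MvPolynomial (Fin n) (ZMod 2) => q.totalDegree ≤ 2 ∧
      θ * m / 2 < (Nat.card {i | s i ∈ (polarMatrix q).mulVecLin.graph} : ℝ)) ⟨q, hq, hcard⟩
  refine ⟨hdeg, (isPolarMatrix_polarMatrix hdeg).exists_le_corr ((le_of_eq ?_).trans
    (hmass _ hheavy))⟩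
  rw [← Real.exp_nat_mul]
  congr 1
  push_cast
  ring

lemma le_mass_correlatedAffine (hm : 0 < m) (hρ₀ : 0 < ρ) (hρ₁ : ρ ≤ 1)
    {f : (Fin n → ZMod 2) → ZMod 2} {q : MvPolynomial (Fin n) (ZMod 2)}
    (hq : ∃ t, ρ ≤ corr f (addAffine q t)) :
    1 - 2 ^ (n + 2) * Real.exp (-(m * ρ ^ 2 / 256)) ≤
      mass (iid (graphDist f)) {c : Fin m → (Fin n → ZMod 2) × ZMod 2 |
        ρ / 4 ≤ corr f (addAffine q (correlatedAffine ρ q c))} := by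
  set Y : (Fin n → ZMod 2) × ZMod 2 → (Fin n → ZMod 2) × ZMod 2 → ℝ := fun t c =>
    signChar (c.2 + MvPolynomial.eval c.1 (addAffine q t)) with hY
  have mean_eq : ∀ t, ∑ c, graphDist f c * Y t c = corr f (addAffine q t) :=
    fun t => sum_graphDist_mul f (Y t)
  have hconc := le_mass_iid_forall_abs_sub_lt (ι := Fin m) (graphDist_mem_stdSimplex f)
    (Y := Y) (fun t c => (abs_signChar _).le) (by positivity : 0 ≤ ρ / 4) (by linarith)
  simp only [mean_eq, Fintype.card_fin, Fintype.card_prod, Fintype.card_fun, ZMod.card] at hconc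
  refine (le_of_eq ?_).trans (hconc.trans
    (mass_mono (fun s => (iid_mem_stdSimplex (graphDist_mem_stdSimplex f)).1 s) fun c hc => ?_))
  · push_cast
    ring_nf
  obtain ⟨t₀, ht₀⟩ := hq
  have hm₀ : (0 : ℝ) < m := by exact_mod_cast hm
  have hempirical : m * (ρ / 2) < ∑ i, Y (correlatedAffine ρ q c) (c i) := by
    refine Classical.epsilon_spec (p := fun t => m * (ρ / 2) < ∑ i, Y t (c i)) ⟨t₀, ?_⟩
    have := (abs_lt.1 (hc t₀)).1
    nlinarith
  have := (abs_lt.1 (hc (correlatedAffine ρ q c))).2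
  refine le_of_mul_le_mul_left (a := (m : ℝ)) ?_ hm₀
  linarith

theorem exists_quadraticDecoder (n m : ℕ) (θ : ℝ) :
    ∃ A : QueryAlgorithm ((Fin n → ZMod 2) × ZMod 2) (MvPolynomial (Fin n) (ZMod 2)),
      A.queries = m * 3 ∧ (0 < θ → 8 * ((n : ℝ) + 1) ≤ θ * m →
        2 ^ (n + 2) * Real.exp (-(m * Real.exp (-(12 / θ)) ^ 2 / 256)) ≤ 1 →
        ∀ f q, q.totalDegree ≤ 2 → θ ≤ corr f q ^ 4 →
        (1 - 2 * Real.exp (-(m * θ ^ 2 / 64))) *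
          (1 - 2 ^ (n + 2) * Real.exp (-(m * Real.exp (-(12 / θ)) ^ 2 / 256))) ≤
        A.prob (bitOracle f) {g | g.totalDegree ≤ 2 ∧ Real.exp (-(12 / θ)) / 4 ≤ corr f g}) := by
  obtain ⟨A, hA, hprob⟩ := exists_bitSampling (n := n) m fun s c =>
    addAffine (heavyQuadratic θ s) (correlatedAffine (Real.exp (-(12 / θ))) (heavyQuadratic θ s) c)
  refine ⟨A, hA, fun hθ₀ hm hsmall f q hq hcorr => ?_⟩
  rw [hprob]
  have hm₀ : 0 < m := by
    by_contra! h0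
    obtain rfl := Nat.le_zero.1 h0
    have : (0 : ℝ) ≤ n := n.cast_nonneg
    push_cast at hm
    linarith
  refine mul_le_mass_prodDist (iid_mem_stdSimplex (derivDist_mem_stdSimplex fun x =>
      AddChar.norm_apply _ _)).1 (iid_mem_stdSimplex (graphDist_mem_stdSimplex f)).1
    (by linarith) (le_mass_heavyQuadratic hθ₀ hm hq hcorr) fun s hs => ?_
  refine (le_mass_correlatedAffine hm₀ (Real.exp_pos _) (Real.exp_le_one_iff.2 ?_) hs.2).trans
    (mass_mono (iid_mem_stdSimplex (graphDist_mem_stdSimplex f)).1 fun c hc => ?_)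
  · rw [neg_nonpos]
    positivity
  · exact ⟨totalDegree_addAffine_le hs.1 _, hc⟩

end QuadraticDecoder

section DecodingParameters

lemma exp_neg_four_le : Real.exp (-4) ≤ 1 / 50 := by
  have hexp : Real.exp 4 = Real.exp 1 ^ 4 := by
    rw [← Real.exp_nat_mul]
    norm_num
  rw [Real.exp_neg, hexp, ← one_div]
  refine one_div_le_one_div_of_le (by norm_num) ?_
  calc (50 : ℝ) ≤ 2.7 ^ 4 := by norm_num
    _ ≤ Real.exp 1 ^ 4 := by gcongr; linarith [Real.exp_one_gt_d9]

lemma two_pow_mul_exp_le {n m : ℕ} {ρ : ℝ} (h : 1024 * ((n : ℝ) + 1) ≤ m * ρ ^ 2) :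
    2 ^ (n + 2) * Real.exp (-(m * ρ ^ 2 / 256)) ≤ 1 / 4 :=
  calc 2 ^ (n + 2) * Real.exp (-(m * ρ ^ 2 / 256))
      ≤ 2 ^ (n + 2) * Real.exp (-4) ^ (n + 1) := by
        rw [← Real.exp_nat_mul]
        gcongr
        push_cast
        linarith
    _ ≤ 2 ^ (n + 2) * (1 / 16) ^ (n + 1) := by
        gcongr
        linarith [exp_neg_four_le]
    _ = 1 / 4 * (1 / 8) ^ n := by
        rw [pow_add, pow_succ (1 / 16 : ℝ), show (1 / 16 : ℝ) = 1 / 2 * (1 / 8) by norm_num,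
          mul_pow, one_div_pow]
        field_simp
        norm_num
    _ ≤ 1 / 4 := mul_le_of_le_one_right (by norm_num) (pow_le_one₀ (by norm_num) (by norm_num))

lemma exp_neg_one_div_rpow_six_le {ε : ℝ} (hε₀ : 0 < ε) (hε : ε ≤ 1 / 2) :
    Real.exp (-(1 / ε ^ (6 : ℝ))) ≤ Real.exp (-(12 / (16 * ε ^ 4))) / 8 := by
  have exponent_le : 12 / (16 * ε ^ 4) + 8 ≤ 1 / ε ^ 6 := by
    have h₂ : ε ^ 2 ≤ (1 / 2) ^ 2 := by gcongr
    have h₆ : ε ^ 6 ≤ (1 / 2) ^ 6 := by gcongr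
    rw [div_add' _ _ _ (by positivity), div_le_div_iff₀ (by positivity) (by positivity)]
    have : 0 < ε ^ 4 := by positivity
    nlinarith
  calc Real.exp (-(1 / ε ^ (6 : ℝ))) = Real.exp (-(1 / ε ^ 6)) := by norm_cast
    _ ≤ Real.exp (-(12 / (16 * ε ^ 4)) + -8) := Real.exp_le_exp.2 (by linarith)
    _ = Real.exp (-(12 / (16 * ε ^ 4))) * Real.exp (-8) := Real.exp_add _ _
    _ ≤ Real.exp (-(12 / (16 * ε ^ 4))) * (1 / 8) := by
        gcongr
        rw [Real.exp_neg, ← one_div]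
        exact one_div_le_one_div_of_le (by norm_num) (by linarith [Real.add_one_le_exp (8 : ℝ)])
    _ = Real.exp (-(12 / (16 * ε ^ 4))) / 8 := by ring

theorem exists_quadraticDecoder_linear (n : ℕ) {θ : ℝ} (hθ₀ : 0 < θ) {N : ℕ}
    (hN : 1024 ≤ N * Real.exp (-(12 / θ)) ^ 2) (hNθ : 256 ≤ N * θ ^ 2) :
    ∃ A : QueryAlgorithm ((Fin n → ZMod 2) × ZMod 2) (MvPolynomial (Fin n) (ZMod 2)),
      A.queries = N * (n + 1) * 3 ∧ ∀ f q, q.totalDegree ≤ 2 → θ ≤ corr f q ^ 4 →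
        2 / 3 ≤ A.prob (bitOracle f)
          {g | g.totalDegree ≤ 2 ∧ Real.exp (-(12 / θ)) / 4 ≤ corr f g} := by
  obtain ⟨A, hA, hprob⟩ := exists_quadraticDecoder n (N * (n + 1)) θ
  refine ⟨A, hA, fun f q hq hcorr => ?_⟩
  have hn : (1 : ℝ) ≤ (n : ℝ) + 1 := by linarith [n.cast_nonneg (α := ℝ)]
  have hsub : Real.exp (-((N * (n + 1) : ℕ) * θ ^ 2 / 64)) ≤ 1 / 50 := by
    refine (Real.exp_le_exp.2 ?_).trans exp_neg_four_le
    push_cast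
    nlinarith
  have haff : 2 ^ (n + 2) * Real.exp (-((N * (n + 1) : ℕ) * Real.exp (-(12 / θ)) ^ 2 / 256)) ≤
      1 / 4 := two_pow_mul_exp_le (by push_cast; nlinarith)
  have hθ₁ : θ ≤ 1 := hcorr.trans (((isPolarMatrix_polarMatrix hq).corr_pow_four_le_mass f).trans
    (mass_le_one (derivDist_mem_stdSimplex fun x => AddChar.norm_apply _ _) _))
  have hm : 8 * ((n : ℝ) + 1) ≤ θ * (N * (n + 1) : ℕ) := by
    have : (N : ℝ) * θ ^ 2 ≤ N * θ := by gcongr; nlinarith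
    push_cast
    nlinarith
  refine le_trans ?_ (hprob hθ₀ hm (haff.trans (by norm_num)) f q hq hcorr)
  calc (2 / 3 : ℝ) ≤ (1 - 2 * (1 / 50)) * (1 - 1 / 4) := by norm_num
    _ ≤ _ := by
        gcongr
        linarith

theorem exists_quadraticDecoding {ε : ℝ} (hε : 0 < ε) :
    ∃ K : ℝ, 0 < K ∧ ∀ n : ℕ,
      ∃ A : QueryAlgorithm ((Fin n → ZMod 2) × ZMod 2) (MvPolynomial (Fin n) (ZMod 2)),
        (1 ≤ n → (A.queries : ℝ) ≤ K * n) ∧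
        ∀ f : (Fin n → ZMod 2) → ZMod 2, distRM2 f ≤ 1 / 2 - ε →
          2 / 3 ≤ A.prob (bitOracle f) {g | g.totalDegree ≤ 2 ∧
            relDist f (fun x => MvPolynomial.eval x g) ≤
              1 / 2 - Real.exp (-(1 / ε ^ (6 : ℝ)))} := by
  set ρ : ℝ := Real.exp (-(12 / (16 * ε ^ 4))) with hρ
  have hρ₀ : 0 < ρ := Real.exp_pos _
  obtain ⟨N, hN⟩ := exists_nat_ge (max (1024 / ρ ^ 2) (256 / (16 * ε ^ 4) ^ 2))
  obtain ⟨hN₁, hN₂⟩ := max_le_iff.1 hN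
  rw [div_le_iff₀ (by positivity)] at hN₁ hN₂
  refine ⟨6 * N + 1, by positivity, fun n => ?_⟩
  obtain ⟨A, hA, hprob⟩ := exists_quadraticDecoder_linear n (by positivity) hN₁ hN₂
  refine ⟨A, fun hn => ?_, fun f hf => ?_⟩
  · have hn₁ : (1 : ℝ) ≤ n := by exact_mod_cast hn
    rw [hA]
    push_cast
    nlinarith [N.cast_nonneg (α := ℝ)]
  · obtain ⟨q, hq, hcorr⟩ := exists_le_corr_of_distRM2_le hf
    have hε₂ : ε ≤ 1 / 2 := by linarith [distRM2_nonneg f]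
    have hcorr₄ : 16 * ε ^ 4 ≤ corr f q ^ 4 :=
      calc 16 * ε ^ 4 = (1 - 2 * (1 / 2 - ε)) ^ 4 := by ring
        _ ≤ corr f q ^ 4 := by gcongr; linarith
    refine (hprob f q hq hcorr₄).trans (A.prob_mono _ fun g hg => ⟨hg.1, ?_⟩)
    rw [relDist_eq]
    linarith [exp_neg_one_div_rpow_six_le hε hε₂, hg.2]

end DecodingParameters

/-! ### The Balog-Szemerédi-Gowers theorem -/

section BipartitePaths

open Finset

variable {α β : Type*}

lemma card_filter_card_lt_four_mul_le (N : Finset α) (bad : α → α → Prop) [DecidableRel bad]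
    (h : 8 * #{x ∈ N ×ˢ N | bad x.1 x.2} ≤ #N ^ 2) :
    2 * #{v ∈ N | #N < 4 * #{w ∈ N | bad v w}} ≤ #N := by
  rcases N.eq_empty_or_nonempty with rfl | hN
  · simp
  refine Nat.le_of_mul_le_mul_right ?_ hN.card_pos
  have hpairs : #{x ∈ N ×ˢ N | bad x.1 x.2} = ∑ v ∈ N, #{w ∈ N | bad v w} := by
    simp only [card_filter, sum_product]
  have hmarkov : #{v ∈ N | #N < 4 * #{w ∈ N | bad v w}} * #N ≤
      4 * #{x ∈ N ×ˢ N | bad x.1 x.2} := by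
    rw [hpairs, mul_sum, ← smul_eq_mul, ← sum_const]
    exact (sum_le_sum fun v hv => (mem_filter.1 hv).2.le).trans
      (sum_le_sum_of_subset (filter_subset _ _))
  linarith

/-- The number of common neighbours in `Z` of `v` and `w` in the bipartite graph of `r`. -/
def codegree (r : α → β → Prop) [DecidableRel r] (Z : Finset β) (v w : α) : ℕ :=
  #{z ∈ Z | r v z ∧ r w z}

variable (r : α → β → Prop) [DecidableRel r] (A : Finset α) (Z : Finset β)

lemma sum_card_codegree_lt_le {c : ℝ} (hc : 0 ≤ c) :
    ∑ z ∈ Z, (#{x ∈ bipartiteBelow r A z ×ˢ bipartiteBelow r A z |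
      (codegree r Z x.1 x.2 : ℝ) < c} : ℝ) ≤ c * (#A : ℝ) ^ 2 := by
  set low : Finset (α × α) := {x ∈ A ×ˢ A | (codegree r Z x.1 x.2 : ℝ) < c} with hlow
  have pairs_eq : ∀ z, {x ∈ bipartiteBelow r A z ×ˢ bipartiteBelow r A z |
      (codegree r Z x.1 x.2 : ℝ) < c} =
      bipartiteAbove (fun z (x : α × α) => r x.1 z ∧ r x.2 z) low z := fun z => by
    ext x
    simp only [bipartiteAbove, bipartiteBelow, hlow, mem_filter, mem_product]
    tauto
  have double_count : ∑ z ∈ Z, #{x ∈ bipartiteBelow r A z ×ˢ bipartiteBelow r A z |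
      (codegree r Z x.1 x.2 : ℝ) < c} = ∑ x ∈ low, codegree r Z x.1 x.2 := by
    simp only [pairs_eq]
    exact sum_card_bipartiteAbove_eq_sum_card_bipartiteBelow _
  calc _ = ∑ x ∈ low, (codegree r Z x.1 x.2 : ℝ) := by exact_mod_cast double_count
    _ ≤ #low • c := sum_le_card_nsmul _ _ _ fun x hx => (mem_filter.1 hx).2.le
    _ ≤ c * (#A : ℝ) ^ 2 := by
        rw [nsmul_eq_mul, mul_comm]
        gcongr
        exact_mod_cast (card_filter_le _ _).trans_eq (by rw [card_product, sq])

variable {r A Z} {δ : ℝ}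

lemma exists_bipartiteBelow_few_codegree_lt (hZ : Z.Nonempty) (hδ : 0 ≤ δ)
    (h : δ * (#A * #Z) ≤ ∑ z ∈ Z, (#(bipartiteBelow r A z) : ℝ)) :
    ∃ z ∈ Z, δ ^ 2 * (#A : ℝ) ^ 2 / 2 + 8 * #{x ∈ bipartiteBelow r A z ×ˢ bipartiteBelow r A z |
      (codegree r Z x.1 x.2 : ℝ) < δ ^ 2 / 16 * #Z} ≤ (#(bipartiteBelow r A z) : ℝ) ^ 2 := by
  have hZ₀ : (0 : ℝ) < #Z := by exact_mod_cast hZ.card_pos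
  have cauchy_schwarz : δ ^ 2 * (#A : ℝ) ^ 2 * #Z ≤
      ∑ z ∈ Z, (#(bipartiteBelow r A z) : ℝ) ^ 2 := by
    refine le_of_mul_le_mul_left ?_ hZ₀
    calc #Z * (δ ^ 2 * (#A : ℝ) ^ 2 * #Z) = (δ * (#A * #Z)) ^ 2 := by ring
      _ ≤ (∑ z ∈ Z, (#(bipartiteBelow r A z) : ℝ)) ^ 2 := by gcongr
      _ ≤ _ := sq_sum_le_card_mul_sum_sq
  refine exists_le_of_sum_le hZ ?_
  rw [sum_add_distrib, sum_const, nsmul_eq_mul, ← mul_sum]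
  linarith [sum_card_codegree_lt_le r A Z (by positivity : 0 ≤ δ ^ 2 / 16 * #Z)]

lemma exists_subset_many_codegree_ge (hA : A.Nonempty) (hZ : Z.Nonempty) (hδ : 0 < δ)
    (h : δ * (#A * #Z) ≤ ∑ z ∈ Z, (#(bipartiteBelow r A z) : ℝ)) :
    ∃ N ⊆ A, ∃ B ⊆ N, δ / 2 * #A ≤ #N ∧ #N ≤ 2 * #B ∧
      ∀ v ∈ B, 4 * #{w ∈ N | (codegree r Z v w : ℝ) < δ ^ 2 / 16 * #Z} ≤ #N := by
  obtain ⟨z, -, hz⟩ := exists_bipartiteBelow_few_codegree_lt hZ hδ.le h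
  set N := bipartiteBelow r A z
  have hA₀ : (0 : ℝ) < #A := by exact_mod_cast hA.card_pos
  have hfew := card_filter_card_lt_four_mul_le N
    (fun v w => (codegree r Z v w : ℝ) < δ ^ 2 / 16 * #Z) (by
      have : 0 ≤ δ ^ 2 * (#A : ℝ) ^ 2 / 2 := by positivity
      exact_mod_cast (by linarith : 8 * (#{x ∈ N ×ˢ N |
        (codegree r Z x.1 x.2 : ℝ) < δ ^ 2 / 16 * #Z} : ℝ) ≤ (#N : ℝ) ^ 2))
  refine ⟨N, filter_subset _ _, {v ∈ N | ¬ #N < 4 * #{w ∈ N |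
    (codegree r Z v w : ℝ) < δ ^ 2 / 16 * #Z}}, filter_subset _ _, ?_, ?_, fun v hv =>
      not_lt.1 (mem_filter.1 hv).2⟩
  · refine (abs_le_of_sq_le_sq' ?_ (Nat.cast_nonneg _)).2
    have : (0 : ℝ) ≤ #{x ∈ N ×ˢ N | (codegree r Z x.1 x.2 : ℝ) < δ ^ 2 / 16 * #Z} :=
      Nat.cast_nonneg _
    nlinarith [sq_nonneg (δ * #A)]
  · have := card_filter_add_card_filter_not (s := N)
      (fun v => #N < 4 * #{w ∈ N | (codegree r Z v w : ℝ) < δ ^ 2 / 16 * #Z})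
    omega

lemma exists_subset_many_paths (hA : A.Nonempty) (hZ : Z.Nonempty) (hδ : 0 < δ)
    (h : δ * (#A * #Z) ≤ ∑ z ∈ Z, (#(bipartiteBelow r A z) : ℝ)) :
    ∃ B ⊆ A, δ / 4 * #A ≤ #B ∧ ∀ v ∈ B, ∀ v' ∈ B, δ ^ 5 / 1024 * (#A * (#Z : ℝ) ^ 2) ≤
      ((∑ w ∈ A, codegree r Z v w * codegree r Z v' w : ℕ) : ℝ) := by
  classical
  obtain ⟨N, hNA, B, hBN, hN, hB, hfew⟩ := exists_subset_many_codegree_ge hA hZ hδ h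
  have hB' : (#N : ℝ) ≤ 2 * #B := by exact_mod_cast hB
  refine ⟨B, hBN.trans hNA, by linarith, fun v hv v' hv' => ?_⟩
  set bad : α → Finset α := fun v => {w ∈ N | (codegree r Z v w : ℝ) < δ ^ 2 / 16 * #Z} with hbad
  have hgood : δ / 4 * #A ≤ #(N \ (bad v ∪ bad v')) := by
    have hcard := le_card_sdiff (bad v ∪ bad v') N
    have hunion := card_union_le (bad v) (bad v')
    have h₁ : 4 * #(bad v) ≤ #N := hfew v hv
    have h₂ : 4 * #(bad v') ≤ #N := hfew v' hv'
    have : (#N : ℝ) ≤ 2 * #(N \ (bad v ∪ bad v')) := by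
      exact_mod_cast (by omega : #N ≤ 2 * #(N \ (bad v ∪ bad v')))
    linarith
  push_cast
  calc δ ^ 5 / 1024 * (#A * (#Z : ℝ) ^ 2)
      = δ / 4 * #A * ((δ ^ 2 / 16 * #Z) * (δ ^ 2 / 16 * #Z)) := by ring
    _ ≤ #(N \ (bad v ∪ bad v')) • ((δ ^ 2 / 16 * #Z) * (δ ^ 2 / 16 * #Z)) := by
        rw [nsmul_eq_mul]
        gcongr
    _ ≤ ∑ w ∈ N \ (bad v ∪ bad v'), (codegree r Z v w * codegree r Z v' w : ℝ) := by
        refine card_nsmul_le_sum _ _ _ fun w hw => ?_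
        simp only [hbad, mem_sdiff, mem_union, mem_filter, not_or, not_and, not_lt] at hw
        gcongr
        exacts [hw.2.1 hw.1, hw.2.2 hw.1]
    _ ≤ ∑ w ∈ A, (codegree r Z v w * codegree r Z v' w : ℝ) :=
        sum_le_sum_of_subset_of_nonneg (sdiff_subset.trans hNA) fun _ _ _ => by positivity

end BipartitePaths

section BalogSzemerediGowers

open Finset
open scoped Pointwise

variable {E : Type*} [AddCommGroup E] [DecidableEq E]

/- A path `v, z, w, z', v'` in the graph of `x - y ∈ D` writes `v - v'` as
`(v - z) - (w - z) - ((v' - z') - (w - z'))`. -/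
lemma sum_codegree_mul_le (A Z D : Finset E) (v v' : E) :
    ∑ w ∈ A, codegree (fun x y => x - y ∈ D) Z v w * codegree (fun x y => x - y ∈ D) Z v' w ≤
      #{x ∈ D ×ˢ D ×ˢ D ×ˢ D | x.1 - x.2.1 - (x.2.2.1 - x.2.2.2) = v - v'} := by
  simp only [codegree, ← card_product]
  rw [← card_sigma]
  refine card_le_card_of_injOn
    (fun x => (v - x.2.1, x.1 - x.2.1, v' - x.2.2, x.1 - x.2.2)) ?_ ?_
  · rintro ⟨w, z, z'⟩ hx
    simp only [coe_sigma, Set.mem_sigma_iff, mem_coe, mem_product, mem_filter] at hx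
    simp only [mem_coe, mem_filter, mem_product]
    exact ⟨⟨hx.2.1.2.1, hx.2.1.2.2, hx.2.2.2.1, hx.2.2.2.2⟩, by abel⟩
  · rintro ⟨w, z, z'⟩ _ ⟨w₁, z₁, z₁'⟩ _ hx
    simp only [Prod.mk.injEq, sub_right_inj] at hx
    obtain ⟨rfl, hw, rfl, -⟩ := hx
    rw [sub_left_inj] at hw
    rw [hw]

theorem balog_szemeredi_gowers {A Z D : Finset E} (hA : A.Nonempty) (hZ : Z.Nonempty) {δ : ℝ}
    (hδ : 0 < δ) (h : δ * (#A * #Z) ≤ #{x ∈ A ×ˢ Z | x.1 - x.2 ∈ D}) :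
    ∃ B ⊆ A, δ / 4 * #A ≤ #B ∧
      (#(B - B) : ℝ) * (δ ^ 5 / 1024 * (#A * (#Z : ℝ) ^ 2)) ≤ (#D : ℝ) ^ 4 := by
  have hdegrees : #{x ∈ A ×ˢ Z | x.1 - x.2 ∈ D} =
      ∑ z ∈ Z, #(bipartiteBelow (fun x y => x - y ∈ D) A z) := by
    simp only [bipartiteBelow, card_filter, sum_product_right]
  rw [hdegrees, Nat.cast_sum] at h
  obtain ⟨B, hBA, hB, hpaths⟩ := exists_subset_many_paths hA hZ hδ h
  refine ⟨B, hBA, hB, ?_⟩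
  set reps : E → Finset (E × E × E × E) := fun d =>
    {x ∈ D ×ˢ D ×ˢ D ×ˢ D | x.1 - x.2.1 - (x.2.2.1 - x.2.2.2) = d}
  have hreps : ∀ d ∈ B - B, δ ^ 5 / 1024 * (#A * (#Z : ℝ) ^ 2) ≤ #(reps d) := fun d hd => by
    obtain ⟨v, hv, v', hv', rfl⟩ := mem_sub.1 hd
    exact (hpaths v hv v' hv').trans (by exact_mod_cast sum_codegree_mul_le A Z D v v')
  have hdisjoint : ∑ d ∈ B - B, #(reps d) ≤ #D ^ 4 :=
    ((sum_card_fiberwise_eq_card_filter _ _ _).trans_le (card_filter_le _ _)).trans_eq (by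
      simp only [card_product]
      ring)
  calc _ = #(B - B) • (δ ^ 5 / 1024 * (#A * (#Z : ℝ) ^ 2)) := (nsmul_eq_mul _ _).symm
    _ ≤ ∑ d ∈ B - B, (#(reps d) : ℝ) := card_nsmul_le_sum _ _ _ hreps
    _ ≤ (#D : ℝ) ^ 4 := by exact_mod_cast hdisjoint

end BalogSzemerediGowers

section Freiman

open Finset
open scoped Pointwise

lemma span_subset_add_of_add_subset {p : ℕ} [NeZero p] {E : Type*} [AddCommGroup E]
    [Module (ZMod p) E] {H : Submodule (ZMod p) E} {S D : Set E} (h₀ : 0 ∈ D)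
    (h : S + D ⊆ (H : Set E) + D) :
    (Submodule.span (ZMod p) S : Set E) ⊆ (H : Set E) + D := by
  have hinvariant : ∀ x ∈ Submodule.span (ZMod p) S,
      ∀ y ∈ (H : Set E) + D, x + y ∈ (H : Set E) + D := by
    intro x hx
    induction hx using Submodule.span_induction with
    | mem s hs =>
      rintro _ ⟨a, ha, d, hd, rfl⟩
      obtain ⟨a', ha', d', hd', hsd⟩ := h (Set.add_mem_add hs hd)
      refine ⟨a + a', H.add_mem ha ha', d', hd', ?_⟩
      rw [add_left_comm, ← hsd, ← add_assoc]
    | zero => simp only [zero_add, imp_self, implies_true]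
    | add x x' _ _ hx hx' =>
      intro y hy
      rw [add_assoc]
      exact hx _ (hx' y hy)
    | smul c x _ hx =>
      rw [← ZMod.natCast_zmod_val c, Nat.cast_smul_eq_nsmul]
      induction c.val with
      | zero => simp only [zero_nsmul, zero_add, imp_self, implies_true]
      | succ k ih =>
        intro y hy
        rw [succ_nsmul, add_assoc]
        exact ih _ (hx y hy)
  intro x hx
  have := hinvariant x hx 0 ⟨0, H.zero_mem, 0, h₀, add_zero 0⟩
  rwa [add_zero] at this

variable {E : Type*} [AddCommGroup E] [DecidableEq E]

lemma card_sub_add_sub_add_le {B : Finset E} (hB : B.Nonempty) {K : ℝ}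
    (hK : (#(B - B) : ℝ) ≤ K * #B) : (#(B - B + (B - B) + B) : ℝ) ≤ K ^ 5 * #B := by
  have hsum : B - B + (B - B) + B = 3 • B - 2 • B := by
    rw [sub_add_sub_comm, sub_add_eq_add_sub, succ_nsmul, two_nsmul]
  have hpluennecke : (#(3 • B - 2 • B) : ℝ) ≤ (#(B - B) / #B : ℝ) ^ (3 + 2) * #B := by
    have := (NNRat.cast_le (K := ℝ)).2 (pluennecke_ruzsa_inequality_nsmul_sub_nsmul_sub hB B 3 2)
    push_cast at this
    exact this
  rw [hsum]
  refine hpluennecke.trans ?_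
  gcongr
  rwa [div_le_iff₀ (by exact_mod_cast hB.card_pos)]

theorem card_span_le_of_card_sub_le {p : ℕ} [Fact p.Prime] [Module (ZMod p) E] {B : Finset E}
    (hB : B.Nonempty) {K : ℝ} (hK : (#(B - B) : ℝ) ≤ K * #B) :
    (Nat.card (Submodule.span (ZMod p) (B : Set E)) : ℝ) ≤ (p : ℝ) ^ (K ^ 5 + 1) * #(B - B) := by
  obtain ⟨F, -, hFcard, hF⟩ := ruzsa_covering_add hB (card_sub_add_sub_add_le hB hK)
  obtain ⟨b₀, hb₀⟩ := hB
  set H := Submodule.span (ZMod p) ((insert b₀ F : Finset E) : Set E) with hH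
  have hspan : (Submodule.span (ZMod p) (B : Set E) : Set E) ⊆ (H : Set E) + ↑(B - B) := by
    refine span_subset_add_of_add_subset (mem_sub.2 ⟨b₀, hb₀, b₀, hb₀, sub_self _⟩) ?_
    rintro _ ⟨b, hb, d, hd, rfl⟩
    obtain ⟨e, he, d', hd', hed⟩ :=
      mem_add.1 (hF (add_mem_add (sub_mem_sub hb hb₀) hd))
    refine ⟨b₀ + e, H.add_mem (Submodule.subset_span (mem_insert_self _ _))
      (Submodule.subset_span (mem_insert_of_mem he)), d', hd', ?_⟩
    change b₀ + e + d' = b + d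
    rw [add_assoc, hed]
    abel
  have hHcard : Nat.card H ≤ p ^ (#F + 1) := by
    rw [Module.natCard_eq_pow_finrank (K := ZMod p), Nat.card_zmod]
    exact Nat.pow_le_pow_right (Fact.out : p.Prime).pos
      ((finrank_span_finset_le_card _).trans (card_insert_le _ _))
  have hHfinite : (H : Set E).Finite := (Module.finite_of_finite (ZMod p) : Finite H)
  have hcard : Nat.card (Submodule.span (ZMod p) (B : Set E)) ≤ p ^ (#F + 1) * #(B - B) := by
    refine (Nat.card_mono (hHfinite.add (finite_toSet _)) hspan).trans
      (Set.natCard_add_le.trans (Nat.mul_le_mul hHcard ?_))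
    rw [Nat.card_coe_set_eq, Set.ncard_coe_finset]
  calc (Nat.card (Submodule.span (ZMod p) (B : Set E)) : ℝ)
      ≤ (p : ℝ) ^ ((#F : ℝ) + 1) * #(B - B) := by exact_mod_cast hcard
    _ ≤ (p : ℝ) ^ (K ^ 5 + 1) * #(B - B) := by
        gcongr
        exact_mod_cast (Fact.out : p.Prime).one_le

end Freiman

section LargeDerivWeight

open Finset

variable {p n : ℕ} [Fact p.Prime] {f : (Fin n → ZMod p) → ℂ}

lemma sum_derivWeight_univ (hf : ∀ x, ‖f x‖ = 1) : ∑ v, derivWeight f v = (p : ℝ) ^ n := by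
  have h := (derivDist_mem_stdSimplex hf).2
  simp only [derivDist, ← mul_sum] at h
  rwa [inv_mul_eq_one₀ (card_pow_pos p n).ne', eq_comm] at h

lemma gowersAverage_three_re_le_one (hf : ∀ x, ‖f x‖ = 1) : (gowersAverage 3 f).re ≤ 1 := by
  have hD := derivDist_mem_stdSimplex hf
  rw [gowersAverage_three, Complex.ofReal_re, ← hD.2]
  exact sum_le_sum fun v _ => mul_le_of_le_one_right (hD.1 v) (derivWeight_le_one hf v)

lemma card_le_derivWeight_mul_le (hf : ∀ x, ‖f x‖ = 1) (β : ℝ) :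
    (#{v | β ≤ derivWeight f v} : ℝ) * β ≤ (p : ℝ) ^ n := by
  calc (#{v | β ≤ derivWeight f v} : ℝ) * β
      ≤ ∑ v with β ≤ derivWeight f v, derivWeight f v := by
        rw [← nsmul_eq_mul]
        exact card_nsmul_le_sum _ _ _ fun v hv => (mem_filter.1 hv).2
    _ ≤ ∑ v, derivWeight f v :=
        sum_le_sum_of_subset_of_nonneg (subset_univ _) fun v _ _ => derivWeight_nonneg f v
    _ = (p : ℝ) ^ n := sum_derivWeight_univ hf

lemma mul_le_card_le_derivWeight (hf : ∀ x, ‖f x‖ = 1) {α : ℝ} (hα : 0 ≤ α)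
    (h : 2 * α ≤ (gowersAverage 3 f).re) :
    α * (p : ℝ) ^ n ≤ #{v | α ≤ derivWeight f v} := by
  have hsq : 2 * α * (p : ℝ) ^ n ≤ ∑ v, derivWeight f v * derivWeight f v := by
    simp only [gowersAverage_three, Complex.ofReal_re, derivDist, mul_assoc, ← mul_sum] at h
    rwa [inv_mul_eq_div, le_div_iff₀ (card_pow_pos p n)] at h
  have hthreshold : ∀ v, derivWeight f v * derivWeight f v ≤
      (if α ≤ derivWeight f v then 1 else 0) + α * derivWeight f v := by
    intro v
    have h₀ := derivWeight_nonneg f v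
    split_ifs with hv
    · nlinarith [derivWeight_le_one hf v]
    · nlinarith
  have := hsq.trans (sum_le_sum fun v _ => hthreshold v)
  rw [sum_add_distrib, ← mul_sum, sum_derivWeight_univ hf, sum_boole] at this
  linarith

lemma mul_sq_card_le_card_sub (hf : ∀ x, ‖f x‖ = 1) {α : ℝ} (hα : 0 ≤ α)
    {A : Finset ((Fin n → ZMod p) × (Fin n → ZMod p))} (hA : ∀ v ∈ A, α ≤ derivWeight f v) :
    α ^ 2 / 2 * (#A : ℝ) ^ 2 ≤ #{x ∈ A ×ˢ A | α ^ 2 / 2 ≤ derivWeight f (x.1 - x.2)} := by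
  have hlower : (α * #A) ^ 2 ≤ ∑ v ∈ A, ∑ v' ∈ A, derivWeight f (v - v') := by
    refine le_trans ?_ (sq_sum_derivWeight_le hf A)
    gcongr
    rw [mul_comm, ← nsmul_eq_mul]
    exact card_nsmul_le_sum _ _ _ hA
  have hthreshold : ∀ v, derivWeight f v ≤
      (if α ^ 2 / 2 ≤ derivWeight f v then 1 else 0) + α ^ 2 / 2 := by
    intro v
    split_ifs with hv
    · linarith [derivWeight_le_one hf v, sq_nonneg α]
    · linarith
  have hcount : (#{x ∈ A ×ˢ A | α ^ 2 / 2 ≤ derivWeight f (x.1 - x.2)} : ℝ) =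
      ∑ v ∈ A, ∑ v' ∈ A, if α ^ 2 / 2 ≤ derivWeight f (v - v') then (1 : ℝ) else 0 := by
    rw [card_filter, sum_product]
    push_cast
    rfl
  have := hlower.trans (sum_le_sum fun v _ => sum_le_sum fun v' _ => hthreshold (v - v'))
  simp only [sum_add_distrib, sum_const, nsmul_eq_mul] at this
  rw [hcount]
  linarith

open scoped Pointwise in
lemma exists_finset_card_sub_le (hf : ∀ x, ‖f x‖ = 1) {α : ℝ} (hα : 0 < α)
    (h : 2 * α ≤ (gowersAverage 3 f).re) :
    ∃ B : Finset ((Fin n → ZMod p) × (Fin n → ZMod p)), (∀ v ∈ B, α ≤ derivWeight f v) ∧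
      α ^ 3 / 8 * (p : ℝ) ^ n ≤ #B ∧ (#(B - B) : ℝ) ≤ 2 ^ 22 / α ^ 24 * #B := by
  set δ : ℝ := α ^ 2 / 2 with hδ
  have hδ₀ : 0 < δ := by positivity
  set A : Finset ((Fin n → ZMod p) × (Fin n → ZMod p)) := {v | α ≤ derivWeight f v} with hA
  set D : Finset ((Fin n → ZMod p) × (Fin n → ZMod p)) := {v | δ ≤ derivWeight f v} with hD
  have hAcard : α * (p : ℝ) ^ n ≤ #A := mul_le_card_le_derivWeight hf hα.le h
  have hA₀ : (0 : ℝ) < #A := (mul_pos hα (card_pow_pos p n)).trans_le hAcard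
  have hAne : A.Nonempty := card_pos.1 (by exact_mod_cast hA₀)
  have hpairs : δ * (#A * #A) ≤ #{x ∈ A ×ˢ A | x.1 - x.2 ∈ D} := by
    simpa only [hD, mem_filter_univ, ← sq] using
      mul_sq_card_le_card_sub hf hα.le fun v hv => (mem_filter.1 hv).2
  obtain ⟨B, hBA, hB, hBB⟩ := balog_szemeredi_gowers hAne hAne hδ₀ hpairs
  refine ⟨B, fun v hv => (mem_filter.1 (hBA hv)).2, ?_, ?_⟩
  · calc α ^ 3 / 8 * (p : ℝ) ^ n = δ / 4 * (α * (p : ℝ) ^ n) := by ring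
      _ ≤ δ / 4 * #A := by gcongr
      _ ≤ #B := hB
  have hDcard : (#D : ℝ) * (δ * α) ≤ #A := by
    nlinarith [card_le_derivWeight_mul_le hf δ]
  have hdiff : (#(B - B) : ℝ) * (δ ^ 9 * α ^ 4) ≤ 1024 * #A := by
    refine le_of_mul_le_mul_right ?_ (pow_pos hA₀ 3)
    calc (#(B - B) : ℝ) * (δ ^ 9 * α ^ 4) * (#A : ℝ) ^ 3
        = 1024 * (#(B - B) * (δ ^ 5 / 1024 * (#A * (#A : ℝ) ^ 2))) * (δ * α) ^ 4 := by ring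
      _ ≤ 1024 * (#D : ℝ) ^ 4 * (δ * α) ^ 4 := by gcongr
      _ = 1024 * (#D * (δ * α)) ^ 4 := by ring
      _ ≤ 1024 * (#A : ℝ) ^ 4 := by gcongr
      _ = 1024 * #A * (#A : ℝ) ^ 3 := by ring
  rw [div_mul_eq_mul_div, le_div_iff₀ (by positivity)]
  calc (#(B - B) : ℝ) * α ^ 24
      = #(B - B) * (δ ^ 9 * α ^ 4) * (δ * 2 ^ 10) := by rw [hδ]; ring
    _ ≤ 1024 * #A * (δ * 2 ^ 10) := by gcongr
    _ = 2 ^ 22 * (δ / 4 * #A) := by ring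
    _ ≤ 2 ^ 22 * #B := by gcongr

lemma rpow_mul_div_le_exp {q K a : ℝ} (hq : 1 ≤ q) (hK : 1 ≤ K) (ha : 0 < a) (haK : a⁻¹ ≤ K) :
    q ^ (K ^ 5 + 1) * (K / a) ≤ Real.exp (4 * q * K ^ 5) := by
  have hpow : q ^ (K ^ 5 + 1) ≤ Real.exp (q * (K ^ 5 + 1)) := by
    rw [Real.exp_mul]
    gcongr
    linarith [Real.add_one_le_exp q]
  have hquotient : K / a ≤ Real.exp (2 * K) := by
    have hexp : K ≤ Real.exp K := by linarith [Real.add_one_le_exp K]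
    rw [two_mul, Real.exp_add, div_eq_mul_inv]
    gcongr
    exact haK.trans hexp
  have hKpow : K ≤ K ^ 5 := le_self_pow₀ hK (by norm_num)
  calc q ^ (K ^ 5 + 1) * (K / a) ≤ Real.exp (q * (K ^ 5 + 1)) * Real.exp (2 * K) := by gcongr
    _ = Real.exp (q * (K ^ 5 + 1) + 2 * K) := (Real.exp_add _ _).symm
    _ ≤ Real.exp (4 * q * K ^ 5) := by
        gcongr
        nlinarith

open scoped Pointwise in
theorem exists_subspace_le_mass_derivDist (hf : ∀ x, ‖f x‖ = 1) {α : ℝ} (hα : 0 < α)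
    (h : 2 * α ≤ (gowersAverage 3 f).re) :
    ∃ H : Submodule (ZMod p) ((Fin n → ZMod p) × (Fin n → ZMod p)),
      α ^ 4 / 8 ≤ mass (derivDist f) (H : Set _) ∧
      (Nat.card H : ℝ) ≤ Real.exp (4 * p * (2 ^ 22 / α ^ 24) ^ 5) * (p : ℝ) ^ n := by
  have hp : (1 : ℝ) ≤ p := by exact_mod_cast (Fact.out : p.Prime).one_le
  have hα₁ : α ≤ 1 := by linarith [gowersAverage_three_re_le_one hf]
  obtain ⟨B, hweight, hB, hBB⟩ := exists_finset_card_sub_le hf hα h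
  have hαK : α⁻¹ ≤ 2 ^ 22 / α ^ 24 := by
    rw [inv_eq_one_div]
    exact div_le_div₀ (by norm_num) (by norm_num) (by positivity)
      (pow_le_of_le_one hα.le hα₁ (by norm_num))
  generalize (2 : ℝ) ^ 22 / α ^ 24 = K at hBB hαK ⊢
  have hB₀ : (0 : ℝ) < #B := lt_of_lt_of_le (by have := card_pow_pos p n; positivity) hB
  set H := Submodule.span (ZMod p) (B : Set ((Fin n → ZMod p) × (Fin n → ZMod p)))
  have hcard : (Nat.card H : ℝ) ≤ (p : ℝ) ^ (K ^ 5 + 1) * #(B - B) :=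
    card_span_le_of_card_sub_le (card_pos.1 (by exact_mod_cast hB₀)) hBB
  refine ⟨H, ?_, hcard.trans ?_⟩
  · refine le_trans ?_ (mass_mono (derivDist_mem_stdSimplex hf).1 Submodule.subset_span)
    have hsum : #B * α ≤ ∑ v ∈ B, derivWeight f v := by
      rw [← nsmul_eq_mul]
      exact card_nsmul_le_sum _ _ _ hweight
    rw [mass_derivDist, sum_indicator_subset _ (subset_univ B), le_inv_mul_iff₀' (card_pow_pos p n)]
    nlinarith
  · have hK : 1 ≤ K := ((one_le_inv₀ hα).2 hα₁).trans hαK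
    have hBcard : (#B : ℝ) ≤ (p : ℝ) ^ n / α := by
      rw [le_div_iff₀ hα]
      refine le_trans ?_ (card_le_derivWeight_mul_le hf α)
      gcongr
      exact fun v hv => mem_filter.2 ⟨mem_univ v, hweight v hv⟩
    calc (p : ℝ) ^ (K ^ 5 + 1) * (#(B - B) : ℝ)
        ≤ (p : ℝ) ^ (K ^ 5 + 1) * (K * ((p : ℝ) ^ n / α)) := by
          gcongr
          exact hBB.trans (by gcongr)
      _ = (p : ℝ) ^ (K ^ 5 + 1) * (K / α) * (p : ℝ) ^ n := by ring
      _ ≤ Real.exp (4 * p * K ^ 5) * (p : ℝ) ^ n := by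
          gcongr
          exact rpow_mul_div_le_exp hp hK hα hαK

end LargeDerivWeight

section RandomMatrix

lemma exists_dotProduct_eq_one_eq_zero {K ι : Type*} [Field K] [Fintype ι] {h h' : ι → K}
    (hh : h ∉ Submodule.span K {h'}) :
    ∃ b : ι → K, b ⬝ᵥ h = 1 ∧ b ⬝ᵥ h' = 0 := by
  classical
  obtain ⟨l, hl, hl'⟩ := Submodule.exists_le_ker_of_notMem hh
  have hdot : ∀ x, (dotProductEquiv K ι).symm l ⬝ᵥ x = l x := fun x =>
    LinearMap.congr_fun ((dotProductEquiv K ι).apply_symm_apply l) x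
  refine ⟨(l h)⁻¹ • (dotProductEquiv K ι).symm l, ?_, ?_⟩
  · rw [smul_dotProduct, hdot, smul_eq_mul, inv_mul_cancel₀ hl]
  · rw [smul_dotProduct, hdot, hl' (Submodule.mem_span_singleton_self h'), smul_zero]

variable {K ι κ : Type*} [Field K] [Fintype K] [Fintype ι] [Fintype κ] [DecidableEq ι]
  [DecidableEq κ]

lemma expect_mulVec_mul_mulVec_eq_zero {h h' : ι → K} (hh : h ∉ Submodule.span K {h'})
    {φ : (κ → K) → ℝ} (hφ : 𝔼 y, φ y = 0) (ψ : (κ → K) → ℝ) :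
    𝔼 N : Matrix κ ι K, φ (N *ᵥ h) * ψ (N *ᵥ h') = 0 := by
  obtain ⟨b, hb, hb'⟩ := exists_dotProduct_eq_one_eq_zero hh
  have hshift : ∀ y : κ → K, 𝔼 N : Matrix κ ι K, φ (N *ᵥ h) * ψ (N *ᵥ h') =
      𝔼 N : Matrix κ ι K, φ (N *ᵥ h + y) * ψ (N *ᵥ h') := by
    intro y
    refine (Fintype.expect_equiv (Equiv.addRight (Matrix.vecMulVec y b)) _ _ fun N => ?_).symm
    simp only [Equiv.coe_addRight, Matrix.add_mulVec, Matrix.vecMulVec_mulVec, hb, hb',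
      MulOpposite.op_one, MulOpposite.op_zero, one_smul, zero_smul, add_zero]
  calc 𝔼 N : Matrix κ ι K, φ (N *ᵥ h) * ψ (N *ᵥ h')
      = 𝔼 y : κ → K, 𝔼 N : Matrix κ ι K, φ (N *ᵥ h + y) * ψ (N *ᵥ h') := by
        simp only [← hshift, Fintype.expect_const]
    _ = 𝔼 N : Matrix κ ι K, (𝔼 y, φ (N *ᵥ h + y)) * ψ (N *ᵥ h') := by
        rw [Finset.expect_comm]
        simp only [Finset.expect_mul]
    _ = 𝔼 _N : Matrix κ ι K, 0 := Finset.expect_congr rfl fun N _ => by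
        rw [Fintype.expect_equiv (Equiv.addLeft (N *ᵥ h)) (fun y => φ (N *ᵥ h + y)) φ
          fun _ => rfl, hφ, zero_mul]
    _ = 0 := Finset.expect_const_zero _

open scoped Classical in
lemma card_filter_mem_span_singleton_le (x : ι → K) :
    (Finset.univ.filter fun h => h ∈ Submodule.span K {x}).card ≤ Fintype.card K := by
  have hsubset : (Finset.univ.filter fun h => h ∈ Submodule.span K {x}) ⊆
      Finset.univ.image fun c : K => c • x := by
    intro h hh
    obtain ⟨c, rfl⟩ := Submodule.mem_span_singleton.1 (Finset.mem_filter.1 hh).2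
    exact Finset.mem_image_of_mem _ (Finset.mem_univ c)
  exact (Finset.card_le_card hsubset).trans Finset.card_image_le

lemma expect_sq_sum_mulVec_le {d : (ι → K) → (κ → K) → ℝ} (hd : ∀ h y, |d h y| ≤ 1)
    (hmean : ∀ h, 𝔼 y, d h y = 0) :
    𝔼 N : Matrix κ ι K, (∑ h, d h (N *ᵥ h)) ^ 2 ≤ Fintype.card (ι → K) * Fintype.card K := by
  classical
  have hpair : ∀ h h', 𝔼 N : Matrix κ ι K, d h (N *ᵥ h) * d h' (N *ᵥ h') ≤
      if h ∈ Submodule.span K {h'} then 1 else 0 := by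
    intro h h'
    split_ifs with hh
    · refine Finset.expect_le Finset.univ_nonempty fun N _ => (le_abs_self _).trans ?_
      rw [abs_mul]
      exact mul_le_one₀ (hd _ _) (abs_nonneg _) (hd _ _)
    · exact (expect_mulVec_mul_mulVec_eq_zero hh (hmean h) _).le
  calc 𝔼 N : Matrix κ ι K, (∑ h, d h (N *ᵥ h)) ^ 2
      = ∑ h, ∑ h', 𝔼 N : Matrix κ ι K, d h' (N *ᵥ h') * d h (N *ᵥ h) := by
        simp only [sq, Finset.sum_mul_sum, ← Finset.expect_sum_comm, mul_comm]
    _ ≤ ∑ h, ∑ h', if h' ∈ Submodule.span K {h} then 1 else 0 :=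
        Finset.sum_le_sum fun h _ => Finset.sum_le_sum fun h' _ => hpair h' h
    _ ≤ ∑ _h : ι → K, (Fintype.card K : ℝ) := Finset.sum_le_sum fun h _ => by
        rw [Finset.sum_boole]
        exact_mod_cast card_filter_mem_span_singleton_le h
    _ = Fintype.card (ι → K) * Fintype.card K := by
        rw [Finset.sum_const, Finset.card_univ, nsmul_eq_mul]

variable {g : (ι → K) → (κ → K) → ℝ}

lemma mass_uniformDist_sum_mulVec_lt_le (hg : ∀ h y, g h y ∈ Set.Icc 0 1) {t : ℝ} (ht : 0 < t) :
    mass (uniformDist (Matrix κ ι K)) {N | ∑ h, g h (N *ᵥ h) < ∑ h, 𝔼 y, g h y - t} ≤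
      Fintype.card (ι → K) * Fintype.card K / t ^ 2 := by
  have hmean : ∀ h, 𝔼 y, g h y ∈ Set.Icc (0 : ℝ) 1 := fun h =>
    ⟨Finset.expect_nonneg fun y _ => (hg h y).1,
      Finset.expect_le Finset.univ_nonempty fun y _ => (hg h y).2⟩
  set d : (ι → K) → (κ → K) → ℝ := fun h y => g h y - 𝔼 y, g h y with hd
  have hvariance := expect_sq_sum_mulVec_le (d := d)
    (fun h y => abs_le.2 ⟨by linarith [(hg h y).1, (hmean h).2], by
      linarith [(hg h y).2, (hmean h).1]⟩)
    (fun h => by rw [Finset.expect_sub_distrib, Fintype.expect_const, sub_self])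
  calc _ ≤ ∑ N, uniformDist (Matrix κ ι K) N * ((∑ h, d h (N *ᵥ h)) ^ 2 / t ^ 2) := by
        refine mass_le_sum_mul (uniformDist_mem_stdSimplex _).1 (fun N => by positivity)
          fun N hN => ?_
        simp only [Set.mem_ofPred_eq, hd, Finset.sum_sub_distrib] at hN ⊢
        rw [one_le_div (by positivity), sq_le_sq, abs_of_pos ht]
        exact (by linarith : t ≤ _).trans (neg_le_abs _)
    _ = (𝔼 N : Matrix κ ι K, (∑ h, d h (N *ᵥ h)) ^ 2) / t ^ 2 := by
        rw [Fintype.expect_eq_sum_div_card, div_div, mul_comm, ← div_div, Finset.sum_div,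
          Finset.sum_div]
        exact Finset.sum_congr rfl fun N _ => inv_mul_eq_div _ _
    _ ≤ _ := by gcongr

lemma mass_uniformDist_sum_mulVec_lt_le_half (hg : ∀ h y, g h y ∈ Set.Icc 0 1) {ν : ℝ}
    (hν : 0 < ν) (hmean : ν * Fintype.card (ι → K) ≤ ∑ h, 𝔼 y, g h y)
    (hlarge : 8 * Fintype.card K < ν ^ 2 * Fintype.card (ι → K)) :
    mass (uniformDist (Matrix κ ι K)) {N | ∑ h, g h (N *ᵥ h) <
      ν / 2 * Fintype.card (ι → K)} ≤ 1 / 2 := by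
  have hq : (0 : ℝ) < Fintype.card (ι → K) := by exact_mod_cast Fintype.card_pos
  calc _ ≤ mass (uniformDist (Matrix κ ι K)) {N | ∑ h, g h (N *ᵥ h) <
          ∑ h, 𝔼 y, g h y - ν / 2 * Fintype.card (ι → K)} := by
        refine mass_mono (uniformDist_mem_stdSimplex _).1 fun N hN => ?_
        rw [Set.mem_ofPred_eq] at hN ⊢
        linarith
    _ ≤ Fintype.card (ι → K) * Fintype.card K / (ν / 2 * Fintype.card (ι → K)) ^ 2 :=
        mass_uniformDist_sum_mulVec_lt_le hg (by positivity)
    _ ≤ 1 / 2 := by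
        rw [div_le_div_iff₀ (by positivity) (by norm_num)]
        nlinarith

lemma half_le_mass_uniformDist_le_sum_mulVec (hg : ∀ h y, g h y ∈ Set.Icc 0 1) (hg₀ : g 0 0 = 1)
    {ν : ℝ} (hν : 0 < ν) (hmean : ν * Fintype.card (ι → K) ≤ ∑ h, 𝔼 y, g h y) :
    1 / 2 ≤ mass (uniformDist (Matrix κ ι K))
      {N | ν ^ 2 / (8 * Fintype.card K) * Fintype.card (ι → K) ≤ ∑ h, g h (N *ᵥ h)} := by
  have huniform := uniformDist_mem_stdSimplex (Matrix κ ι K)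
  have hk : (1 : ℝ) ≤ Fintype.card K := by exact_mod_cast Fintype.card_pos
  have hν₁ : ν ≤ 1 := by
    have : ∑ h, 𝔼 y, g h y ≤ ∑ _h : ι → K, (1 : ℝ) := Finset.sum_le_sum fun h _ =>
      Finset.expect_le Finset.univ_nonempty fun y _ => (hg h y).2
    rw [Finset.sum_const, Finset.card_univ, nsmul_one] at this
    have hq : (0 : ℝ) < Fintype.card (ι → K) := by exact_mod_cast Fintype.card_pos
    exact le_of_mul_le_mul_right (by linarith) hq
  by_cases hlarge : 8 * Fintype.card K < ν ^ 2 * Fintype.card (ι → K)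
  · have hbad := mass_uniformDist_sum_mulVec_lt_le_half hg hν hmean hlarge
    calc (1 / 2 : ℝ) ≤ 1 - mass (uniformDist (Matrix κ ι K)) {N | ∑ h, g h (N *ᵥ h) <
            ν / 2 * Fintype.card (ι → K)} := by linarith
      _ = mass (uniformDist (Matrix κ ι K)) _ := (mass_compl huniform _).symm
      _ ≤ _ := by
        refine mass_mono huniform.1 fun N hN => ?_
        rw [Set.mem_compl_iff, Set.mem_ofPred_eq, not_lt] at hN
        refine le_trans ?_ hN
        gcongr ?_ * _
        rw [div_le_div_iff₀ (by positivity) (by norm_num)]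
        nlinarith
  · have hzero : ∀ N : Matrix κ ι K, 1 ≤ ∑ h, g h (N *ᵥ h) := fun N => by
      rw [← hg₀, ← Matrix.mulVec_zero N]
      exact Finset.single_le_sum (f := fun h => g h (N *ᵥ h)) (fun h _ => (hg h _).1)
        (Finset.mem_univ 0)
    have hsmall : ν ^ 2 / (8 * Fintype.card K) * Fintype.card (ι → K) ≤ 1 := by
      rw [div_mul_eq_mul_div]
      exact div_le_one_of_le₀ (not_lt.1 hlarge) (by positivity)
    have huniv : {N : Matrix κ ι K | ν ^ 2 / (8 * Fintype.card K) * Fintype.card (ι → K) ≤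
        ∑ h, g h (N *ᵥ h)} = Set.univ :=
      Set.eq_univ_of_forall fun N => hsmall.trans (hzero N)
    rw [huniv, mass_univ, huniform.2]
    norm_num

end RandomMatrix

section RandomGraph

section Fibres

variable {K V W : Type*} [Field K] [AddCommGroup V] [Module K V] [AddCommGroup W] [Module K W]

lemma exists_linearMap_mk_mem (H : Submodule K (V × W)) :
    ∃ L : V →ₗ[K] W, ∀ v ∈ H, (v.1, L v.1) ∈ H := by
  let π : H →ₗ[K] V := (LinearMap.fst K V W).comp H.subtype
  obtain ⟨σ, hσ⟩ := π.rangeRestrict.exists_rightInverse_of_surjective π.range_rangeRestrict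
  obtain ⟨L, hL⟩ := LinearMap.exists_extend (((LinearMap.snd K V W).comp H.subtype).comp σ)
  refine ⟨L, fun v hv => ?_⟩
  let t : LinearMap.range π := ⟨v.1, ⟨⟨v, hv⟩, rfl⟩⟩
  have hfst : ((σ t : H) : V × W).1 = v.1 := congrArg Subtype.val (LinearMap.congr_fun hσ t)
  have hsnd : L v.1 = ((σ t : H) : V × W).2 := LinearMap.congr_fun hL t
  rw [hsnd, ← hfst]
  exact (σ t).2

variable {H : Submodule K (V × W)} {L : V →ₗ[K] W}

lemma mk_add_mem_iff (hL : ∀ v ∈ H, (v.1, L v.1) ∈ H) (h : V) (u : W) :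
    (h, L h + u) ∈ H ↔ (h, L h) ∈ H ∧ u ∈ H.comap (LinearMap.inr K V W) := by
  have hsum : (h, L h + u) = (h, L h) + LinearMap.inr K V W u := by
    simp only [LinearMap.inr_apply, Prod.mk_add_mk, add_zero]
  refine ⟨fun hu => ?_, fun ⟨hh, hu⟩ => hsum ▸ H.add_mem hh hu⟩
  have hh : (h, L h) ∈ H := hL _ hu
  exact ⟨hh, (H.add_mem_iff_right hh).1 (hsum ▸ hu)⟩

variable [Fintype V] [Fintype W]

open scoped Classical in
lemma sum_indicator_submodule (hL : ∀ v ∈ H, (v.1, L v.1) ∈ H) (F : V × W → ℝ) :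
    ∑ v, (H : Set (V × W)).indicator F v =
      ∑ h with (h, L h) ∈ H, ∑ u : H.comap (LinearMap.inr K V W), F (h, L h + u) := by
  rw [Fintype.sum_prod_type, Finset.sum_filter]
  refine Finset.sum_congr rfl fun h _ => ?_
  rw [← Equiv.sum_comp (Equiv.addLeft (L h))]
  simp only [Equiv.coe_addLeft, Set.indicator_apply, SetLike.mem_coe, mk_add_mem_iff hL]
  split_ifs with hh
  · simp only [hh, true_and]
    rw [← Finset.sum_filter]
    exact Finset.sum_subtype _ (fun u => by simp) fun u => F (h, L h + u)
  · simp only [hh, false_and, if_false, Finset.sum_const_zero]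

open scoped Classical in
lemma sq_sum_indicator_submodule_le (hL : ∀ v ∈ H, (v.1, L v.1) ∈ H) {w : V × W → ℝ}
    (hw : ∀ v, 0 ≤ w v) (hw₁ : ∀ h, ∑ y, w (h, y) ≤ 1) :
    (∑ v, (H : Set (V × W)).indicator w v) ^ 2 ≤
      Nat.card H * ∑ h, 𝔼 u : H.comap (LinearMap.inr K V W), w (h, L h + u) := by
  set H₀ := H.comap (LinearMap.inr K V W)
  set base : Finset V := Finset.univ.filter fun h => (h, L h) ∈ H
  have hcard : (Nat.card H : ℝ) = base.card * Fintype.card H₀ := by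
    have := sum_indicator_submodule hL fun _ => 1
    simp only [Set.indicator_apply, SetLike.mem_coe, Finset.sum_boole, Finset.sum_const,
      nsmul_eq_mul, mul_one, Finset.card_univ] at this
    rw [← this, Nat.card_eq_fintype_card, Fintype.card_subtype]
  have hsum := sum_indicator_submodule hL w
  have hle_base : ∑ v, (H : Set (V × W)).indicator w v ≤ base.card := by
    rw [hsum, ← nsmul_one]
    refine Finset.sum_le_card_nsmul _ _ _ fun h _ => le_trans ?_ (hw₁ h)
    rw [← Equiv.sum_comp (Equiv.addLeft (L h)) fun y => w (h, y)]
    rw [Equiv.coe_addLeft, ← Fintype.sum_subtype_add_sum_subtype (· ∈ H₀)]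
    exact le_add_of_nonneg_right (Finset.sum_nonneg fun _ _ => hw _)
  have hle_mean : ∑ v, (H : Set (V × W)).indicator w v ≤
      Fintype.card H₀ * ∑ h, 𝔼 u : H₀, w (h, L h + u) := by
    rw [hsum, Finset.mul_sum]
    refine (Finset.sum_le_sum fun h _ => (Fintype.card_mul_expect _).ge).trans ?_
    exact Finset.sum_le_sum_of_subset_of_nonneg (Finset.subset_univ _) fun h _ _ =>
      mul_nonneg (Nat.cast_nonneg _) (Finset.expect_nonneg fun u _ => hw _)
  have hnonneg : 0 ≤ ∑ v, (H : Set (V × W)).indicator w v :=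
    Finset.sum_nonneg fun v _ => Set.indicator_nonneg (fun v _ => hw v) v
  rw [sq, hcard, mul_assoc]
  exact mul_le_mul hle_base hle_mean hnonneg (Nat.cast_nonneg _)

end Fibres

lemma expect_comp_of_surjective {A B : Type*} [AddGroup A] [AddGroup B] [Fintype A] [Fintype B]
    {ρ : A →+ B} (hρ : Function.Surjective ρ) (F : B → ℝ) : 𝔼 a, F (ρ a) = 𝔼 b, F b := by
  have hshift : ∀ b, 𝔼 a, F (ρ a) = 𝔼 a, F (ρ a + b) := by
    intro b
    obtain ⟨a₀, rfl⟩ := hρ b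
    refine (Fintype.expect_equiv (Equiv.addRight a₀) _ _ fun a => ?_).symm
    rw [Equiv.coe_addRight, map_add]
  calc 𝔼 a, F (ρ a) = 𝔼 b, 𝔼 a, F (ρ a + b) := by simp only [← hshift, Fintype.expect_const]
    _ = 𝔼 a, 𝔼 b, F (ρ a + b) := Finset.expect_comm _ _ _
    _ = 𝔼 _a : A, 𝔼 b, F b := Finset.expect_congr rfl fun a _ =>
        Fintype.expect_equiv (Equiv.addLeft (ρ a)) _ _ fun _ => rfl
    _ = 𝔼 b, F b := Fintype.expect_const _

theorem exists_randomMatrix {K ι κ : Type*} [Field K] [Fintype K] [Fintype ι] [Fintype κ]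
    [DecidableEq ι] [DecidableEq κ] (H : Submodule K ((ι → K) × (κ → K))) :
    ∃ T : Matrix κ ι K → Matrix κ ι K, ∀ w : (ι → K) × (κ → K) → ℝ, (∀ v, 0 ≤ w v) →
      (∀ h, ∑ y, w (h, y) ≤ 1) → w 0 = 1 → ∀ ν : ℝ, 0 < ν →
      ν * Fintype.card (ι → K) * Nat.card H ≤
        (∑ v, (H : Set ((ι → K) × (κ → K))).indicator w v) ^ 2 →
      1 / 2 ≤ mass (uniformDist (Matrix κ ι K))
        {N | ν ^ 2 / (8 * Fintype.card K) * Fintype.card (ι → K) ≤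
          ∑ h, w (h, T N *ᵥ h)} := by
  classical
  obtain ⟨L, hL⟩ := exists_linearMap_mk_mem H
  set H₀ := H.comap (LinearMap.inr K (ι → K) (κ → K))
  obtain ⟨ρ, hρ⟩ := H₀.subtype.exists_leftInverse_of_injective H₀.ker_subtype
  refine ⟨fun N => LinearMap.toMatrix' L + LinearMap.toMatrix' (H₀.subtype.comp ρ) * N,
    fun w hw hw₁ hw₀ ν hν hH => ?_⟩
  have hT : ∀ (N : Matrix κ ι K) h,
      (LinearMap.toMatrix' L + LinearMap.toMatrix' (H₀.subtype.comp ρ) * N) *ᵥ h =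
        L h + ρ (N *ᵥ h) := by
    intro N h
    rw [Matrix.add_mulVec, ← Matrix.mulVec_mulVec, LinearMap.toMatrix'_mulVec,
      LinearMap.toMatrix'_mulVec]
    rfl
  simp only [hT]
  have hmean : ν * Fintype.card (ι → K) ≤ ∑ h, 𝔼 y, w (h, L h + ρ y) := by
    have hsurj : Function.Surjective ρ.toAddMonoidHom := fun u => ⟨u, LinearMap.congr_fun hρ u⟩
    have hexpect : ∀ h, 𝔼 y, w (h, L h + ρ y) = 𝔼 u : H₀, w (h, L h + u) := fun h =>
      expect_comp_of_surjective hsurj fun u : H₀ => w (h, L h + u)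
    simp only [hexpect]
    have hpos : (0 : ℝ) < Nat.card H := by exact_mod_cast Nat.card_pos
    refine le_of_mul_le_mul_right (hH.trans ?_) hpos
    rw [mul_comm _ (Nat.card H : ℝ)]
    exact sq_sum_indicator_submodule_le hL hw hw₁
  refine half_le_mass_uniformDist_le_sum_mulVec (g := fun h y => w (h, L h + ρ y))
    (fun h y => ⟨hw _, ?_⟩) ?_ hν hmean
  · exact (Finset.single_le_sum (f := fun y => w (h, y)) (fun y _ => hw _)
      (Finset.mem_univ _)).trans (hw₁ h)
  · simpa only [map_zero, Submodule.coe_zero, add_zero, Prod.mk_zero_zero] using hw₀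

end RandomGraph

section MatrixAlgorithm

variable {p n : ℕ} [Fact p.Prime]

lemma exists_randomMatrix_derivWeight
    (H : Submodule (ZMod p) ((Fin n → ZMod p) × (Fin n → ZMod p))) :
    ∃ T : Matrix (Fin n) (Fin n) (ZMod p) → Matrix (Fin n) (Fin n) (ZMod p),
      ∀ f : (Fin n → ZMod p) → ℂ, (∀ x, ‖f x‖ = 1) → ∀ μ R : ℝ, 0 < μ →
        μ ≤ mass (derivDist f) (H : Set _) → (Nat.card H : ℝ) ≤ R * (p : ℝ) ^ n →
        1 / 2 ≤ mass (uniformDist (Matrix (Fin n) (Fin n) (ZMod p)))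
          {N | (μ ^ 2 / R) ^ 2 / (8 * p) ≤ ((p : ℝ) ^ n)⁻¹ * ∑ h, derivWeight f (h, T N *ᵥ h)} := by
  have hq := card_pow_pos p n
  obtain ⟨T, hT⟩ := exists_randomMatrix H
  refine ⟨T, fun f hf μ R hμ hmass hcard => ?_⟩
  have hR : 0 < R :=
    pos_of_mul_pos_left ((Nat.cast_pos.2 Nat.card_pos).trans_le hcard) hq.le
  have hsum : μ * (p : ℝ) ^ n ≤ ∑ v, (H : Set _).indicator (derivWeight f) v := by
    rwa [← le_inv_mul_iff₀' hq, ← mass_derivDist]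
  have hhalf := hT (derivWeight f) (derivWeight_nonneg f) (fun h => (sum_derivWeight hf h).le)
    (derivWeight_zero hf) (μ ^ 2 / R) (by positivity) (by
      rw [Fintype.card_fun, ZMod.card, Fintype.card_fin, Nat.cast_pow]
      calc μ ^ 2 / R * (p : ℝ) ^ n * Nat.card H
          ≤ μ ^ 2 / R * (p : ℝ) ^ n * (R * (p : ℝ) ^ n) := by gcongr
        _ = (μ * (p : ℝ) ^ n) ^ 2 := by field_simp
        _ ≤ _ := by gcongr)
  rw [Fintype.card_fun, ZMod.card, Fintype.card_fin, Nat.cast_pow] at hhalf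
  simpa only [le_inv_mul_iff₀' hq] using hhalf

lemma two_mul_exp_neg_two_le : 2 * Real.exp (-2) ≤ 1 / 2 := by
  have hexp : 2 * Real.exp (-1) ≤ 1 := by
    rw [Real.exp_neg, mul_inv_le_iff₀ (Real.exp_pos 1)]
    linarith [Real.add_one_le_exp (1 : ℝ)]
  calc 2 * Real.exp (-2) = (2 * Real.exp (-1)) * (2 * Real.exp (-1)) / 2 := by
        rw [show (-2 : ℝ) = -1 + -1 by norm_num, Real.exp_add]
        ring
    _ ≤ 1 * 1 / 2 := by gcongr
    _ = 1 / 2 := by norm_num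

theorem exists_matrixAlgorithm (p n m : ℕ) [Fact p.Prime] (θ R : ℝ) (hθ : 0 < θ)
    (hm : 8 * ((n : ℝ) + 1) ≤ θ * m) (hmθ : 128 ≤ m * θ ^ 2) :
    ∃ A : QueryAlgorithm (Fin n → ZMod p) (Matrix (Fin n) (Fin n) (ZMod p)), A.queries = m * p ∧
      ∀ f : (Fin n → ZMod p) → ℂ, (∀ x, f x ^ p = 1) →
        ∀ H : Submodule (ZMod p) ((Fin n → ZMod p) × (Fin n → ZMod p)),
        θ ≤ mass (derivDist f) (H : Set _) → (Nat.card H : ℝ) ≤ R * (p : ℝ) ^ n →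
        1 / 4 ≤ A.prob (phaseOracle f) {M | (Real.exp (-(24 / θ)) ^ 2 / R) ^ 2 / (8 * p) ≤
          ((p : ℝ) ^ n)⁻¹ * ∑ h, derivWeight f (h, M *ᵥ h)} := by
  choose T hT using exists_randomMatrix_derivWeight (p := p) (n := n)
  have hm₀ : 0 < m := Nat.pos_of_ne_zero fun h => by norm_num [h] at hmθ
  let IsDense (s : Fin m → (Fin n → ZMod p) × (Fin n → ZMod p))
      (H : Submodule (ZMod p) ((Fin n → ZMod p) × (Fin n → ZMod p))) : Prop :=
    (Nat.card H : ℝ) ≤ R * (p : ℝ) ^ n ∧ θ * m / 2 < (Nat.card {i | s i ∈ H} : ℝ)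
  obtain ⟨A, hA, hprob⟩ := exists_phaseSampling (p := p) (n := n) m
    fun s N => T (Classical.epsilon (IsDense s)) (N ⟨0, hm₀⟩)
  refine ⟨A, hA, fun f hf H hmass hcard => ?_⟩
  have hf₁ : ∀ x, ‖f x‖ = 1 := fun x => norm_eq_one_of_pow_prime_eq_one (hf x)
  have huniform := uniformDist_mem_stdSimplex (Matrix (Fin n) (Fin n) (ZMod p))
  have hsample := le_mass_iid_subspace (ι := Fin m) (derivDist_mem_stdSimplex hf₁) hθ
    (by rw [Fintype.card_fin]; linarith [(Nat.cast_nonneg n : (0 : ℝ) ≤ n)])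
    (by simp only [Module.finrank_prod, Module.finrank_fin_fun, Fintype.card_fin]
        push_cast
        linarith) hmass
  rw [Fintype.card_fin] at hsample
  have hexp : 2 * Real.exp (-(m * θ ^ 2 / 64)) ≤ 1 / 2 :=
    le_trans (by gcongr; linarith) two_mul_exp_neg_two_le
  rw [hprob f hf, show (1 / 4 : ℝ) = 1 / 2 * (1 / 2) by norm_num]
  refine mul_le_mass_prodDist (iid_mem_stdSimplex (derivDist_mem_stdSimplex hf₁)).1
    (iid_mem_stdSimplex huniform).1 (by norm_num) ((by linarith : (1 / 2 : ℝ) ≤ _).trans hsample)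
    fun s hs => ?_
  have hdense : IsDense s (Classical.epsilon (IsDense s)) :=
    Classical.epsilon_spec (p := IsDense s) ⟨H, hcard, hs.1⟩
  refine (hT _ f hf₁ _ R (Real.exp_pos _) (hs.2 _ hdense.2) hdense.1).trans_eq ?_
  exact (mass_iid_eval_mem huniform.2 (⟨0, hm₀⟩ : Fin m) _).symm

end MatrixAlgorithm

section DerivativeMatrix

variable {p n : ℕ} [Fact p.Prime] {f : (Fin n → ZMod p) → ℂ} {γ : ℝ}

lemma IsPolynomialPhase.pow_eq_one (hf : IsPolynomialPhase f) (x : Fin n → ZMod p) :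
    f x ^ p = 1 := by
  obtain ⟨P, -, hP⟩ := hf
  rw [hP, ← AddChar.map_nsmul_eq_pow, nsmul_eq_mul, CharP.cast_eq_zero, zero_mul,
    AddChar.map_zero_eq_one]

lemma gowersAverage_three_re_nonneg (f : (Fin n → ZMod p) → ℂ) : 0 ≤ (gowersAverage 3 f).re := by
  rw [gowersAverage_three, Complex.ofReal_re]
  exact Finset.sum_nonneg fun v _ => mul_nonneg
    (mul_nonneg (inv_nonneg.2 (card_pow_pos p n).le) (derivWeight_nonneg f v))
    (derivWeight_nonneg f v)

lemma gowersNorm_three_le_one (hf : ∀ x, ‖f x‖ = 1) : gowersNorm 3 f ≤ 1 :=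
  Real.rpow_le_one (gowersAverage_three_re_nonneg f) (gowersAverage_three_re_le_one hf)
    (by norm_num)

lemma pow_le_gowersAverage_three (hγ : 0 ≤ γ) (h : γ ≤ gowersNorm 3 f) :
    γ ^ 8 ≤ (gowersAverage 3 f).re := by
  calc γ ^ 8 ≤ gowersNorm 3 f ^ 8 := by gcongr
    _ = (gowersAverage 3 f).re := by
      rw [gowersNorm, ← Real.rpow_natCast, ← Real.rpow_mul (gowersAverage_three_re_nonneg f)]
      norm_num

lemma expect_norm_fourierCoeff_mulDeriv_sq (f : (Fin n → ZMod p) → ℂ)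
    (M : Matrix (Fin n) (Fin n) (ZMod p)) :
    𝔼 h, ‖fourierCoeff (mulDeriv h f) (M *ᵥ h)‖ ^ 2 =
      ((p : ℝ) ^ n)⁻¹ * ∑ h, derivWeight f (h, M *ᵥ h) :=
  expect_eq_inv_mul_sum _

lemma exp_neg_le_sq_div_sq_div (a b : ℝ) {c : ℝ} (hc : 0 < c) :
    Real.exp (-(4 * a + 2 * b + c)) ≤ (Real.exp (-a) ^ 2 / Real.exp b) ^ 2 / c := by
  have hfraction : (Real.exp (-a) ^ 2 / Real.exp b) ^ 2 = Real.exp (-(4 * a + 2 * b)) := by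
    rw [← Real.exp_nat_mul, ← Real.exp_sub, ← Real.exp_nat_mul]
    congr 1
    push_cast
    ring
  rw [hfraction, le_div_iff₀ hc]
  calc Real.exp (-(4 * a + 2 * b + c)) * c
      ≤ Real.exp (-(4 * a + 2 * b + c)) * Real.exp c := by
        gcongr
        linarith [Real.add_one_le_exp c]
    _ = Real.exp (-(4 * a + 2 * b)) := by
        rw [← Real.exp_add]
        congr 1
        ring

lemma exists_sampleSize {t : ℝ} (ht : 1 ≤ t) :
    ∃ N : ℕ, (N : ℝ) ≤ 2 ^ 22 * t ^ 64 ∧ 8 ≤ 1 / (128 * t ^ 32) * N ∧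
      128 ≤ N * (1 / (128 * t ^ 32)) ^ 2 := by
  have ht₀ : 0 < t := by linarith
  have ht₃₂ : 1 ≤ t ^ 32 := one_le_pow₀ ht
  have hceil : 2 ^ 21 * t ^ 64 ≤ (⌈2 ^ 21 * t ^ 64⌉₊ : ℝ) := Nat.le_ceil _
  refine ⟨⌈2 ^ 21 * t ^ 64⌉₊, ?_, ?_, ?_⟩
  · have := Nat.ceil_lt_add_one (by positivity : 0 ≤ 2 ^ 21 * t ^ 64)
    linarith [one_le_pow₀ ht (n := 64)]
  · rw [one_div_mul_eq_div, le_div_iff₀ (by positivity)]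
    nlinarith
  · rw [div_pow, mul_pow, one_pow, mul_one_div, le_div_iff₀ (by positivity)]
    linarith

lemma exponent_le {q t : ℝ} (hq : 1 ≤ q) (ht : 1 ≤ t) :
    4 * (24 / (1 / (128 * t ^ 32))) + 2 * (4 * q * (2 ^ 22 / (1 / (2 * t ^ 8)) ^ 24) ^ 5) +
      8 * q ≤ 2 ^ 234 * q * t ^ 960 := by
  have ht₀ : 0 < t := by linarith
  have hsimp : 4 * (24 / (1 / (128 * t ^ 32))) +
      2 * (4 * q * (2 ^ 22 / (1 / (2 * t ^ 8)) ^ 24) ^ 5) =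
        12288 * t ^ 32 + 2 ^ 233 * q * t ^ 960 := by
    field_simp
    ring
  have hpow : t ^ 32 ≤ t ^ 960 := pow_le_pow_right₀ ht (by norm_num)
  have hfirst : 12288 * t ^ 32 ≤ 12288 * (q * t ^ 960) :=
    mul_le_mul_of_nonneg_left (hpow.trans (le_mul_of_one_le_left (by positivity) hq))
      (by norm_num)
  have hlast : 8 * q ≤ 8 * (q * t ^ 960) := by
    gcongr
    exact le_mul_of_one_le_right (by linarith) (one_le_pow₀ ht)
  rw [hsimp]
  linarith [(by positivity : 0 ≤ q * t ^ 960)]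

theorem exists_derivativeMatrix (p n : ℕ) [Fact p.Prime] {t : ℝ} (ht : 1 ≤ t) :
    ∃ A : QueryAlgorithm (Fin n → ZMod p) (Matrix (Fin n) (Fin n) (ZMod p)),
      (A.queries : ℝ) ≤ 2 ^ 22 * p * t ^ 64 * (n + 1) ∧
      ∀ f : (Fin n → ZMod p) → ℂ, (∀ x, f x ^ p = 1) → 1 / t ≤ gowersNorm 3 f →
        1 / 4 ≤ A.prob (phaseOracle f)
          {M | Real.exp (-(2 ^ 234 * p * t ^ 960)) ≤
            𝔼 h, ‖fourierCoeff (mulDeriv h f) (M *ᵥ h)‖ ^ 2} := by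
  have ht₀ : 0 < t := by linarith
  have hp : (1 : ℝ) ≤ p := by exact_mod_cast (Fact.out : p.Prime).one_le
  set α : ℝ := 1 / (2 * t ^ 8) with hα
  set θ : ℝ := 1 / (128 * t ^ 32) with hθ
  obtain ⟨N, hN, hθN, hθN₂⟩ := exists_sampleSize ht
  obtain ⟨A, hA, hprob⟩ := exists_matrixAlgorithm p n (N * (n + 1)) θ
    (Real.exp (4 * p * (2 ^ 22 / α ^ 24) ^ 5)) (by positivity)
    (by push_cast; rw [← mul_assoc]; gcongr)
    (by push_cast; nlinarith [(Nat.cast_nonneg n : (0 : ℝ) ≤ n)])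
  refine ⟨A, ?_, fun f hf hU => ?_⟩
  · rw [hA]
    push_cast
    calc (N : ℝ) * (n + 1) * p ≤ 2 ^ 22 * t ^ 64 * (n + 1) * p := by gcongr
      _ = 2 ^ 22 * p * t ^ 64 * (n + 1) := by ring
  · have hgowers : 2 * α ≤ (gowersAverage 3 f).re := by
      refine le_of_eq_of_le ?_ (pow_le_gowersAverage_three (by positivity) hU)
      rw [hα]
      field_simp
    obtain ⟨H, hmass, hcard⟩ := exists_subspace_le_mass_derivDist
      (fun x => norm_eq_one_of_pow_prime_eq_one (hf x)) (by positivity) hgowers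
    have hθα : θ = α ^ 4 / 8 := by
      rw [hθ, hα]
      field_simp
      norm_num
    refine (hprob f hf H (hθα ▸ hmass) hcard).trans (A.prob_mono _ fun M hM => ?_)
    rw [Set.mem_ofPred_eq, expect_norm_fourierCoeff_mulDeriv_sq]
    refine le_trans ?_ hM
    refine le_trans (Real.exp_le_exp.2 (neg_le_neg (exponent_le hp ht))) ?_
    exact exp_neg_le_sq_div_sq_div _ _ (by positivity)

theorem exists_derivativeMatrix_of_le_gowersNorm (p : ℕ) [Fact p.Prime] :
    ∃ K : ℕ, 4 ≤ K ∧ ∀ γ : ℝ, 0 < γ → ∀ n : ℕ,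
    ∃ A : QueryAlgorithm (Fin n → ZMod p) (Matrix (Fin n) (Fin n) (ZMod p)),
      (1 ≤ n → 2 * (A.queries : ℝ) ≤ K * (1 / γ) ^ K * n) ∧
      ∀ f : (Fin n → ZMod p) → ℂ, (∀ x, f x ^ p = 1) → γ ≤ gowersNorm 3 f →
        1 / 4 ≤ A.prob (phaseOracle f) {M | Real.exp (-(K * (1 / γ) ^ K)) ≤
          𝔼 h, ‖fourierCoeff (mulDeriv h f) (M *ᵥ h)‖ ^ 2} := by
  obtain ⟨K, hK, hpK⟩ : ∃ K : ℕ, 960 ≤ K ∧ (2 : ℝ) ^ 234 * p ≤ K := by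
    refine ⟨2 ^ 234 * p, ?_, le_of_eq (by norm_cast)⟩
    exact le_trans (by norm_num) (Nat.le_mul_of_pos_right _ (Fact.out : p.Prime).pos)
  refine ⟨K, by omega, fun γ hγ n => ?_⟩
  rcases lt_or_ge 1 γ with hγ₁ | hγ₁
  · obtain ⟨A, hA, -⟩ := exists_phaseSampling (p := p) (n := n) (Z := Unit) 0
      fun _ _ => (0 : Matrix (Fin n) (Fin n) (ZMod p))
    refine ⟨A, fun _ => ?_, fun f hf hU => absurd hU (not_le.2 (lt_of_le_of_lt ?_ hγ₁))⟩
    · rw [hA, zero_mul, Nat.cast_zero, mul_zero]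
      positivity
    · exact gowersNorm_three_le_one fun x => norm_eq_one_of_pow_prime_eq_one (hf x)
  · have ht : 1 ≤ 1 / γ := one_le_one_div hγ hγ₁
    obtain ⟨A, hA, hprob⟩ := exists_derivativeMatrix p n ht
    refine ⟨A, fun hn => ?_, fun f hf hU => ?_⟩
    · have hn₁ : (1 : ℝ) ≤ n := by exact_mod_cast hn
      calc 2 * (A.queries : ℝ) ≤ 2 * (2 ^ 22 * p * (1 / γ) ^ 64 * (n + n)) := by
            refine mul_le_mul_of_nonneg_left (hA.trans ?_) two_pos.le
            gcongr
        _ = 2 ^ 24 * p * (1 / γ) ^ 64 * n := by ring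
        _ ≤ K * (1 / γ) ^ K * n := by
            gcongr
            · exact le_trans (by gcongr <;> norm_num) hpK
            · exact le_trans (by norm_num) hK
    · refine (hprob f hf (by rwa [one_div_one_div])).trans (A.prob_mono _ fun M hM => ?_)
      exact le_trans (Real.exp_le_exp.2 (neg_le_neg (mul_le_mul hpK (pow_le_pow_right₀ ht hK)
        (by positivity) (by positivity)))) hM

lemma le_mul_mul_log {n : ℕ} (hn : 2 ≤ n) {a c : ℝ} (hc : 0 ≤ c) (h : 2 * a ≤ c * n) :
    a ≤ c * (n * Real.log n) := by
  have hlog : Real.log 2 ≤ Real.log n := Real.log_le_log two_pos (by exact_mod_cast hn)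
  have hhalf : 1 / 2 ≤ Real.log n := by linarith [Real.log_two_gt_d9]
  calc a ≤ c * (n * (1 / 2)) := by linarith
    _ ≤ c * (n * Real.log n) := by gcongr

end DerivativeMatrix

end QuadraticDecoding

end

theorem theorem5p1p1_general :
    (∃ C : ℝ, 0 < C ∧ ∀ ε : ℝ, 0 < ε →
      ∃ K : ℝ, 0 < K ∧ ∀ n : ℕ,
        ∃ A : QuadraticDecoding.QueryAlgorithm ((Fin n → ZMod 2) × ZMod 2)
            (MvPolynomial (Fin n) (ZMod 2)),
          (1 ≤ n → (A.queries : ℝ) ≤ K * n) ∧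
          ∀ f : (Fin n → ZMod 2) → ZMod 2,
            QuadraticDecoding.distRM2 f ≤ 1 / 2 - ε →
            2 / 3 ≤ A.prob (QuadraticDecoding.bitOracle f)
              {g | g.totalDegree ≤ 2 ∧
                QuadraticDecoding.relDist f (fun x => MvPolynomial.eval x g) ≤
                  1 / 2 - Real.exp (-(1 / ε ^ C))}) ∧
    (∀ (p : ℕ) [Fact p.Prime], ∃ K : ℕ, 4 ≤ K ∧ ∀ γ : ℝ, 0 < γ → ∀ n : ℕ,
      ∃ A : QuadraticDecoding.QueryAlgorithm (Fin n → ZMod p) (Matrix (Fin n) (Fin n) (ZMod p)),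
        (1 ≤ n → 2 * (A.queries : ℝ) ≤ K * (1 / γ) ^ K * n) ∧
        ∀ f : (Fin n → ZMod p) → ℂ, (∀ x, f x ^ p = 1) →
          γ ≤ QuadraticDecoding.gowersNorm 3 f →
          1 / 4 ≤ A.prob (QuadraticDecoding.phaseOracle f)
            {M | Real.exp (-(K * (1 / γ) ^ K)) ≤
              𝔼 h : Fin n → ZMod p,
                ‖QuadraticDecoding.fourierCoeff (QuadraticDecoding.mulDeriv h f) (M *ᵥ h)‖ ^ 2}) :=
  ⟨⟨6, by norm_num, fun _ hε => QuadraticDecoding.exists_quadraticDecoding hε⟩,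
    fun p _ => QuadraticDecoding.exists_derivativeMatrix_of_le_gowersNorm p⟩

theorem theorem5p1p1 :
    -- decoding: from distance `1/2 - ε` to distance `1/2 - η`, where `η = exp (-1/ε^C)`
    (∃ C : ℝ, 0 < C ∧ ∀ ε : ℝ, 0 < ε →
      ∃ K : ℝ, 0 < K ∧ ∀ n : ℕ,
        ∃ A : QuadraticDecoding.QueryAlgorithm ((Fin n → ZMod 2) × ZMod 2)
            (MvPolynomial (Fin n) (ZMod 2)),
          (2 ≤ n → (A.queries : ℝ) ≤ K * (n * Real.log n)) ∧
          ∀ f : (Fin n → ZMod 2) → ZMod 2,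
            QuadraticDecoding.distRM2 f ≤ 1 / 2 - ε →
            2 / 3 ≤ A.prob (QuadraticDecoding.bitOracle f)
              {g | g.totalDegree ≤ 2 ∧
                QuadraticDecoding.relDist f (fun x => MvPolynomial.eval x g) ≤
                  1 / 2 - Real.exp (-(1 / ε ^ C))}) ∧
    -- the core lemma, for every prime `p`
    (∀ (p : ℕ) [Fact p.Prime], ∃ K : ℕ, 0 < K ∧ ∀ γ : ℝ, 0 < γ → ∀ n : ℕ,
      ∃ A : QuadraticDecoding.QueryAlgorithm (Fin n → ZMod p) (Matrix (Fin n) (Fin n) (ZMod p)),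
        (2 ≤ n → (A.queries : ℝ) ≤ K * (1 / γ) ^ K * (n * Real.log n)) ∧
        ∀ f : (Fin n → ZMod p) → ℂ,
          QuadraticDecoding.IsPolynomialPhase f →
          γ ≤ QuadraticDecoding.gowersNorm 3 f →
          γ ^ K / K ≤ A.prob (QuadraticDecoding.phaseOracle f)
            {M | Real.exp (-(K * (1 / γ) ^ K)) ≤
              Finset.expect Finset.univ fun h : Fin n → ZMod p =>
                ‖QuadraticDecoding.fourierCoeff (QuadraticDecoding.mulDeriv h f) (M *ᵥ h)‖ ^ 2}) := by
  obtain ⟨⟨C, hC, hdecode⟩, hmatrix⟩ := theorem5p1p1_general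
  refine ⟨⟨C, hC, fun ε hε => ?_⟩, fun p _ => ?_⟩
  · obtain ⟨K, hK, hdecode⟩ := hdecode ε hε
    exact ⟨2 * K, by positivity, fun n => (hdecode n).imp fun A hA => ⟨fun hn =>
      QuadraticDecoding.le_mul_mul_log hn (by positivity) (by linarith [hA.1 (by omega)]), hA.2⟩⟩
  · obtain ⟨K, hK, hmatrix⟩ := hmatrix p
    refine ⟨K, by omega, fun γ hγ n => (hmatrix γ hγ n).imp fun A hA => ⟨fun hn =>
      QuadraticDecoding.le_mul_mul_log hn (by positivity) (hA.1 (by omega)), fun f hf hU => ?_⟩⟩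
    have hγ₁ : γ ≤ 1 := hU.trans (QuadraticDecoding.gowersNorm_three_le_one fun x =>
      QuadraticDecoding.norm_eq_one_of_pow_prime_eq_one (hf.pow_eq_one x))
    exact (div_le_div₀ zero_le_one (pow_le_one₀ hγ.le hγ₁) four_pos (by exact_mod_cast hK)).trans
      (hA.2 f hf.pow_eq_one hU)
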